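/- Let $n\ge 1$, let $M(n)$ be the Lie algebra of complex $n\times n$ matrices, put $d(k)=k(k+1)/2$, and let $x_m$ denote the upper left $m\times m$ corner of $x\in M(n)$. Write $\det(\lambda-x_m)=\lambda^m+\sum_{k=1}^m(-1)^{m-k+1}f_{k,m}(x)\lambda^{k-1}$. A matrix $x\in M(n)$ is called regular if its centralizer in $M(n)$ has dimension $n$, and strongly regular if the differentials at $x$ of the $d(n)$ functions $f_{k,m}$, $1\le k\le m\le n$, are linearly independent. Let $O_x$ be the orbit of $x$ under conjugation by $GL_n(\mathbb C)$, and let $O_x^{sreg}$ be the set of strongly regular elements of $O_x$. Give $M(n)$ the Poisson structure for which the entries $\alpha_{ij}$ satisfy $[\alpha_{ij},\alpha_{st}]=\delta_{js}\alpha_{it}-\delta_{it}\alpha_{sj}$, and let $\xi_f$ be the vector field with $\xi_f g=[f,g]$. When $x$ is regular, the orbit $O_x$ is a complex submanifold of $M(n)$ of dimension $2d(n-1)$, and it carries the holomorphic symplectic form $\omega_y([a,y],[b,y])=\operatorname{tr}(y[a,b])$, $y\in O_x$, $a,b\in M(n)$. Let $f_{(k,m)}(x)=\frac1{m+1-k}\operatorname{tr}\big((x_m)^{m+1-k}\big)$.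 The vector fields $\xi_{f_{(k,m)}}$, $1\le k\le m\le n-1$, integrate to a holomorphic action on $M(n)$ of the simply connected abelian group $A=\mathbb C^{d(n-1)}$. Theorem 3.36 (Theorem 0.15). Let $x\in M(n)$. Then $O_x^{sreg}$ is nonempty if and only if $x$ is regular. If $x$ is regular, then $O_x^{sreg}$ is an open dense subset of $O_x$, and with $\omega$ it is a $2d(n-1)$-dimensional complex symplectic manifold. Furthermore, $O_x^{sreg}$ is stable under $A$, the $A$-orbits in $O_x^{sreg}$ are complex submanifolds of dimension $d(n-1)$, and they are exactly the leaves (maximal connected integral manifolds) of a polarization of $O_x^{sreg}$, i.e. of a holomorphic involutive distribution of Lagrangian subspaces of the tangent spaces. -/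

import Mathlib

open scoped Topology Matrix.Norms.Operator

/-! ### Complex submanifolds, symplectic forms, polarizations -/

section Geometry

variable {E : Type*} [NormedAddCommGroup E] [NormedSpace ℂ E]

/-- `S` is an (embedded) complex submanifold of `E` of dimension `d`: around every point of `S`
there are biholomorphic coordinates of `E` in which `S` is a `d`-dimensional linear subspace. -/
def IsComplexSubmanifold (S : Set E) (d : ℕ) : Prop :=
  ∀ y ∈ S, ∃ (Φ : OpenPartialHomeomorph E E) (W : Submodule ℂ E),
    y ∈ Φ.source ∧ AnalyticOnNhd ℂ Φ Φ.source ∧ AnalyticOnNhd ℂ Φ.symm Φ.target ∧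
    Module.finrank ℂ W = d ∧ Φ '' (S ∩ Φ.source) = (W : Set E) ∩ Φ.target

/-- The (holomorphic) tangent space at `y` of a complex submanifold `S` of `E`: the velocities at
`0` of the germs of holomorphic curves in `S` through `y`. -/
def tangentVectors (S : Set E) (y : E) : Set E :=
  {v | ∃ γ : ℂ → E, AnalyticAt ℂ γ 0 ∧ γ 0 = y ∧ (∀ᶠ t in 𝓝 (0 : ℂ), γ t ∈ S) ∧ deriv γ 0 = v}

/-- The pullback `φ^* ω` of a 2-form along `φ`. If `φ` is a holomorphic map from an open set into
a complex submanifold `S`, then it involves only the values of `ω` on tangent vectors of `S`. -/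
noncomputable def pullbackForm {V : Type*} [NormedAddCommGroup V] [NormedSpace ℂ V]
    (ω : E → E [⋀^Fin 2]→L[ℂ] ℂ) (φ : V → E) (u : V) : V [⋀^Fin 2]→L[ℂ] ℂ :=
  (ω (φ u)).compContinuousLinearMap (fderiv ℂ φ u)

/-- `ω` defines a holomorphic symplectic form on the `d`-dimensional complex submanifold `S`.
A 2-form on `S` is given here by alternating forms `ω y` on the ambient space, of which only the
restrictions to the tangent spaces of `S` matter. Holomorphy and closedness are those of the
pullbacks along holomorphic maps into `S` (in particular along local parametrizations of `S`). -/
structure IsHolomorphicSymplectic (S : Set E) (d : ℕ) (ω : E → E [⋀^Fin 2]→L[ℂ] ℂ) : Prop where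
  holomorphic : ∀ (U : Set (Fin d → ℂ)) (φ : (Fin d → ℂ) → E), IsOpen U → AnalyticOnNhd ℂ φ U →
    Set.MapsTo φ U S → AnalyticOnNhd ℂ (pullbackForm ω φ) U
  closed : ∀ (U : Set (Fin d → ℂ)) (φ : (Fin d → ℂ) → E), IsOpen U → AnalyticOnNhd ℂ φ U →
    Set.MapsTo φ U S → ∀ u ∈ U, extDeriv (pullbackForm ω φ) u = 0
  nondegenerate : ∀ y ∈ S, ∀ u ∈ tangentVectors S y,
    (∀ v ∈ tangentVectors S y, ω y ![u, v] = 0) → u = 0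

/-- `F` is a (holomorphic) polarization, of rank `k`, of the complex submanifold `S` with the
symplectic form `ω`: a holomorphic involutive distribution of Lagrangian subspaces of the tangent
spaces of `S`. Only the subspaces `F y` for `y ∈ S` matter. -/
structure IsPolarization (S : Set E) (ω : E → E [⋀^Fin 2]→L[ℂ] ℂ) (k : ℕ)
    (F : E → Submodule ℂ E) : Prop where
  /-- `F y` is contained in, and equal to its own `ω`-orthogonal complement in, the tangent space
  of `S` at `y`. -/
  lagrangian : ∀ y ∈ S, ∀ u : E,
    u ∈ F y ↔ u ∈ tangentVectors S y ∧ ∀ v ∈ F y, ω y ![u, v] = 0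
  /-- `F` is a holomorphic subbundle of rank `k`: it has local holomorphic frames. -/
  holomorphic : ∀ y ∈ S, ∃ (U : Set E) (X : Fin k → E → E), IsOpen U ∧ y ∈ U ∧
    (∀ i, AnalyticOnNhd ℂ (X i) U) ∧
    ∀ z ∈ S ∩ U, LinearIndependent ℂ (fun i => X i z) ∧
      F z = Submodule.span ℂ (Set.range fun i => X i z)
  /-- The local holomorphic sections of `F` are closed under the Lie bracket. -/
  involutive : ∀ (U : Set E) (X Y : E → E), IsOpen U → AnalyticOnNhd ℂ X U → AnalyticOnNhd ℂ Y U →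
    (∀ z ∈ S ∩ U, X z ∈ F z ∧ Y z ∈ F z) → ∀ z ∈ S ∩ U, VectorField.lieBracket ℂ X Y z ∈ F z

/-- `L` is a connected integral manifold in `S` of the distribution `F` of rank `k`. -/
structure IsIntegralManifold (S : Set E) (k : ℕ) (F : E → Submodule ℂ E) (L : Set E) : Prop where
  subset : L ⊆ S
  connected : IsConnected L
  submanifold : IsComplexSubmanifold L k
  tangent : ∀ y ∈ L, tangentVectors L y = (F y : Set E)

/-- `L` is an (embedded) leaf in `S` of the distribution `F` of rank `k`: a maximal connected
integral manifold. -/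
structure IsLeaf (S : Set E) (k : ℕ) (F : E → Submodule ℂ E) (L : Set E) : Prop where
  integral : IsIntegralManifold S k F L
  maximal : ∀ L' : Set E, IsIntegralManifold S k F L' → (L ∩ L').Nonempty → L' ⊆ L

end Geometry

/-! ### Regular and strongly regular matrices, the Gelfand-Zeitlin action -/

/-- The algebra `M(n)` of complex `n × n` matrices. -/
abbrev Mat (n : ℕ) : Type := Matrix (Fin n) (Fin n) ℂ

/-- `d(k) = k (k + 1) / 2`. -/
def dd (k : ℕ) : ℕ := k * (k + 1) / 2

/-- The upper left `m × m` corner `x_m` of `x`. -/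
def cutoff {n : ℕ} (m : ℕ) (h : m ≤ n) (x : Mat n) : Mat m :=
  x.submatrix (Fin.castLE h) (Fin.castLE h)

/-- The `d(n)` functions `f_{k,m}`, `1 ≤ k ≤ m ≤ n`, where
`det (λ - x_m) = λ ^ m + ∑_{k=1}^m (-1) ^ (m-k+1) f_{k,m}(x) λ ^ (k-1)`. In the index
`i = ⟨m - 1, k - 1⟩` both `m` and `k` are shifted by one. -/
noncomputable def charCoeff {n : ℕ} (i : (m : Fin n) × Fin (m + 1)) (x : Mat n) : ℂ :=
  (-1) ^ ((i.1 : ℕ) - i.2 + 1) * (cutoff (i.1 + 1) i.1.isLt x).charpoly.coeff i.2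

/-- `x` is regular: its centralizer in `M(n)` has dimension `n`. -/
def IsRegularMat {n : ℕ} (x : Mat n) : Prop :=
  Module.finrank ℂ (Subalgebra.centralizer ℂ {x}) = n

/-- `x` is strongly regular: the differentials at `x` of the `d(n)` functions `f_{k,m}` are
linearly independent. -/
def IsStronglyRegular {n : ℕ} (x : Mat n) : Prop :=
  LinearIndependent ℂ fun i : (m : Fin n) × Fin (m + 1) => fderiv ℂ (charCoeff i) x

/-- The adjoint orbit `O_x`. -/
def adjointOrbit {n : ℕ} (x : Mat n) : Set (Mat n) :=
  {y | ∃ g : GL (Fin n) ℂ, y = (g : Mat n) * x * ((g⁻¹ : GL (Fin n) ℂ) : Mat n)}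

/-- The set `O_x^{sreg}` of the strongly regular matrices in `O_x`. -/
def sregOrbit {n : ℕ} (x : Mat n) : Set (Mat n) :=
  {y | y ∈ adjointOrbit x ∧ IsStronglyRegular y}

/-- The Poisson bracket on `M(n)`, determined by
`[α_ij, α_st] = δ_js α_it - δ_it α_sj` for the matrix entries `α_ij`. -/
noncomputable def poissonBracket {n : ℕ} (f g : Mat n → ℂ) (x : Mat n) : ℂ :=
  ∑ i, ∑ j, ∑ s, ∑ t,
    fderiv ℂ f x (Matrix.single i j 1) * fderiv ℂ g x (Matrix.single s t 1) *
      ((if j = s then x i t else 0) - (if i = t then x s j else 0))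

/-- The Hamiltonian vector field `ξ_f`, with `ξ_f g = [f, g]`; its `(s, t)` entry is therefore
`[f, α_st]`. -/
noncomputable def hamiltonianField {n : ℕ} (f : Mat n → ℂ) (x : Mat n) : Mat n :=
  Matrix.of fun s t => poissonBracket f (fun y => y s t) x

/-- Index set of the `d(n - 1)` pairs `(k, m)` with `1 ≤ k ≤ m ≤ n - 1`, as `⟨m - 1, k - 1⟩`. -/
abbrev GZIndex (n : ℕ) : Type := (m : Fin (n - 1)) × Fin (m + 1)

/-- `f_{(k,m)}(x) = tr (x_m ^ (m + 1 - k)) / (m + 1 - k)` for `1 ≤ k ≤ m ≤ n - 1`. -/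
noncomputable def traceFun {n : ℕ} (i : GZIndex n) (x : Mat n) : ℂ :=
  (1 / (((i.1 : ℕ) + 1 - i.2 : ℕ) : ℂ)) *
    (cutoff (i.1 + 1) (by omega) x ^ ((i.1 : ℕ) + 1 - i.2)).trace

/-- `σ` is the holomorphic action on `M(n)` of the simply connected group `A = ℂ ^ {d(n-1)}` which
integrates the commuting vector fields `ξ_{(k,m)}`, `1 ≤ k ≤ m ≤ n - 1`: the `(k,m)` coordinates
of `a ∈ A` are the coefficients of the vector field generating `t ↦ σ (t a)`. -/
structure IsGZAction (n : ℕ) (σ : (GZIndex n → ℂ) → Mat n → Mat n) : Prop where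
  zero : ∀ y, σ 0 y = y
  add : ∀ a b y, σ (a + b) y = σ a (σ b y)
  holomorphic : AnalyticOnNhd ℂ (fun p : (GZIndex n → ℂ) × Mat n => σ p.1 p.2) Set.univ
  generator : ∀ (a : GZIndex n → ℂ) (y : Mat n),
    HasDerivAt (fun t : ℂ => σ (t • a) y) (∑ i, a i • hamiltonianField (traceFun i) y) 0

/-- `ω` is the Kirillov-Kostant-Souriau form on the adjoint orbit `O`, transferred to adjoint
orbits by the trace form: `ω_y([a, y], [b, y]) = tr (y [a, b])`. -/
def IsOrbitForm {n : ℕ} (O : Set (Mat n)) (ω : Mat n → Mat n [⋀^Fin 2]→L[ℂ] ℂ) : Prop :=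
  ∀ y ∈ O, ∀ a b : Mat n, ω y ![a * y - y * a, b * y - y * b] = (y * (a * b - b * a)).trace

/-!
The whole argument rests on gradients for the trace form. The differentials at `y` of the `f_{k,m}`
with `m` fixed span the same functionals as `v ↦ tr ((y_m) ^ j v)`, `j < m`, where the power is
extended by zero to an `n × n` matrix. Hence `y` is strongly regular if and only if the powers
`(y_m) ^ j`, `j < m ≤ n`, are linearly independent (`isStronglyRegular_iff`).

*Nonemptiness.* Strong regularity makes `1, y, …, y ^ (n - 1)` independent, so `y` is regular.
Conversely a regular matrix has a cyclic vector (`IsRegularMat.exists_isCyclicVector`), so it is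
conjugate to a companion matrix, and companion matrices are strongly regular
(`isStronglyRegular_companionMat`).

*The orbit.* For regular `y` the centralizer is the span of the powers of `y`, so by duality the
tangent directions `[a, y]` are exactly those in which the characteristic polynomial is stationary.
A level set of invariants that is swept out, to first order, by a family of maps is a submanifold
(`exists_slice_chart`), and this applies to conjugation by `exp a`. Strong regularity is an open
condition, and it is dense in the orbit by the identity theorem along a pencil of conjugating
matrices (`adjointOrbit_subset_closure_sregOrbit`).

*The symplectic form.* Near a point of the orbit let `h y` be the matrix with columns
`v, y v, …, y ^ (n - 1) v`, for a cyclic vector `v`. Then `y = h C h⁻¹` with the companion matrix `C`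
constant on the orbit, and the form is the exterior derivative of `- tr (C h⁻¹ dh)`
(`orbitForm_eq_extDeriv`), hence holomorphic and closed. It is nondegenerate since
`ω ([a, y], [b, y]) = - tr ([a, y] b)`.

*The action.* The field `ξ_{(k,m)}` at `y` is the commutator of `y` with `(y_m) ^ (m - k)`, and its
flow is conjugation by the exponential of a multiple of this power. The composition of these flows
(`gzAction`) is the action; it preserves all the `f_{k,m}`, and an action with these generators is
unique (`IsGZAction.unique`).

*The polarization.* On the strongly regular set the `ξ_{(k,m)}` are independent, because a
combination of their gradients commuting with `y` is a polynomial in `y`. Comparing dimensions,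
`n ^ 2 = d(n) + d(n - 1)`, their span is the common kernel of the `d f_{k,m}`
(`IsStronglyRegular.gzDistribution_eq_ker`). This description gives everything else: the `A`-orbits
are submanifolds by the slice charts, the span is Lagrangian and involutive, and the `f_{k,m}` are
locally constant on any integral manifold, which therefore stays in a single `A`-orbit.
-/

/-! ### Local slices, tangent vectors and integral manifolds -/

section Slices

variable {E : Type*} [NormedAddCommGroup E] [NormedSpace ℂ E]

/-- A map with injective strict derivative on a finite-dimensional space is locally injective. -/
theorem HasStrictFDerivAt.exists_isOpen_injOn [FiniteDimensional ℂ E] {G : Type*}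
    [NormedAddCommGroup G] [NormedSpace ℂ G] [FiniteDimensional ℂ G] {h : E → G} {h' : E →L[ℂ] G}
    {a : E} (hh : HasStrictFDerivAt h h' a) (hinj : Function.Injective h') :
    ∃ N : Set E, IsOpen N ∧ a ∈ N ∧ Set.InjOn h N := by
  have : CompleteSpace E := FiniteDimensional.complete ℂ E
  obtain ⟨Λ, hΛ⟩ := h'.toLinearMap.exists_leftInverse_of_injective (LinearMap.ker_eq_bot.2 hinj)
  have h1 : HasStrictFDerivAt (fun x => LinearMap.toContinuousLinearMap Λ (h x))
      ((ContinuousLinearEquiv.refl ℂ E : E ≃L[ℂ] E) : E →L[ℂ] E) a := by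
    have := (LinearMap.toContinuousLinearMap Λ).hasStrictFDerivAt.comp a hh
    convert this using 1
    ext v
    exact (LinearMap.congr_fun hΛ v).symm
  refine ⟨(h1.toOpenPartialHomeomorph _).source, (h1.toOpenPartialHomeomorph _).open_source,
    h1.mem_toOpenPartialHomeomorph_source, fun x hx y hy hxy => ?_⟩
  refine (h1.toOpenPartialHomeomorph _).injOn hx hy ?_
  simp [hxy]

/-- **Slice chart.** Let `T` be a holomorphic family of maps with `T 0 = id` which preserve `f`, such
that `a ↦ T a z` is an immersion at `0` onto a subspace containing the kernel of `df`. Then the level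
set of `f` through `z` is linear in suitable coordinates, and is locally swept out by `T · z`.
The coordinates are the inverse of `(a, v) ↦ T a (z + v)`, for `v` in a complement of the range of
the derivative `D`. -/
theorem exists_slice_chart [FiniteDimensional ℂ E] {P G : Type*} [NormedAddCommGroup P]
    [NormedSpace ℂ P] [FiniteDimensional ℂ P] [NormedAddCommGroup G] [NormedSpace ℂ G]
    [FiniteDimensional ℂ G] {T : P → E → E}
    (hT : AnalyticOnNhd ℂ (fun q : P × E => T q.1 q.2) Set.univ) (hT0 : ∀ p, T 0 p = p)
    {z : E} {D : P →L[ℂ] E} (hD : HasFDerivAt (fun a => T a z) D 0)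
    (hDinj : Function.Injective D) {f : E → G} (hf : AnalyticAt ℂ f z)
    (hinv : ∀ a p, f (T a p) = f p)
    (hker : ∀ v, fderiv ℂ f z v = 0 → v ∈ LinearMap.range D.toLinearMap) :
    ∃ Φ : OpenPartialHomeomorph E E, z ∈ Φ.source ∧ AnalyticOnNhd ℂ Φ Φ.source ∧
      AnalyticOnNhd ℂ Φ.symm Φ.target ∧
      ∀ p ∈ Φ.source, (f p = f z ↔ Φ p ∈ LinearMap.range D.toLinearMap) ∧
        (f p = f z → ∃ a, p = T a z) := by
  have : CompleteSpace E := FiniteDimensional.complete ℂ E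
  obtain ⟨ℓ₀, hℓ₀⟩ := D.toLinearMap.exists_leftInverse_of_injective (LinearMap.ker_eq_bot.2 hDinj)
  set ℓ : E →L[ℂ] P := LinearMap.toContinuousLinearMap ℓ₀ with hℓdef
  have hℓ : ∀ a, ℓ (D a) = a := fun a => LinearMap.congr_fun hℓ₀ a
  -- the projection onto a complement of the range of `D`
  set π : E →L[ℂ] E := ContinuousLinearMap.id ℂ E - D.comp ℓ with hπ
  have hπa : ∀ w, π w = w - D (ℓ w) := fun w => by simp [hπ]
  set Ψ : E → E := fun w => T (ℓ w) (z + π w) with hΨ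
  have hΨan : AnalyticOnNhd ℂ Ψ Set.univ := by
    intro w _
    have h2 : AnalyticAt ℂ (fun w => (ℓ w, z + π w)) w :=
      (ℓ.analyticAt w).prod (analyticAt_const.add (π.analyticAt w))
    exact AnalyticAt.comp (g := fun q : P × E => T q.1 q.2) (hT _ trivial) h2
  have hΨ0 : Ψ 0 = z := by simp [hΨ, hT0]
  have hder : HasStrictFDerivAt Ψ
      ((ContinuousLinearEquiv.refl ℂ E : E ≃L[ℂ] E) : E →L[ℂ] E) 0 := by
    have hTd : HasFDerivAt (fun q : P × E => T q.1 q.2)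
        (fderiv ℂ (fun q : P × E => T q.1 q.2) (0, z)) (0, z) :=
      (hT (0, z) trivial).differentiableAt.hasFDerivAt
    set T' := fderiv ℂ (fun q : P × E => T q.1 q.2) (0, z)
    have hl : ∀ a, T' (a, 0) = D a := by
      have h3 : HasFDerivAt (fun a : P => (a, z)) (ContinuousLinearMap.inl ℂ P E) 0 :=
        hasFDerivAt_prodMk_left _ _
      have := (HasFDerivAt.comp (0 : P) (f := fun a : P => (a, z)) hTd h3).unique hD
      intro a
      rw [← this]; simp
    have hr : ∀ v, T' (0, v) = v := by
      have h3 : HasFDerivAt (fun v : E => ((0 : P), v)) (ContinuousLinearMap.inr ℂ P E) z :=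
        hasFDerivAt_prodMk_right _ _
      have h4 := HasFDerivAt.comp z (f := fun v : E => ((0 : P), v)) hTd h3
      have h5 : HasFDerivAt (fun v : E => T 0 v) (ContinuousLinearMap.id ℂ E) z := by
        simp only [hT0]; exact hasFDerivAt_id z
      have := h4.unique h5
      intro v
      simpa using congrArg (fun L : E →L[ℂ] E => L v) this
    have hΨs := (hΨan 0 trivial).hasStrictFDerivAt
    convert hΨs using 1
    refine (HasFDerivAt.fderiv ?_).symm
    have h6 : HasFDerivAt (fun w => (ℓ w, z + π w)) (ℓ.prod π) 0 :=
      ℓ.hasFDerivAt.prodMk (π.hasFDerivAt.const_add z)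
    have hTd' : HasFDerivAt (fun q : P × E => T q.1 q.2) T' (ℓ 0, z + π 0) := by
      simpa using hTd
    have h7 := HasFDerivAt.comp (0 : E) (f := fun w => (ℓ w, z + π w)) hTd' h6
    have h8 : HasFDerivAt Ψ (T'.comp (ℓ.prod π)) 0 := h7
    refine h8.congr_fderiv ?_
    ext w
    symm
    have : ((ℓ w, π w) : P × E) = (ℓ w, 0) + (0, π w) := by simp
    change w = T' (ℓ w, π w)
    rw [this, map_add, hl, hr, hπa]; simp
  -- `v ↦ (f (z + v), ℓ v)` is injective near `0`
  obtain ⟨N, hNo, hN0, hNinj⟩ : ∃ N : Set E, IsOpen N ∧ (0 : E) ∈ N ∧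
      Set.InjOn (fun v => (f (z + v), ℓ v)) N := by
    have hf' : HasStrictFDerivAt f (fderiv ℂ f z) (z + 0) := by
      simpa using hf.hasStrictFDerivAt
    have h1 : HasStrictFDerivAt (fun v => f (z + v)) (fderiv ℂ f z) 0 := by
      have := HasStrictFDerivAt.comp (0 : E) hf' ((hasStrictFDerivAt_id (0 : E)).const_add z)
      simpa using this
    refine (h1.prodMk ℓ.hasStrictFDerivAt).exists_isOpen_injOn ?_
    refine (injective_iff_map_eq_zero _).2 fun v hv => ?_
    simp only [ContinuousLinearMap.prod_apply, Prod.mk_eq_zero] at hv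
    obtain ⟨a, ha⟩ := hker v hv.1
    have ha' : D a = v := ha
    have := hv.2
    rw [← ha', hℓ] at this
    rw [← ha', this, map_zero]
  set e := hder.toOpenPartialHomeomorph Ψ with he
  have he_coe : ∀ w, e w = Ψ w := fun w => rfl
  have h0 : (0 : E) ∈ e.source := hder.mem_toOpenPartialHomeomorph_source
  have hNπ : IsOpen (π ⁻¹' N) := hNo.preimage π.continuous
  set e₁ := e.restrOpen (π ⁻¹' N) hNπ with he₁
  have h01 : (0 : E) ∈ e₁.source := by
    rw [he₁, OpenPartialHomeomorph.restrOpen_source]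
    exact ⟨h0, by simpa using hN0⟩
  have hsymm : AnalyticAt ℂ e₁.symm z := by
    have h1 : AnalyticAt ℂ e₁ 0 := hΨan 0 trivial
    have := e₁.analyticAt_symm' (i := ContinuousLinearEquiv.refl ℂ E) h01 h1 hder.hasFDerivAt.fderiv
    have h2 : e₁ 0 = z := hΨ0
    rwa [h2] at this
  have hz : z ∈ e₁.target := by
    have := e₁.map_source h01
    have h2 : e₁ 0 = z := hΨ0
    rwa [h2] at this
  refine ⟨e₁.symm.restrOpen {p | AnalyticAt ℂ e₁.symm p} (isOpen_analyticAt ℂ _), ?_, ?_, ?_, ?_⟩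
  · rw [OpenPartialHomeomorph.restrOpen_source]
    exact ⟨hz, hsymm⟩
  · intro p hp
    rw [OpenPartialHomeomorph.restrOpen_source] at hp
    exact hp.2
  · intro p _
    exact hΨan p trivial
  · intro p hp
    rw [OpenPartialHomeomorph.restrOpen_source] at hp
    have hp1 : p ∈ e₁.target := hp.1
    set w := e₁.symm p with hw
    have hws : w ∈ e₁.source := e₁.map_target hp1
    have hpw : p = T (ℓ w) (z + π w) := (e₁.right_inv hp1).symm
    have hwN : π w ∈ N := by
      rw [he₁, OpenPartialHomeomorph.restrOpen_source] at hws
      exact hws.2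
    have hℓπ : ℓ (π w) = 0 := by rw [hπa, map_sub, hℓ, sub_self]
    have key : f p = f z → π w = 0 := by
      intro h
      refine hNinj hwN hN0 ?_
      rw [hpw, hinv] at h
      simp [h, hℓπ]
    refine ⟨⟨fun h => ⟨ℓ w, ?_⟩, ?_⟩, fun h => ⟨ℓ w, ?_⟩⟩
    · have h1 := key h
      rw [hπa, sub_eq_zero] at h1
      exact h1.symm
    · rintro ⟨a, ha⟩
      have ha' : D a = w := ha
      have : π w = 0 := by rw [hπa, ← ha', hℓ, sub_self]
      rw [hpw, hinv, this, add_zero]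
    · rw [key h, add_zero] at hpw
      exact hpw

/-- A set squeezed between the `T`-orbit of each of its points and the level set of `f` is a complex
submanifold, under the hypotheses of `exists_slice_chart`. -/
theorem isComplexSubmanifold_of_slice [FiniteDimensional ℂ E] {P G : E → Type*}
    [∀ z, NormedAddCommGroup (P z)] [∀ z, NormedSpace ℂ (P z)] [∀ z, FiniteDimensional ℂ (P z)]
    [∀ z, NormedAddCommGroup (G z)] [∀ z, NormedSpace ℂ (G z)] [∀ z, FiniteDimensional ℂ (G z)]
    {S : Set E} {d : ℕ} {T : ∀ z, P z → E → E}
    (hT : ∀ z, AnalyticOnNhd ℂ (fun q : P z × E => T z q.1 q.2) Set.univ)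
    (hT0 : ∀ z p, T z 0 p = p)
    {D : ∀ z, P z →L[ℂ] E} (hD : ∀ z, HasFDerivAt (fun a => T z a z) (D z) 0)
    (hDinj : ∀ z ∈ S, Function.Injective (D z)) {f : ∀ z, E → G z}
    (hf : ∀ z, AnalyticAt ℂ (f z) z)
    (hinv : ∀ z a p, f z (T z a p) = f z p)
    (hker : ∀ z ∈ S, ∀ v, fderiv ℂ (f z) z v = 0 → v ∈ LinearMap.range (D z).toLinearMap)
    (hP : ∀ z ∈ S, Module.finrank ℂ (P z) = d) (hTS : ∀ z ∈ S, ∀ a, T z a z ∈ S)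
    (hfS : ∀ z ∈ S, ∀ p ∈ S, f z p = f z z) :
    IsComplexSubmanifold S d := by
  intro z hz
  obtain ⟨Φ, h1, h2, h3, h4⟩ := exists_slice_chart (hT z) (hT0 z) (hD z) (hDinj z hz) (hf z)
    (hinv z) (hker z hz)
  refine ⟨Φ, LinearMap.range (D z).toLinearMap, h1, h2, h3, ?_, ?_⟩
  · rw [LinearMap.finrank_range_of_inj (hDinj z hz), hP z hz]
  · ext q
    constructor
    · rintro ⟨p, ⟨hpS, hp⟩, rfl⟩
      exact ⟨(h4 p hp).1.1 (hfS z hz p hpS), Φ.map_source hp⟩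
    · rintro ⟨hq, hqt⟩
      have hp := Φ.map_target hqt
      refine ⟨Φ.symm q, ⟨?_, hp⟩, Φ.right_inv hqt⟩
      have := (h4 _ hp).1.2 (by rw [Φ.right_inv hqt]; exact hq)
      obtain ⟨a, ha⟩ := (h4 _ hp).2 this
      rw [ha]
      exact hTS z hz a

theorem IsComplexSubmanifold.inter_isOpen {S U : Set E} {d : ℕ} (hS : IsComplexSubmanifold S d)
    (hU : IsOpen U) : IsComplexSubmanifold (S ∩ U) d := by
  rintro y ⟨hyS, hyU⟩
  obtain ⟨Φ, W, h1, h2, h3, h4, h5⟩ := hS y hyS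
  refine ⟨Φ.restrOpen U hU, W, ?_, ?_, ?_, h4, ?_⟩
  · rw [OpenPartialHomeomorph.restrOpen_source]; exact ⟨h1, hyU⟩
  · intro p hp
    rw [OpenPartialHomeomorph.restrOpen_source] at hp
    exact h2 p hp.1
  · intro p hp
    exact h3 p hp.1
  · ext q
    constructor
    · rintro ⟨p, ⟨⟨hpS, hpU⟩, hp⟩, rfl⟩
      have hq : Φ p ∈ (W : Set E) ∩ Φ.target := by
        rw [← h5]
        exact ⟨p, ⟨hpS, hp.1⟩, rfl⟩
      exact ⟨hq.1, (Φ.restrOpen U hU).map_source hp⟩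
    · rintro ⟨hqW, hqt⟩
      have hp := (Φ.restrOpen U hU).map_target hqt
      have hq : q ∈ Φ '' (S ∩ Φ.source) := by
        rw [h5]; exact ⟨hqW, hqt.1⟩
      obtain ⟨p, ⟨hpS, hps⟩, rfl⟩ := hq
      have hpU : (Φ.restrOpen U hU).symm (Φ p) = p := Φ.left_inv hps
      rw [hpU] at hp
      refine ⟨p, ⟨⟨hpS, ?_⟩, hp⟩, rfl⟩
      rw [OpenPartialHomeomorph.restrOpen_source] at hp
      exact hp.2

theorem tangentVectors_mono {S S' : Set E} (h : S ⊆ S') (y : E) :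
    tangentVectors S y ⊆ tangentVectors S' y := by
  rintro v ⟨γ, h1, h2, h3, h4⟩
  exact ⟨γ, h1, h2, h3.mono fun t ht => h ht, h4⟩

theorem tangentVectors_inter_isOpen {S U : Set E} (hU : IsOpen U) {y : E} (hy : y ∈ U) :
    tangentVectors (S ∩ U) y = tangentVectors S y := by
  refine Set.Subset.antisymm (tangentVectors_mono Set.inter_subset_left y) ?_
  rintro v ⟨γ, h1, h2, h3, h4⟩
  refine ⟨γ, h1, h2, ?_, h4⟩
  have : ∀ᶠ t in 𝓝 (0 : ℂ), γ t ∈ U :=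
    h1.continuousAt.eventually_mem (by rw [h2]; exact hU.mem_nhds hy)
  filter_upwards [h3, this] with t ht ht' using ⟨ht, ht'⟩

/-- A function constant on `S` has differential vanishing on the tangent vectors of `S`. -/
theorem fderiv_eq_zero_of_mem_tangentVectors {G : Type*} [NormedAddCommGroup G] [NormedSpace ℂ G]
    {S : Set E} {z v : E} {f : E → G} (hf : DifferentiableAt ℂ f z)
    (hfS : ∀ p ∈ S, f p = f z) (hv : v ∈ tangentVectors S z) : fderiv ℂ f z v = 0 := by
  obtain ⟨γ, h1, h2, h3, h4⟩ := hv
  have h5 : HasDerivAt γ v 0 := h4 ▸ h1.differentiableAt.hasDerivAt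
  have h6 : HasFDerivAt f (fderiv ℂ f z) (γ 0) := h2 ▸ hf.hasFDerivAt
  have h7 := h6.comp_hasDerivAt 0 h5
  have h8 : HasDerivAt (f ∘ γ) (0 : G) 0 := by
    refine (hasDerivAt_const (0 : ℂ) (f z)).congr_of_eventuallyEq ?_
    filter_upwards [h3] with t ht using hfS _ ht
  exact h7.unique h8

/-- The tangent space of a set swept out near `z` by a holomorphic family of maps, and contained in a
level set of a function `f` with `ker df` in the span of the generating directions. -/
theorem tangentVectors_eq_range {P G : Type*} [NormedAddCommGroup P]
    [NormedSpace ℂ P] [NormedAddCommGroup G] [NormedSpace ℂ G] {S : Set E} {T : P → E}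
    {z : E} (hT : AnalyticOnNhd ℂ T Set.univ) (hT0 : T 0 = z)
    {D : P →L[ℂ] E} (hD : HasFDerivAt T D 0) {f : E → G} (hf : DifferentiableAt ℂ f z)
    (hker : ∀ v, fderiv ℂ f z v = 0 → v ∈ LinearMap.range D.toLinearMap)
    (hTS : ∀ a, T a ∈ S) (hfS : ∀ p ∈ S, f p = f z) :
    tangentVectors S z = (LinearMap.range D.toLinearMap : Set E) := by
  refine Set.Subset.antisymm
    (fun v hv => hker v (fderiv_eq_zero_of_mem_tangentVectors hf hfS hv)) ?_
  rintro v ⟨a, rfl⟩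
  refine ⟨fun t : ℂ => T (t • a), ?_, by simp [hT0], Filter.Eventually.of_forall fun t => hTS _, ?_⟩
  · exact (hT _ trivial).comp (analyticAt_id.smul analyticAt_const)
  · have h1 : HasDerivAt (fun t : ℂ => t • a) a 0 := by
      simpa using (hasDerivAt_id (0 : ℂ)).smul_const a
    have h2 : HasFDerivAt T D ((0 : ℂ) • a) := by simpa using hD
    exact (h2.comp_hasDerivAt 0 h1).deriv

/-- A holomorphic function whose differential kills the tangent vectors of a complex submanifold is
locally constant on it. -/
theorem IsComplexSubmanifold.eventually_eq [FiniteDimensional ℂ E] {G : Type*}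
    [NormedAddCommGroup G] [NormedSpace ℂ G] {L : Set E} {d : ℕ} (hL : IsComplexSubmanifold L d)
    {f : E → G} (hf : Differentiable ℂ f)
    (hker : ∀ y ∈ L, ∀ v ∈ tangentVectors L y, fderiv ℂ f y v = 0) {y : E} (hy : y ∈ L) :
    ∀ᶠ p in 𝓝[L] y, f p = f y := by
  obtain ⟨Φ, W, h1, h2, h3, -, h5⟩ := hL y hy
  have hyt := Φ.map_source h1
  obtain ⟨r, hr, hball⟩ := Metric.isOpen_iff.1 Φ.open_target _ hyt
  have hmem : ∀ w ∈ W, w ∈ Φ.target → Φ.symm w ∈ L := by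
    intro w hw hwt
    have : w ∈ Φ '' (L ∩ Φ.source) := by rw [h5]; exact ⟨hw, hwt⟩
    obtain ⟨p, ⟨hpL, hps⟩, rfl⟩ := this
    rwa [Φ.left_inv hps]
  have hΦW : ∀ p ∈ L, p ∈ Φ.source → Φ p ∈ W := by
    intro p hpL hps
    have : Φ p ∈ (W : Set E) ∩ Φ.target := by rw [← h5]; exact ⟨p, ⟨hpL, hps⟩, rfl⟩
    exact this.1
  -- the restriction to `W` of `f` in the chart has zero derivative
  set F : W → G := fun w => f (Φ.symm (w : E)) with hF
  have hFd : ∀ w : W, (w : E) ∈ Φ.target → HasFDerivAt F (0 : W →L[ℂ] G) w := by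
    intro w hw
    have ha : HasFDerivAt Φ.symm (fderiv ℂ Φ.symm w) (w : E) :=
      (h3 _ hw).differentiableAt.hasFDerivAt
    have hb := (hf (Φ.symm w)).hasFDerivAt.comp (w : E) ha
    have hc := HasFDerivAt.comp w hb W.subtypeL.hasFDerivAt
    have hz : ((fderiv ℂ f (Φ.symm w)).comp (fderiv ℂ Φ.symm w)).comp W.subtypeL = 0 := by
      ext u
      refine hker _ (hmem w w.2 hw) _ ⟨fun t : ℂ => Φ.symm (w + t • (u : E)), ?_, by simp, ?_, ?_⟩
      · have h8 : AnalyticAt ℂ Φ.symm ((w : E) + (0 : ℂ) • (u : E)) := by simpa using h3 _ hw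
        exact AnalyticAt.comp (g := Φ.symm) (f := fun t : ℂ => (w : E) + t • (u : E)) h8
          (analyticAt_const.add (analyticAt_id.smul analyticAt_const))
      · have hcont : ContinuousAt (fun t : ℂ => (w : E) + t • (u : E)) 0 := by fun_prop
        have := hcont.eventually_mem (s := Φ.target)
          (by simpa using Φ.open_target.mem_nhds hw)
        filter_upwards [this] with t ht
        exact hmem _ (W.add_mem w.2 (W.smul_mem t u.2)) ht
      · have h9 : HasDerivAt (fun t : ℂ => (w : E) + t • (u : E)) (u : E) 0 := by
          simpa using ((hasDerivAt_id (0 : ℂ)).smul_const (u : E)).const_add (w : E)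
        have ha' : HasFDerivAt Φ.symm (fderiv ℂ Φ.symm w) ((w : E) + (0 : ℂ) • (u : E)) := by
          simpa using ha
        exact (ha'.comp_hasDerivAt 0 h9).deriv
    rw [hz] at hc
    exact hc
  have hconst : ∀ w ∈ Metric.ball (⟨Φ y, hΦW y hy h1⟩ : W) r, F w = F ⟨Φ y, hΦW y hy h1⟩ := by
    intro w hw
    have hsub : ∀ u ∈ Metric.ball (⟨Φ y, hΦW y hy h1⟩ : W) r, (u : E) ∈ Φ.target :=
      fun u hu => hball (by simpa [Subtype.dist_eq] using hu)
    refine Metric.isOpen_ball.is_const_of_fderiv_eq_zero (𝕜 := ℂ)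
      (convex_ball _ _).isPreconnected ?_ ?_ hw (Metric.mem_ball_self hr)
    · exact fun u hu => (hFd u (hsub u hu)).differentiableAt.differentiableWithinAt
    · exact fun u hu => (hFd u (hsub u hu)).fderiv
  have hcy : ContinuousAt Φ y := Φ.continuousAt h1
  have e1 : ∀ᶠ p in 𝓝 y, p ∈ Φ.source := Φ.open_source.mem_nhds h1
  have e2 : ∀ᶠ p in 𝓝 y, Φ p ∈ Metric.ball (Φ y) r :=
    hcy.eventually_mem (Metric.ball_mem_nhds _ hr)
  filter_upwards [nhdsWithin_le_nhds e1, nhdsWithin_le_nhds e2, self_mem_nhdsWithin] with p hp hpb hpL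
  have := hconst ⟨Φ p, hΦW p hpL hp⟩ (by simpa [Subtype.dist_eq] using hpb)
  simpa [hF, Φ.left_inv hp, Φ.left_inv h1] using this

/-- A preconnected set which is locally contained in single classes of an equivalence relation is
contained in one class. -/
theorem IsPreconnected.subset_of_eventually {X : Type*} [TopologicalSpace X] {L : Set X}
    (hL : IsPreconnected L) {r : X → X → Prop} (hr : Equivalence r)
    (h : ∀ y ∈ L, ∀ᶠ p in 𝓝[L] y, r y p) {y p : X} (hy : y ∈ L) (hp : p ∈ L) : r y p := by
  have hpc : PreconnectedSpace L := isPreconnected_iff_preconnectedSpace.1 hL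
  have hev : ∀ q : L, ∀ᶠ p : L in 𝓝 q, r q p := by
    intro q
    have := h q q.2
    rwa [nhdsWithin_eq_map_subtype_coe q.2, Filter.eventually_map] at this
  have hclopen : IsClopen {q : L | r y q} := by
    refine ⟨⟨isOpen_iff_mem_nhds.2 fun q hq => ?_⟩, isOpen_iff_mem_nhds.2 fun q hq => ?_⟩
    · filter_upwards [hev q] with s hs hys
      exact hq (hr.trans hys (hr.symm hs))
    · filter_upwards [hev q] with s hs
      exact hr.trans hq hs
  have := hclopen.eq_univ ⟨⟨y, hy⟩, hr.refl y⟩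
  have hmem : (⟨p, hp⟩ : L) ∈ {q : L | r y q} := by rw [this]; trivial
  exact hmem

end Slices

/-! ### Regular matrices and cyclic vectors -/

section Cyclic

open Polynomial

/-- A finitely generated torsion module over a principal ideal domain has an element whose images
under the endomorphisms fill the module: the vector of generators of its primary cyclic summands. -/
theorem Module.exists_forall_exists_end_apply_eq {R M : Type*} [CommRing R] [IsDomain R]
    [IsPrincipalIdealRing R] [AddCommGroup M] [Module R M] [Module.Finite R M]
    (hM : Module.IsTorsion R M) : ∃ v : M, ∀ w, ∃ g : M →ₗ[R] M, g v = w := by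
  classical
  obtain ⟨ι, _, p, -, e, ⟨φ⟩⟩ := Module.equiv_directSum_of_isTorsion hM
  set v₀ : DirectSum ι fun i => R ⧸ Submodule.span R {p i ^ e i} :=
    DFinsupp.equivFunOnFintype.symm fun i => Submodule.Quotient.mk 1 with hv₀
  refine ⟨φ.symm v₀, fun w => ?_⟩
  have hg : ∀ i, ∃ g : (R ⧸ Submodule.span R {p i ^ e i}) →ₗ[R]
      (R ⧸ Submodule.span R {p i ^ e i}), g (Submodule.Quotient.mk 1) = φ w i := by
    intro i
    obtain ⟨r, hr⟩ := Submodule.Quotient.mk_surjective _ (φ w i)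
    refine ⟨Submodule.liftQ _ (LinearMap.toSpanSingleton R _ (φ w i)) ?_, ?_⟩
    · rw [Submodule.span_le, Set.singleton_subset_iff, SetLike.mem_coe, LinearMap.mem_ker,
        LinearMap.toSpanSingleton_apply, ← hr, ← Submodule.Quotient.mk_smul,
        Submodule.Quotient.mk_eq_zero, smul_eq_mul, mul_comm]
      exact Submodule.smul_mem _ r (Submodule.mem_span_singleton_self _)
    · rw [Submodule.liftQ_apply, LinearMap.toSpanSingleton_apply, one_smul]
  choose g hg using hg
  refine ⟨φ.symm.toLinearMap ∘ₗ DFinsupp.mapRange.linearMap g ∘ₗ φ.toLinearMap, ?_⟩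
  simp only [LinearMap.comp_apply, LinearEquiv.coe_coe, LinearEquiv.apply_symm_apply]
  rw [LinearEquiv.symm_apply_eq]
  refine DFinsupp.ext fun i => ?_
  rw [DFinsupp.mapRange.linearMap_apply, DFinsupp.mapRange_apply]
  exact hg i

variable {n : ℕ}

/-- For every matrix `y` there is a vector which the centralizer of `y` moves everywhere: the
centralizer is the endomorphism ring of `ℂ ^ n` as a module over the polynomials. -/
theorem exists_forall_exists_commute_mulVec_eq (y : Mat n) :
    ∃ v : Fin n → ℂ, ∀ w, ∃ a : Mat n, Commute a y ∧ a.mulVec v = w := by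
  set f : (Fin n → ℂ) →ₗ[ℂ] (Fin n → ℂ) := Matrix.toLin' y with hf
  obtain ⟨v, hv⟩ := Module.exists_forall_exists_end_apply_eq
    (Module.AEval.isTorsion_of_finiteDimensional ℂ (Fin n → ℂ) f)
  refine ⟨(Module.AEval'.of f).symm v, fun w => ?_⟩
  obtain ⟨g, hg⟩ := hv (Module.AEval'.of f w)
  set a : (Fin n → ℂ) →ₗ[ℂ] (Fin n → ℂ) :=
    (Module.AEval'.of f).symm.toLinearMap ∘ₗ g.restrictScalars ℂ ∘ₗ
      (Module.AEval'.of f).toLinearMap with ha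
  have hcomm : ∀ u, a (f u) = f (a u) := by
    intro u
    simp only [ha, LinearMap.comp_apply, LinearEquiv.coe_coe, LinearMap.restrictScalars_apply]
    rw [← Module.AEval'.X_smul_of, map_smul, Module.AEval'.of_symm_X_smul]
  refine ⟨LinearMap.toMatrix' a, ?_, ?_⟩
  · refine (Matrix.toLin' (R := ℂ)).injective ?_
    rw [Matrix.toLin'_mul, Matrix.toLin'_mul, Matrix.toLin'_toMatrix']
    exact LinearMap.ext hcomm
  · rw [← Matrix.toLin'_apply, Matrix.toLin'_toMatrix']
    simp [ha, hg]

/-- `v` is a cyclic vector of `y`: the vectors `v, y v, …, y ^ (n - 1) v` are independent, hence a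
basis. -/
def IsCyclicVector (y : Mat n) (v : Fin n → ℂ) : Prop :=
  LinearIndependent ℂ fun j : Fin n => (y ^ (j : ℕ)).mulVec v

theorem pow_mem_span_pow (y : Mat n) (k : ℕ) :
    y ^ k ∈ Submodule.span ℂ (Set.range fun j : Fin n => y ^ (j : ℕ)) := by
  have h1 : aeval y (X ^ k %ₘ y.charpoly) = y ^ k := by
    rw [aeval_modByMonic_eq_self_of_root (Matrix.aeval_self_charpoly y)]; simp
  rw [← h1]
  rcases Nat.eq_zero_or_pos n with rfl | hn
  · rw [Subsingleton.elim (aeval y _) 0]; exact Submodule.zero_mem _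
  have hdeg : (X ^ k %ₘ y.charpoly).natDegree < n := by
    have := natDegree_modByMonic_lt (X ^ k) y.charpoly_monic (by
      intro h
      have := y.charpoly_natDegree_eq_dim
      rw [h] at this; simp at this; omega)
    simpa using this
  rw [aeval_eq_sum_range' hdeg]
  refine Submodule.sum_mem _ fun i hi => Submodule.smul_mem _ _ (Submodule.subset_span ?_)
  exact ⟨⟨i, Finset.mem_range.1 hi⟩, rfl⟩

theorem Commute.mulVec_pow {a y : Mat n} (h : Commute a y) (k : ℕ) (v : Fin n → ℂ) :
    a.mulVec ((y ^ k).mulVec v) = (y ^ k).mulVec (a.mulVec v) := by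
  rw [Matrix.mulVec_mulVec, (h.pow_right k).eq, Matrix.mulVec_mulVec]

theorem IsCyclicVector.linearIndependent_pow {y : Mat n} {v : Fin n → ℂ} (h : IsCyclicVector y v) :
    LinearIndependent ℂ fun j : Fin n => y ^ (j : ℕ) := by
  have h' : LinearIndependent ℂ
      (((Matrix.mulVecBilin ℂ ℂ).flip v : Mat n →ₗ[ℂ] (Fin n → ℂ)) ∘
        fun j : Fin n => y ^ (j : ℕ)) := h
  exact h'.of_comp _

/-- Two matrices commuting with `y` and agreeing on a cyclic vector of `y` are equal. -/
theorem IsCyclicVector.eq_of_mulVec_eq {y : Mat n} {v : Fin n → ℂ} (h : IsCyclicVector y v)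
    {a b : Mat n} (ha : Commute a y) (hb : Commute b y) (hab : a.mulVec v = b.mulVec v) : a = b := by
  have hspan := h.span_eq_top_of_card_eq_finrank' (by simp)
  refine (Matrix.toLin' (R := ℂ)).injective (LinearMap.ext_on_range hspan fun j => ?_)
  rw [Matrix.toLin'_apply, Matrix.toLin'_apply, ha.mulVec_pow, hb.mulVec_pow, hab]

theorem IsCyclicVector.mem_span_pow {y : Mat n} {v : Fin n → ℂ} (h : IsCyclicVector y v)
    {a : Mat n} (ha : Commute a y) :
    a ∈ Submodule.span ℂ (Set.range fun j : Fin n => y ^ (j : ℕ)) := by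
  have hspan := h.span_eq_top_of_card_eq_finrank' (by simp)
  have hv : a.mulVec v ∈ Submodule.span ℂ
      (Set.range fun j : Fin n => (y ^ (j : ℕ)).mulVec v) := hspan ▸ Submodule.mem_top
  obtain ⟨c, hc⟩ := (Submodule.mem_span_range_iff_exists_fun ℂ).1 hv
  refine (Submodule.mem_span_range_iff_exists_fun ℂ).2 ⟨c, ?_⟩
  refine h.eq_of_mulVec_eq ?_ ha ?_
  · exact Commute.sum_left _ _ _ fun j _ => ((Commute.refl y).pow_left _).smul_left _
  · rw [← hc, Matrix.sum_mulVec]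
    simp [Matrix.smul_mulVec]

theorem mem_centralizer_singleton {y a : Mat n} :
    a ∈ Subalgebra.toSubmodule (Subalgebra.centralizer ℂ {y}) ↔ Commute a y := by
  rw [Subalgebra.mem_toSubmodule, Subalgebra.mem_centralizer_iff]
  simp [commute_iff_eq, eq_comm]

theorem IsCyclicVector.centralizer_eq {y : Mat n} {v : Fin n → ℂ} (h : IsCyclicVector y v) :
    Subalgebra.toSubmodule (Subalgebra.centralizer ℂ {y}) =
      Submodule.span ℂ (Set.range fun j : Fin n => y ^ (j : ℕ)) := by
  refine le_antisymm (fun a ha => h.mem_span_pow (mem_centralizer_singleton.1 ha)) ?_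
  rw [Submodule.span_le]
  rintro _ ⟨j, rfl⟩
  exact mem_centralizer_singleton.2 ((Commute.refl y).pow_left _)

theorem IsCyclicVector.isRegularMat {y : Mat n} {v : Fin n → ℂ} (h : IsCyclicVector y v) :
    IsRegularMat y := by
  have h1 : Module.finrank ℂ (Subalgebra.toSubmodule (Subalgebra.centralizer ℂ {y})) = n := by
    rw [h.centralizer_eq, finrank_span_eq_card h.linearIndependent_pow, Fintype.card_fin]
  exact h1

/-- A vector which the centralizer of `y` moves everywhere is cyclic, since a polynomial in `y`
killing it kills everything. -/
theorem exists_isCyclicVector_of_linearIndependent_pow {y : Mat n}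
    (h : LinearIndependent ℂ fun j : Fin n => y ^ (j : ℕ)) : ∃ v, IsCyclicVector y v := by
  obtain ⟨v, hv⟩ := exists_forall_exists_commute_mulVec_eq y
  refine ⟨v, Fintype.linearIndependent_iff.2 fun c hc => Fintype.linearIndependent_iff.1 h c ?_⟩
  refine (Matrix.toLin' (R := ℂ)).injective (LinearMap.ext fun w => ?_)
  obtain ⟨a, ha, rfl⟩ := hv w
  have hcomm : Commute a (∑ j, c j • y ^ (j : ℕ)) :=
    Commute.sum_right _ _ _ fun j _ => (ha.pow_right _).smul_right _
  rw [Matrix.toLin'_apply, Matrix.mulVec_mulVec, ← hcomm.eq, ← Matrix.mulVec_mulVec,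
    Matrix.sum_mulVec]
  simp only [Matrix.smul_mulVec, hc, Matrix.mulVec_zero, map_zero, LinearMap.zero_apply]

/-- A regular matrix has a cyclic vector. Otherwise take `v` which the centralizer moves everywhere;
a rank one matrix built from an eigenvector of `y` and an eigencovector for the same eigenvalue that
kills the cyclic subspace of `v` commutes with `y` and kills `v`, so that the centralizer has
dimension more than `n`. -/
theorem IsRegularMat.exists_isCyclicVector {y : Mat n} (h : IsRegularMat y) :
    ∃ v, IsCyclicVector y v := by
  obtain ⟨v, hv⟩ := exists_forall_exists_commute_mulVec_eq y
  set Z := Subalgebra.toSubmodule (Subalgebra.centralizer ℂ {y}) with hZ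
  have hZn : Module.finrank ℂ Z = n := h
  -- evaluation at `v` is injective on the centralizer, by equality of dimensions
  have hinj : ∀ a, Commute a y → a.mulVec v = 0 → a = 0 := by
    set ev : Z →ₗ[ℂ] (Fin n → ℂ) :=
      ((Matrix.mulVecBilin ℂ ℂ).flip v : Mat n →ₗ[ℂ] (Fin n → ℂ)) ∘ₗ Z.subtype with hev
    have hsurj : Function.Surjective ev := by
      intro w
      obtain ⟨a, ha, haw⟩ := hv w
      exact ⟨⟨a, mem_centralizer_singleton.2 ha⟩, haw⟩
    have hi : Function.Injective ev :=
      (LinearMap.injective_iff_surjective_of_finrank_eq_finrank (by simp [hZn])).2 hsurj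
    intro a ha hav
    have : (⟨a, mem_centralizer_singleton.2 ha⟩ : Z) = 0 := hi (by rw [map_zero]; exact hav)
    exact congrArg Subtype.val this
  set N : Submodule ℂ (Fin n → ℂ) :=
    Submodule.span ℂ (Set.range fun j : Fin n => (y ^ (j : ℕ)).mulVec v) with hN
  have hNpow : ∀ k, (y ^ k).mulVec v ∈ N := by
    intro k
    obtain ⟨c, hc⟩ := (Submodule.mem_span_range_iff_exists_fun ℂ).1 (pow_mem_span_pow y k)
    rw [← hc, Matrix.sum_mulVec]
    refine Submodule.sum_mem _ fun j _ => ?_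
    rw [Matrix.smul_mulVec]
    exact Submodule.smul_mem _ _ (Submodule.subset_span ⟨j, rfl⟩)
  refine ⟨v, linearIndependent_of_top_le_span_of_card_eq_finrank (le_of_eq (Eq.symm ?_)) (by simp)⟩
  change N = ⊤
  by_contra hne
  have hNinv : ∀ w ∈ N, Matrix.toLin' y w ∈ N := by
    intro w hw
    have : N ≤ N.comap (Matrix.toLin' y) := by
      rw [hN, Submodule.span_le]
      rintro _ ⟨j, rfl⟩
      change y.mulVec _ ∈ N
      rw [Matrix.mulVec_mulVec, ← pow_succ']
      exact hNpow _
    exact this hw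
  have hAinv : ∀ ψ ∈ N.dualAnnihilator, (Matrix.toLin' y).dualMap ψ ∈ N.dualAnnihilator := by
    intro ψ hψ
    rw [Submodule.mem_dualAnnihilator] at hψ ⊢
    intro w hw
    exact hψ _ (hNinv w hw)
  have hAne : Nontrivial N.dualAnnihilator := by
    rw [Submodule.nontrivial_iff_ne_bot]
    intro hbot
    exact hne ((Submodule.dualAnnihilator_eq_bot_iff).1 hbot)
  -- an eigencovector `ψ` of `y` vanishing on the cyclic subspace `N`
  obtain ⟨μ, hμ⟩ := Module.End.exists_eigenvalue
    (((Matrix.toLin' y).dualMap).restrict hAinv)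
  obtain ⟨⟨ψ, hψN⟩, hψ⟩ := hμ.exists_hasEigenvector
  have hψ0 : ψ ≠ 0 := fun h0 => hψ.2 (Subtype.ext h0)
  have hψy : ∀ w, ψ (y.mulVec w) = μ * ψ w := by
    intro w
    have := congrArg Subtype.val hψ.apply_eq_smul
    exact LinearMap.congr_fun this w
  -- `μ` is an eigenvalue of `y`, as `y - μ` is not surjective
  obtain ⟨u, hu0, hu⟩ : ∃ u ≠ 0, y.mulVec u = μ • u := by
    by_contra hcon
    push Not at hcon
    set g := Matrix.toLin' y - μ • LinearMap.id with hg
    have hgi : Function.Injective g := by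
      refine (injective_iff_map_eq_zero _).2 fun u hu => ?_
      by_contra hu0
      refine hcon u hu0 ?_
      simpa [hg, sub_eq_zero] using hu
    have hgs := LinearMap.injective_iff_surjective.1 hgi
    refine hψ0 (LinearMap.ext fun w => ?_)
    obtain ⟨w', rfl⟩ := hgs w
    simp [hg, hψy]
  set A : (Fin n → ℂ) →ₗ[ℂ] (Fin n → ℂ) := ψ.smulRight u with hA
  have hAv : (LinearMap.toMatrix' A).mulVec v = 0 := by
    rw [← Matrix.toLin'_apply, Matrix.toLin'_toMatrix', hA, LinearMap.smulRight_apply]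
    have : ψ v = 0 := (Submodule.mem_dualAnnihilator _).1 hψN v (by simpa using hNpow 0)
    rw [this, zero_smul]
  have hAc : Commute (LinearMap.toMatrix' A) y := by
    refine (Matrix.toLin' (R := ℂ)).injective (LinearMap.ext fun w => ?_)
    rw [Matrix.toLin'_mul, Matrix.toLin'_mul, Matrix.toLin'_toMatrix', LinearMap.comp_apply,
      LinearMap.comp_apply, hA, LinearMap.smulRight_apply, LinearMap.smulRight_apply, map_smul,
      Matrix.toLin'_apply, Matrix.toLin'_apply, hψy, hu, smul_smul, mul_comm]
  have h0 := hinj _ hAc hAv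
  have hA0 : A = 0 := by
    simpa using congrArg Matrix.toLin' h0
  refine hψ0 (LinearMap.ext fun w => ?_)
  have := LinearMap.congr_fun hA0 w
  simpa [hA, hu0] using this

theorem isRegularMat_iff_exists_isCyclicVector {y : Mat n} :
    IsRegularMat y ↔ ∃ v, IsCyclicVector y v :=
  ⟨IsRegularMat.exists_isCyclicVector, fun ⟨_, h⟩ => h.isRegularMat⟩

theorem isRegularMat_of_linearIndependent_pow {y : Mat n}
    (h : LinearIndependent ℂ fun j : Fin n => y ^ (j : ℕ)) : IsRegularMat y :=
  isRegularMat_iff_exists_isCyclicVector.2 (exists_isCyclicVector_of_linearIndependent_pow h)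

theorem IsRegularMat.linearIndependent_pow {y : Mat n} (h : IsRegularMat y) :
    LinearIndependent ℂ fun j : Fin n => y ^ (j : ℕ) :=
  let ⟨_, hv⟩ := h.exists_isCyclicVector
  hv.linearIndependent_pow

theorem IsRegularMat.mem_span_pow {y a : Mat n} (h : IsRegularMat y) (ha : Commute a y) :
    a ∈ Submodule.span ℂ (Set.range fun j : Fin n => y ^ (j : ℕ)) :=
  let ⟨_, hv⟩ := h.exists_isCyclicVector
  hv.mem_span_pow ha

/-- The matrix with columns `v, y v, …, y ^ (n - 1) v`. -/
noncomputable def krylov (v : Fin n → ℂ) (y : Mat n) : Mat n :=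
  Matrix.of fun i j => (y ^ (j : ℕ)).mulVec v i

theorem isCyclicVector_iff_isUnit_krylov {y : Mat n} {v : Fin n → ℂ} :
    IsCyclicVector y v ↔ IsUnit (krylov v y) :=
  Matrix.linearIndependent_cols_iff_isUnit (A := krylov v y)

/-- The companion matrix of a monic polynomial `p` of degree `n`, with ones below the diagonal and
the negated coefficients of `p` in the last column. -/
def companionMat (n : ℕ) (p : ℂ[X]) : Mat n :=
  Matrix.of fun i j =>
    if (j : ℕ) + 1 < n then (if (i : ℕ) = j + 1 then 1 else 0) else -p.coeff i

/-- In the basis `v, y v, …`, the matrix `y` becomes its companion matrix; invertibility of the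
change of basis is not needed for this form of the identity. -/
theorem mul_krylov (v : Fin n → ℂ) (y : Mat n) :
    y * krylov v y = krylov v y * companionMat n y.charpoly := by
  have hcol : ∀ i (j : Fin n), (y * krylov v y) i j = (y ^ ((j : ℕ) + 1)).mulVec v i := by
    intro i j
    rw [pow_succ', ← Matrix.mulVec_mulVec]
    rfl
  ext i j
  rw [hcol, Matrix.mul_apply]
  by_cases hj : (j : ℕ) + 1 < n
  · rw [Finset.sum_eq_single ⟨j + 1, hj⟩]
    · simp [krylov, companionMat, hj]
    · intro b _ hb
      have : (b : ℕ) ≠ j + 1 := fun h => hb (Fin.ext h)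
      simp [companionMat, hj, this]
    · simp
  · have hjn : (j : ℕ) + 1 = n := by omega
    have hch : y ^ n = -∑ k : Fin n, y.charpoly.coeff k • y ^ (k : ℕ) := by
      have h1 := Matrix.aeval_self_charpoly y
      rw [y.charpoly_monic.as_sum] at h1
      simp only [Matrix.charpoly_natDegree_eq_dim, Fintype.card_fin] at h1
      rw [map_add, map_sum] at h1
      simp only [map_pow, aeval_X, map_mul, aeval_C] at h1
      rw [eq_neg_iff_add_eq_zero, ← h1, Finset.sum_range]
      simp [Algebra.smul_def]
    rw [hjn, hch, Matrix.neg_mulVec, Matrix.sum_mulVec]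
    simp only [Pi.neg_apply, Finset.sum_apply, krylov, companionMat, Matrix.of_apply, hj,
      if_false, mul_neg, Finset.sum_neg_distrib, Matrix.smul_mulVec, Pi.smul_apply, smul_eq_mul]
    congr 1
    exact Finset.sum_congr rfl fun k _ => mul_comm _ _

end Cyclic

section MatrixTopology

/-- The topology of the operator norm on `M(n)`. It is the product topology by definition, but not
at the transparency of instance search; as a local instance it lets general results on normed spaces
apply to matrices. -/
noncomputable abbrev matNormTopology (n : ℕ) : TopologicalSpace (Mat n) :=
  PseudoMetricSpace.toUniformSpace.toTopologicalSpace

attribute [local instance] matNormTopology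

/-! ### Differentials of the coefficients of the characteristic polynomial -/

section Gradients

open Polynomial

variable {n : ℕ}

/-- The trace form: `b` is sent to the functional `v ↦ tr (b v)`. -/
noncomputable def traceDual (n : ℕ) : Mat n →ₗ[ℂ] (Mat n →L[ℂ] ℂ) :=
  (LinearMap.toContinuousLinearMap : (Mat n →ₗ[ℂ] ℂ) ≃ₗ[ℂ] (Mat n →L[ℂ] ℂ)).toLinearMap ∘ₗ
    (LinearMap.mul ℂ (Mat n)).compr₂ (Matrix.traceLinearMap (Fin n) ℂ ℂ)

@[simp]
theorem traceDual_apply (b v : Mat n) : traceDual n b v = (b * v).trace := rfl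

theorem traceDual_injective : Function.Injective (traceDual n) := by
  intro a b hab
  refine Matrix.ext_iff_trace_mul_right.2 fun v => ?_
  exact congrArg (fun L : Mat n →L[ℂ] ℂ => L v) hab

theorem traceDual_surjective : Function.Surjective (traceDual n) := by
  refine (LinearMap.injective_iff_surjective_of_finrank_eq_finrank ?_).1 traceDual_injective
  rw [← (LinearMap.toContinuousLinearMap : (Mat n →ₗ[ℂ] ℂ) ≃ₗ[ℂ] (Mat n →L[ℂ] ℂ)).finrank_eq]
  exact (Subspace.dual_finrank_eq (K := ℂ) (V := Mat n)).symm

/-- A vector orthogonal, for the trace form, to everything orthogonal to a subspace lies in it. -/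
theorem mem_of_forall_trace_eq_zero {V : Submodule ℂ (Mat n)} {v : Mat n}
    (h : ∀ b : Mat n, (∀ u ∈ V, (b * u).trace = 0) → (b * v).trace = 0) : v ∈ V := by
  by_contra hv
  obtain ⟨φ, hφ, hV⟩ := Submodule.exists_le_ker_of_notMem hv
  obtain ⟨b, hb⟩ := traceDual_surjective (LinearMap.toContinuousLinearMap φ)
  have hb' : ∀ u, (b * u).trace = φ u := fun u =>
    congrArg (fun L : Mat n →L[ℂ] ℂ => L u) hb
  refine hφ ?_
  rw [← hb']
  exact h b fun u hu => (hb' u).trans (hV hu)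

theorem analyticAt_entry (i j : Fin n) (y : Mat n) : AnalyticAt ℂ (fun x : Mat n => x i j) y :=
  (LinearMap.toContinuousLinearMap (Matrix.entryLinearMap ℂ ℂ i j)).analyticAt y

/-- The coefficients of the characteristic polynomial are polynomials in the entries. -/
theorem charpoly_coeff_eq_aeval (k : ℕ) (x : Mat n) : x.charpoly.coeff k =
    MvPolynomial.aeval (fun p : Fin n × Fin n => x p.1 p.2)
      ((Matrix.charpoly.univ ℂ (Fin n)).coeff k) := by
  rw [MvPolynomial.aeval_eq_eval₂Hom, Matrix.charpoly.univ_coeff_eval₂Hom]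
  rfl

theorem analyticAt_aeval_entries (q : MvPolynomial (Fin n × Fin n) ℂ) (y : Mat n) :
    AnalyticAt ℂ (fun x : Mat n => MvPolynomial.aeval (fun p : Fin n × Fin n => x p.1 p.2) q) y := by
  induction q using MvPolynomial.induction_on with
  | C a => simpa using analyticAt_const
  | add p q hp hq => simp only [map_add]; exact hp.fun_add hq
  | mul_X p i hp =>
    simp only [map_mul, MvPolynomial.aeval_X]
    exact hp.fun_mul (analyticAt_entry i.1 i.2 y)

theorem analyticAt_charpoly_coeff (k : ℕ) (y : Mat n) :
    AnalyticAt ℂ (fun x : Mat n => x.charpoly.coeff k) y := by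
  simp_rw [charpoly_coeff_eq_aeval]
  exact analyticAt_aeval_entries _ y

/-- For `p = charpoly y`, the matrix `∑_{i ≥ k} p_i y ^ (i - k)`; for `k ≥ 1` these are the matrix
coefficients of the adjugate of `λ - y`. -/
noncomputable def adjCoeff (y : Mat n) (k : ℕ) : Mat n := aeval y (divX^[k] y.charpoly)

theorem coeff_iterate_divX (p : ℂ[X]) (k i : ℕ) : (divX^[k] p).coeff i = p.coeff (i + k) := by
  induction k generalizing i with
  | zero => rfl
  | succ k ih => rw [Function.iterate_succ_apply', coeff_divX, ih]; congr 1; ring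

theorem adjCoeff_zero (y : Mat n) : adjCoeff y 0 = 0 := Matrix.aeval_self_charpoly y

theorem adjCoeff_self (y : Mat n) : adjCoeff y n = 1 := by
  have : divX^[n] y.charpoly = 1 := by
    ext i
    rw [coeff_iterate_divX, coeff_one]
    have hd := y.charpoly_natDegree_eq_dim
    rw [Fintype.card_fin] at hd
    have hm := y.charpoly_monic.coeff_natDegree
    rw [hd] at hm
    split_ifs with h
    · subst h; simpa using hm
    · exact coeff_eq_zero_of_natDegree_lt (by omega)
  rw [adjCoeff, this, map_one]

theorem mul_adjCoeff_succ (y : Mat n) (k : ℕ) :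
    y * adjCoeff y (k + 1) = adjCoeff y k - y.charpoly.coeff k • (1 : Mat n) := by
  have h := divX_mul_X_add (divX^[k] y.charpoly)
  rw [coeff_iterate_divX, zero_add] at h
  have h2 := congrArg (aeval y) h
  rw [map_add, map_mul, aeval_X, aeval_C, ← Function.iterate_succ_apply' divX] at h2
  have hc : Commute y (adjCoeff y (k + 1)) := by
    have := Commute.all (X : ℂ[X]) (divX^[k + 1] y.charpoly)
    have := this.map (aeval y)
    rwa [aeval_X] at this
  rw [hc.eq, eq_sub_iff_add_eq, ← Algebra.algebraMap_eq_smul_one]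
  exact h2

/-- The generating function of the `adjCoeff y (k + 1)` is the adjugate of `t - y`. -/
theorem smul_one_sub_mul_sum_adjCoeff (y : Mat n) (t : ℂ) :
    (t • (1 : Mat n) - y) * ∑ k ∈ Finset.range n, t ^ k • adjCoeff y (k + 1) =
      y.charpoly.eval t • (1 : Mat n) := by
  have key : ∀ N, (t • (1 : Mat n) - y) * ∑ k ∈ Finset.range N, t ^ k • adjCoeff y (k + 1) =
      t ^ N • adjCoeff y N + (∑ k ∈ Finset.range N, y.charpoly.coeff k * t ^ k) • (1 : Mat n) := by
    intro N
    induction N with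
    | zero => simp [adjCoeff_zero]
    | succ N ih =>
      rw [Finset.sum_range_succ, mul_add, ih, Finset.sum_range_succ, sub_mul, smul_mul_assoc,
        one_mul, mul_smul_comm, mul_adjCoeff_succ]
      module
  rw [key, adjCoeff_self, ← add_smul]
  congr 1
  have hd := y.charpoly_natDegree_eq_dim
  have hm := y.charpoly_monic.coeff_natDegree
  rw [hd, Fintype.card_fin] at hm
  rw [eval_eq_sum_range, hd, Fintype.card_fin, Finset.sum_range_succ, hm]
  ring

/-- Jacobi's formula at an invertible matrix. -/
theorem hasDerivAt_det_sub_smul {a : Mat n} (ha : IsUnit a.det) (v : Mat n) :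
    HasDerivAt (fun t : ℂ => (a - t • v).det) (-(a.det * (a⁻¹ * v).trace)) 0 := by
  -- `q` collects the terms of order at least two in the expansion of `det (1 + X a⁻¹ v)`
  set q := (Matrix.det (1 + (X : ℂ[X]) • (a⁻¹ * v).map C)).divX.divX with hq
  have h : ∀ t : ℂ, (a - t • v).det =
      a.det * (1 + (a⁻¹ * v).trace * (-t) + q.eval (-t) * (-t) ^ 2) := by
    intro t
    rw [← Matrix.det_one_add_smul, ← Matrix.det_mul, mul_add, mul_one, mul_smul_comm,
      Matrix.mul_nonsing_inv_cancel_left _ _ ha, neg_smul, sub_eq_add_neg]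
  simp_rw [h]
  have hqd : HasDerivAt (fun t : ℂ => q.eval (-t)) (-(derivative q).eval 0) 0 := by
    have h2 : HasDerivAt (fun t : ℂ => q.eval t) ((derivative q).eval 0) (-(0 : ℂ)) := by
      rw [neg_zero]; exact q.hasDerivAt 0
    simpa [Function.comp_def] using h2.comp (0 : ℂ) (hasDerivAt_neg (0 : ℂ))
  have h3 := ((((hasDerivAt_neg (0 : ℂ)).const_mul (a⁻¹ * v).trace).const_add 1).add
    (hqd.mul ((hasDerivAt_neg (0 : ℂ)).pow 2))).const_mul a.det
  simpa using h3

/-- By Jacobi's formula, the differential of `det (t - y)` is `- tr (adj (t - y) v)`; compare the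
coefficients of the powers of `t`. -/
theorem fderiv_charpoly_coeff (y v : Mat n) {k : ℕ} (hk : k < n) :
    fderiv ℂ (fun x : Mat n => x.charpoly.coeff k) y v = -(adjCoeff y (k + 1) * v).trace := by
  set d : ℕ → ℂ := fun k => fderiv ℂ (fun x : Mat n => x.charpoly.coeff k) y v with hd
  have hder : ∀ k, HasDerivAt (fun t : ℂ => (y + t • v).charpoly.coeff k) (d k) 0 := by
    intro k
    have h1 : HasDerivAt (fun t : ℂ => y + t • v) v 0 := by
      have := ((hasDerivAt_id (0 : ℂ)).smul_const v).const_add y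
      rwa [one_smul] at this
    have h2 : HasFDerivAt (fun x : Mat n => x.charpoly.coeff k)
        (fderiv ℂ (fun x : Mat n => x.charpoly.coeff k) y) (y + (0 : ℂ) • v) := by
      simpa using (analyticAt_charpoly_coeff k y).differentiableAt.hasFDerivAt
    exact h2.comp_hasDerivAt 0 h1
  have hdeg : ∀ x : Mat n, x.charpoly.natDegree = n := fun x => by
    rw [x.charpoly_natDegree_eq_dim, Fintype.card_fin]
  have hlead : ∀ x : Mat n, x.charpoly.coeff n = 1 := fun x => by
    have := x.charpoly_monic.coeff_natDegree; rwa [hdeg] at this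
  set p : ℂ[X] := ∑ k ∈ Finset.range n, monomial k (d k) with hp
  set q : ℂ[X] := ∑ k ∈ Finset.range n, monomial k (-(adjCoeff y (k + 1) * v).trace) with hqdef
  have hpq : p = q := by
    -- it suffices to compare values at the `t` which are not eigenvalues of `y`
    refine Polynomial.eq_of_infinite_eval_eq p q (Set.Infinite.mono ?_
      (Polynomial.finite_setOfPred_isRoot y.charpoly_monic.ne_zero).infinite_compl)
    intro t ht
    have ht' : y.charpoly.eval t ≠ 0 := ht
    set a : Mat n := t • (1 : Mat n) - y with ha
    have hev : ∀ x : Mat n, x.charpoly.eval t = (t • (1 : Mat n) - x).det := by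
      intro x
      rw [Matrix.eval_charpoly, Matrix.scalar_apply, ← Matrix.smul_one_eq_diagonal]
    have hau : IsUnit a.det := by
      rw [ha, ← hev]; exact isUnit_iff_ne_zero.2 ht'
    have h1 : HasDerivAt (fun s : ℂ => (y + s • v).charpoly.eval t) (p.eval t) 0 := by
      have h2 : ∀ s : ℂ, (y + s • v).charpoly.eval t =
          ∑ k ∈ Finset.range n, (y + s • v).charpoly.coeff k * t ^ k + t ^ n := by
        intro s
        rw [eval_eq_sum_range, hdeg, Finset.sum_range_succ, hlead, one_mul]
      simp_rw [h2, hp, eval_finsetSum, eval_monomial]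
      exact (HasDerivAt.fun_sum fun k _ => (hder k).mul_const _).add_const _
    have h2 : HasDerivAt (fun s : ℂ => (y + s • v).charpoly.eval t)
        (-(a.det * (a⁻¹ * v).trace)) 0 := by
      have h3 : ∀ s : ℂ, (y + s • v).charpoly.eval t = (a - s • v).det := by
        intro s; rw [hev, ha, sub_add_eq_sub_sub]
      simp_rw [h3]
      exact hasDerivAt_det_sub_smul hau v
    have h4 : a.det • a⁻¹ = ∑ k ∈ Finset.range n, t ^ k • adjCoeff y (k + 1) := by
      have := smul_one_sub_mul_sum_adjCoeff y t
      rw [← ha, hev, ← ha] at this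
      rw [← Matrix.nonsing_inv_mul_cancel_left a (∑ k ∈ Finset.range n, _) hau, this,
        mul_smul_comm, mul_one]
    change p.eval t = q.eval t
    rw [h1.unique h2, ← smul_eq_mul, ← Matrix.trace_smul, ← smul_mul_assoc, h4, Finset.sum_mul,
      Matrix.trace_sum, hqdef, eval_finsetSum, ← Finset.sum_neg_distrib]
    refine Finset.sum_congr rfl fun k _ => ?_
    rw [eval_monomial, smul_mul_assoc, Matrix.trace_smul, smul_eq_mul]
    ring
  have h5 := congrArg (fun r : ℂ[X] => r.coeff k) hpq
  simpa [hp, hqdef, finsetSum_coeff, coeff_monomial, hk] using h5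

/-- The coefficients of the adjugate of `λ - y` are polynomials in `y` of degrees `n - 1, …, 0`. -/
theorem span_adjCoeff (y : Mat n) :
    Submodule.span ℂ (Set.range fun k : Fin n => adjCoeff y (k + 1)) =
      Submodule.span ℂ (Set.range fun j : Fin n => y ^ (j : ℕ)) := by
  refine le_antisymm ?_ ?_
  · rw [Submodule.span_le]
    rintro _ ⟨k, rfl⟩
    change aeval y _ ∈ Submodule.span ℂ (Set.range fun j : Fin n => y ^ (j : ℕ))
    rw [aeval_eq_sum_range]
    exact Submodule.sum_mem _ fun i _ => Submodule.smul_mem _ _ (pow_mem_span_pow y i)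
  · set V := Submodule.span ℂ (Set.range fun k : Fin n => adjCoeff y (k + 1)) with hV
    rcases Nat.eq_zero_or_pos n with rfl | hn
    · rw [Submodule.span_le]
      rintro _ ⟨j, rfl⟩
      exact j.elim0
    have h1 : (1 : Mat n) ∈ V := by
      refine Submodule.subset_span ⟨⟨n - 1, by omega⟩, ?_⟩
      simp only [Nat.sub_add_cancel hn]
      exact adjCoeff_self y
    have hy : V ≤ V.comap (LinearMap.mulLeft ℂ y) := by
      conv_lhs => rw [hV]
      rw [Submodule.span_le]
      rintro _ ⟨⟨k, hk⟩, rfl⟩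
      change y * adjCoeff y (k + 1) ∈ V
      rw [mul_adjCoeff_succ]
      refine Submodule.sub_mem _ ?_ (Submodule.smul_mem _ _ h1)
      rcases k with _ | k
      · rw [adjCoeff_zero]; exact Submodule.zero_mem _
      · exact Submodule.subset_span ⟨⟨k, by omega⟩, rfl⟩
    rw [Submodule.span_le]
    rintro _ ⟨j, rfl⟩
    have : ∀ i : ℕ, y ^ i ∈ V := by
      intro i
      induction i with
      | zero => simpa using h1
      | succ i ih => rw [pow_succ']; exact hy ih
    exact this j

/-! ### Corners -/

/-- The projection of `ℂ ^ n` onto its first `m` coordinates. -/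
def cornerProj (n m : ℕ) : Mat n := Matrix.diagonal fun i => if (i : ℕ) < m then 1 else 0

/-- The corner `x_m`, extended by zero to an `n × n` matrix. -/
def corner (m : ℕ) (x : Mat n) : Mat n := cornerProj n m * x * cornerProj n m

/-- The power `(x_m) ^ j`, extended by zero to an `n × n` matrix; it is the gradient, for the
trace form, of `tr ((x_m) ^ (j + 1)) / (j + 1)`. -/
def cornerPow (m j : ℕ) (x : Mat n) : Mat n := corner m x ^ j * cornerProj n m

theorem cornerProj_mul_cornerProj (m m' : ℕ) :
    cornerProj n m * cornerProj n m' = cornerProj n (min m m') := by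
  rw [cornerProj, cornerProj, cornerProj, Matrix.diagonal_mul_diagonal]
  congr 1
  ext i
  by_cases h : (i : ℕ) < m <;> by_cases h' : (i : ℕ) < m' <;> simp [h, h']

theorem cornerProj_eq_one {m : ℕ} (h : n ≤ m) : cornerProj n m = 1 := by
  rw [cornerProj, ← Matrix.diagonal_one]
  congr 1
  ext i
  simp [i.isLt.trans_le h]

theorem cornerPow_top (j : ℕ) (x : Mat n) : cornerPow n j x = x ^ j := by
  simp [cornerPow, corner, cornerProj_eq_one le_rfl]

/-- The matrix of the projection of `ℂ ^ n` onto its first `m` coordinates, as an `m × n` matrix. -/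
def cornerRestr {m : ℕ} (h : m ≤ n) : Matrix (Fin m) (Fin n) ℂ :=
  (1 : Mat n).submatrix (Fin.castLE h) id

open Matrix in
theorem cutoff_eq {m : ℕ} (h : m ≤ n) (x : Mat n) :
    cutoff m h x = cornerRestr h * x * (cornerRestr h)ᵀ := by
  have h1 : cornerRestr h * x = x.submatrix (Fin.castLE h) id := by
    ext i j
    simp [cornerRestr, Matrix.mul_apply, Matrix.one_apply]
  rw [h1]
  ext i j
  simp [cornerRestr, Matrix.mul_apply, Matrix.one_apply, cutoff]

open Matrix in
theorem cornerRestr_mul_transpose {m : ℕ} (h : m ≤ n) :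
    cornerRestr h * (cornerRestr h)ᵀ = 1 := by
  have := cutoff_eq h (1 : Mat n)
  rw [Matrix.mul_one] at this
  rw [← this, cutoff, Matrix.submatrix_one _ (Fin.castLE_injective h)]

open Matrix in
theorem transpose_mul_cornerRestr {m : ℕ} (h : m ≤ n) :
    (cornerRestr h)ᵀ * cornerRestr h = cornerProj n m := by
  ext i j
  rw [Matrix.mul_apply]
  simp only [cornerRestr, Matrix.transpose_apply, Matrix.submatrix_apply, Matrix.one_apply, id,
    cornerProj, Matrix.diagonal_apply, mul_ite, mul_one, mul_zero]
  by_cases hi : (i : ℕ) < m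
  · rw [Finset.sum_eq_single ⟨i, hi⟩]
    · have : Fin.castLE h ⟨i, hi⟩ = i := rfl
      rw [this]; simp [hi]
    · intro b _ hb
      have : Fin.castLE h b ≠ i := fun h' => hb (Fin.ext (by simp [← h']))
      simp [this]
    · simp
  · rw [Finset.sum_eq_zero]
    · simp [hi]
    · intro b _
      have : Fin.castLE h b ≠ i := fun h' => hi (by rw [← h']; simp)
      simp [this]

open Matrix in
/-- Extension by zero of an `m × m` matrix to an `n × n` matrix. -/
def padCorner {m : ℕ} (h : m ≤ n) : Mat m →ₗ[ℂ] Mat n where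
  toFun a := (cornerRestr h)ᵀ * a * cornerRestr h
  map_add' a b := by rw [Matrix.mul_add, Matrix.add_mul]
  map_smul' c a := by simp

open Matrix in
theorem padCorner_apply {m : ℕ} (h : m ≤ n) (a : Mat m) :
    padCorner h a = (cornerRestr h)ᵀ * a * cornerRestr h := rfl

theorem trace_mul_cutoff {m : ℕ} (h : m ≤ n) (a : Mat m) (v : Mat n) :
    (a * cutoff m h v).trace = (padCorner h a * v).trace := by
  rw [cutoff_eq, padCorner_apply, Matrix.mul_assoc, Matrix.mul_assoc, Matrix.mul_assoc,
    ← Matrix.mul_assoc a, ← Matrix.mul_assoc (a * _), ← Matrix.trace_mul_comm]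
  simp only [Matrix.mul_assoc]

theorem corner_eq_padCorner {m : ℕ} (h : m ≤ n) (x : Mat n) :
    corner m x = padCorner h (cutoff m h x) := by
  rw [corner, padCorner_apply, cutoff_eq, ← transpose_mul_cornerRestr h]
  simp only [Matrix.mul_assoc]

theorem padCorner_mul {m : ℕ} (h : m ≤ n) (a b : Mat m) :
    padCorner h (a * b) = padCorner h a * padCorner h b := by
  simp only [padCorner_apply, Matrix.mul_assoc]
  rw [← Matrix.mul_assoc (cornerRestr h), cornerRestr_mul_transpose, Matrix.one_mul]

theorem cornerPow_eq_padCorner {m : ℕ} (h : m ≤ n) (j : ℕ) (x : Mat n) :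
    cornerPow m j x = padCorner h (cutoff m h x ^ j) := by
  induction j with
  | zero =>
    rw [cornerPow, pow_zero, pow_zero, padCorner_apply, ← transpose_mul_cornerRestr h]
    simp only [Matrix.one_mul, Matrix.mul_one]
  | succ j ih =>
    rw [pow_succ', padCorner_mul, ← ih, cornerPow, cornerPow, pow_succ', mul_assoc,
      corner_eq_padCorner h]

/-! ### Strong regularity in terms of powers of corners -/

theorem analyticAt_charCoeff (i : (m : Fin n) × Fin (m + 1)) (y : Mat n) :
    AnalyticAt ℂ (charCoeff i) y := by
  have hlin : AnalyticAt ℂ (fun x : Mat n => cutoff (i.1 + 1) i.1.isLt x) y := by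
    set L : Mat n →ₗ[ℂ] Mat (i.1 + 1) :=
      { toFun := fun x => cutoff (i.1 + 1) i.1.isLt x
        map_add' := fun _ _ => rfl
        map_smul' := fun _ _ => rfl }
    exact (LinearMap.toContinuousLinearMap L).analyticAt y
  have h2 : AnalyticAt ℂ (fun x : Mat n => (cutoff (i.1 + 1) i.1.isLt x).charpoly.coeff i.2) y :=
    (analyticAt_charpoly_coeff (i.2 : ℕ) _).comp hlin
  exact analyticAt_const.mul h2

/-- The gradient of a coefficient of the characteristic polynomial of a corner, up to sign. -/
noncomputable def charCoeffGrad (i : (m : Fin n) × Fin (m + 1)) (y : Mat n) : Mat n :=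
  padCorner (m := i.1 + 1) i.1.isLt (adjCoeff (cutoff (i.1 + 1) i.1.isLt y) (i.2 + 1))

theorem fderiv_charCoeff (i : (m : Fin n) × Fin (m + 1)) (y : Mat n) :
    fderiv ℂ (charCoeff i) y =
      (-(-1) ^ ((i.1 : ℕ) - i.2 + 1) : ℂ) • traceDual n (charCoeffGrad i y) := by
  set L : Mat n →L[ℂ] Mat (i.1 + 1) := LinearMap.toContinuousLinearMap
      { toFun := fun x => cutoff (i.1 + 1) i.1.isLt x
        map_add' := fun _ _ => rfl
        map_smul' := fun _ _ => rfl } with hL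
  have hLa : ∀ x, L x = cutoff (i.1 + 1) i.1.isLt x := fun x => rfl
  have h1 := (analyticAt_charpoly_coeff (i.2 : ℕ) (L y)).differentiableAt.hasFDerivAt
  have h2 := (h1.comp y L.hasFDerivAt).const_mul ((-1) ^ ((i.1 : ℕ) - i.2 + 1) : ℂ)
  have h3 : HasFDerivAt (charCoeff i) _ y := h2
  rw [h3.fderiv]
  ext v
  simp only [FunLike.coe_smul, Pi.smul_apply, ContinuousLinearMap.comp_apply, traceDual_apply,
    smul_eq_mul]
  rw [fderiv_charpoly_coeff _ _ i.2.isLt, hLa, hLa, trace_mul_cutoff, charCoeffGrad]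
  ring

theorem fderiv_charCoeff_eq_zero_iff (i : (m : Fin n) × Fin (m + 1)) (y v : Mat n) :
    fderiv ℂ (charCoeff i) y v = 0 ↔ (charCoeffGrad i y * v).trace = 0 := by
  rw [fderiv_charCoeff]
  simp

theorem span_charCoeffGrad (m : Fin n) (y : Mat n) :
    Submodule.span ℂ (Set.range fun k : Fin (m + 1) => charCoeffGrad ⟨m, k⟩ y) =
      Submodule.span ℂ (Set.range fun j : Fin (m + 1) => cornerPow (m + 1) j y) := by
  have h := congrArg (Submodule.map (padCorner (m := m + 1) m.isLt))
    (span_adjCoeff (cutoff (m + 1) m.isLt y))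
  rw [Submodule.map_span, Submodule.map_span, ← Set.range_comp, ← Set.range_comp] at h
  have h2 : (fun j : Fin (m + 1) => cornerPow (n := n) (m + 1) j y) =
      (padCorner (m := m + 1) m.isLt) ∘ fun j : Fin (m + 1) => cutoff (m + 1) m.isLt y ^ (j : ℕ) :=
    funext fun j => cornerPow_eq_padCorner _ _ _
  rw [h2]
  exact h

theorem forall_trace_eq_zero_iff_of_span_eq {ι κ : Type} {a : ι → Mat n} {b : κ → Mat n}
    (h : Submodule.span ℂ (Set.range a) = Submodule.span ℂ (Set.range b)) (v : Mat n) :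
    (∀ i, (a i * v).trace = 0) ↔ ∀ k, (b k * v).trace = 0 := by
  have key : ∀ {ι : Type} (a : ι → Mat n), (∀ i, (a i * v).trace = 0) ↔
      Submodule.span ℂ (Set.range a) ≤
        LinearMap.ker ((Matrix.traceLinearMap (Fin n) ℂ ℂ) ∘ₗ LinearMap.mulRight ℂ v) := by
    intro ι a
    rw [Submodule.span_le, Set.range_subset_iff]
    rfl
  rw [key a, h, ← key b]

/-- The common kernel of the differentials of the coefficients of the characteristic polynomial of
one corner. -/
theorem forall_fderiv_charCoeff_eq_zero_iff (m : Fin n) (y v : Mat n) :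
    (∀ k : Fin (m + 1), fderiv ℂ (charCoeff ⟨m, k⟩) y v = 0) ↔
      ∀ j : Fin (m + 1), (cornerPow (m + 1) j y * v).trace = 0 := by
  simp_rw [fderiv_charCoeff_eq_zero_iff]
  exact forall_trace_eq_zero_iff_of_span_eq (span_charCoeffGrad m y) v

theorem span_range_sigma_eq {a b : ((m : Fin n) × Fin (m + 1)) → Mat n}
    (h : ∀ m : Fin n, Submodule.span ℂ (Set.range fun k : Fin (m + 1) => a ⟨m, k⟩) =
      Submodule.span ℂ (Set.range fun k : Fin (m + 1) => b ⟨m, k⟩)) :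
    Submodule.span ℂ (Set.range a) = Submodule.span ℂ (Set.range b) := by
  have key : ∀ a : ((m : Fin n) × Fin (m + 1)) → Mat n, Submodule.span ℂ (Set.range a) =
      ⨆ m : Fin n, Submodule.span ℂ (Set.range fun k : Fin (m + 1) => a ⟨m, k⟩) := by
    intro a
    rw [← Submodule.span_iUnion, Set.range_sigma_eq_iUnion_range]
  rw [key a, key b]
  exact iSup_congr h

/-- A matrix is strongly regular if and only if the powers `(y_m) ^ j`, `j < m ≤ n`, extended by
zero, are linearly independent. -/
theorem isStronglyRegular_iff {y : Mat n} :
    IsStronglyRegular y ↔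
      LinearIndependent ℂ fun i : (m : Fin n) × Fin (m + 1) => cornerPow (n := n) (i.1 + 1) i.2 y := by
  have h1 : IsStronglyRegular y ↔ LinearIndependent ℂ fun i => charCoeffGrad (n := n) i y := by
    have hu : ∀ i : (m : Fin n) × Fin (m + 1), IsUnit (-(-1) ^ ((i.1 : ℕ) - i.2 + 1) : ℂ) :=
      fun i => by simp
    have h2 : (fun i : (m : Fin n) × Fin (m + 1) => fderiv ℂ (charCoeff i) y) =
        (fun i => (hu i).unit) • ((traceDual n) ∘ fun i => charCoeffGrad i y) := by
      funext i
      rw [fderiv_charCoeff]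
      rfl
    have h3 : IsStronglyRegular y ↔
        LinearIndependent ℂ fun i : (m : Fin n) × Fin (m + 1) => fderiv ℂ (charCoeff i) y := Iff.rfl
    rw [h3, h2]
    refine (LinearIndependent.units_smul_iff (R := ℂ) _ _).trans ?_
    exact LinearMap.linearIndependent_iff _ (LinearMap.ker_eq_bot.2 traceDual_injective)
  have h2 : Submodule.span ℂ (Set.range fun i => charCoeffGrad (n := n) i y) =
      Submodule.span ℂ (Set.range fun i : (m : Fin n) × Fin (m + 1) =>
        cornerPow (n := n) (i.1 + 1) i.2 y) :=
    span_range_sigma_eq fun m => span_charCoeffGrad m y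
  rw [h1, linearIndependent_iff_card_eq_finrank_span, linearIndependent_iff_card_eq_finrank_span,
    Set.finrank, Set.finrank, h2]

end Gradients

/-! ### Strongly regular elements of regular orbits -/

section StronglyRegular

open Polynomial

variable {n : ℕ}

theorem cornerProj_mul_corner (m : ℕ) (x : Mat n) : cornerProj n m * corner m x = corner m x := by
  rw [corner, ← mul_assoc, ← mul_assoc, cornerProj_mul_cornerProj, min_self]

theorem corner_mul_cornerProj (m : ℕ) (x : Mat n) : corner m x * cornerProj n m = corner m x := by
  rw [corner, mul_assoc, cornerProj_mul_cornerProj, min_self]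

theorem commute_cornerProj_corner (m : ℕ) (x : Mat n) :
    Commute (cornerProj n m) (corner m x) := by
  rw [commute_iff_eq, cornerProj_mul_corner, corner_mul_cornerProj]

theorem cornerProj_mul_cornerPow (m j : ℕ) (x : Mat n) :
    cornerProj n m * cornerPow m j x = cornerPow m j x := by
  rw [cornerPow, ← mul_assoc, ((commute_cornerProj_corner m x).pow_right j).eq, mul_assoc,
    cornerProj_mul_cornerProj, min_self]

theorem cornerPow_mul_cornerProj (m j : ℕ) (x : Mat n) :
    cornerPow m j x * cornerProj n m = cornerPow m j x := by
  rw [cornerPow, mul_assoc, cornerProj_mul_cornerProj, min_self]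

theorem self_mem_adjointOrbit (x : Mat n) : x ∈ adjointOrbit x := ⟨1, by simp⟩

theorem adjointOrbit_symm {x y : Mat n} (h : y ∈ adjointOrbit x) : x ∈ adjointOrbit y := by
  obtain ⟨g, rfl⟩ := h
  refine ⟨g⁻¹, ?_⟩
  simp only [inv_inv, mul_assoc, Units.inv_mul, mul_one, Units.inv_mul_cancel_left]

theorem adjointOrbit_trans {x y z : Mat n} (h : y ∈ adjointOrbit x) (h' : z ∈ adjointOrbit y) :
    z ∈ adjointOrbit x := by
  obtain ⟨g, rfl⟩ := h
  obtain ⟨g', rfl⟩ := h'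
  refine ⟨g' * g, ?_⟩
  rw [mul_inv_rev, Units.val_mul, Units.val_mul]
  simp only [mul_assoc]

theorem isRegularMat_of_mem_adjointOrbit {x y : Mat n} (h : y ∈ adjointOrbit x)
    (hy : IsRegularMat y) : IsRegularMat x := by
  obtain ⟨g, rfl⟩ := h
  refine isRegularMat_of_linearIndependent_pow ?_
  set L : Mat n →ₗ[ℂ] Mat n := LinearMap.mulRight ℂ ((g⁻¹ : GL (Fin n) ℂ) : Mat n) ∘ₗ
    LinearMap.mulLeft ℂ (g : Mat n)
  have hL : (fun j : Fin n => ((g : Mat n) * x * ((g⁻¹ : GL (Fin n) ℂ) : Mat n)) ^ (j : ℕ)) =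
      L ∘ fun j : Fin n => x ^ (j : ℕ) := by
    funext j
    exact Units.conj_pow g x j
  have := hy.linearIndependent_pow
  rw [hL] at this
  exact this.of_comp L

theorem charpoly_eq_of_mem_adjointOrbit {x y : Mat n} (h : y ∈ adjointOrbit x) :
    y.charpoly = x.charpoly := by
  obtain ⟨g, rfl⟩ := h
  rw [Matrix.coe_units_inv]
  exact Matrix.charpoly_units_conj g x

/-- The powers of `y` itself are among the powers of its corners. -/
theorem IsStronglyRegular.isRegularMat {y : Mat n} (h : IsStronglyRegular y) : IsRegularMat y := by
  refine isRegularMat_of_linearIndependent_pow ?_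
  rcases Nat.eq_zero_or_pos n with rfl | hn
  · exact linearIndependent_empty_type
  have h1 := isStronglyRegular_iff.1 h
  set ι : Fin n → (m : Fin n) × Fin (m + 1) :=
    fun j => ⟨⟨n - 1, by omega⟩, ⟨j, by have := j.isLt; simp only; omega⟩⟩ with hι
  have hinj : Function.Injective ι := by
    intro j j' hjj
    simp only [hι, Sigma.mk.injEq, heq_eq_eq, true_and, Fin.mk.injEq] at hjj
    exact Fin.ext hjj
  have h2 := h1.comp ι hinj
  convert h2 using 1
  funext j
  simp only [hι, Function.comp_apply]
  rw [Nat.sub_add_cancel hn, cornerPow_top]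

/-- The last row of a power of a corner of a companion matrix, up to and including the entry one;
the entries to the right of it involve the coefficients of `p`. -/
theorem corner_companionMat_pow_apply {p : ℂ[X]} {m : ℕ} (hm : m < n) (k : ℕ) (b : Fin n)
    (hb : (b : ℕ) + k ≤ m) :
    (corner (m + 1) (companionMat n p) ^ k) ⟨m, hm⟩ b = if (b : ℕ) + k = m then 1 else 0 := by
  induction k generalizing b with
  | zero =>
    rw [pow_zero, Matrix.one_apply]
    simp [Fin.ext_iff, eq_comm]
  | succ k ih =>
    have hcol : ∀ c : Fin n, corner (m + 1) (companionMat n p) c b =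
        if (c : ℕ) = b + 1 then 1 else 0 := by
      intro c
      rw [corner, cornerProj, Matrix.mul_diagonal, Matrix.diagonal_mul]
      have h1 : (b : ℕ) < m + 1 := by omega
      have h2 : (b : ℕ) + 1 < n := by omega
      by_cases hc : (c : ℕ) = b + 1
      · have : (b : ℕ) + 1 < m + 1 := by omega
        simp [companionMat, h1, h2, hc, this]
      · simp [companionMat, h2, hc]
    rw [pow_succ, Matrix.mul_apply, Finset.sum_eq_single ⟨b + 1, by omega⟩]
    · rw [hcol, ih _ (by simp only; omega)]
      simp only [if_true, mul_one]
      congr 1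
      simp only [eq_iff_iff]
      omega
    · intro c _ hc
      have : (c : ℕ) ≠ b + 1 := fun h => hc (Fin.ext h)
      rw [hcol, if_neg this, mul_zero]
    · simp

/-- Companion matrices are strongly regular: in the entries at position `(m, m - k)` the powers of
the corners form a unitriangular system. -/
theorem isStronglyRegular_companionMat (p : ℂ[X]) : IsStronglyRegular (companionMat n p) := by
  set C := companionMat n p with hC
  rw [isStronglyRegular_iff, Fintype.linearIndependent_iff]
  intro c hc
  -- The coefficients `c ⟨m, k⟩` vanish by induction along the lexicographic order on the indices,
  -- from the top; `m * (n + 1) + k` encodes this order.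
  have key : ∀ N : ℕ, ∀ i : (m : Fin n) × Fin (m + 1),
      (n + 1) * (n + 1) - ((i.1 : ℕ) * (n + 1) + i.2) ≤ N → c i = 0 := by
    intro N
    induction N with
    | zero =>
      intro i hi
      exfalso
      have h1 := i.1.isLt
      have h2 : (i.2 : ℕ) < i.1 + 1 := i.2.isLt
      have h3 : ((i.1 : ℕ) + 1) * (n + 1) ≤ n * (n + 1) := Nat.mul_le_mul_right _ h1
      have h4 : (n + 1) * (n + 1) = n * (n + 1) + (n + 1) := by ring
      have h5 : ((i.1 : ℕ) + 1) * (n + 1) = i.1 * (n + 1) + (n + 1) := by ring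
      omega
    | succ N ih =>
      rintro ⟨m, k⟩ hi
      have hk : (k : ℕ) ≤ m := Nat.lt_succ_iff.1 k.isLt
      have hm := m.isLt
      -- in the entry at `(m, m - k)`, the smaller corners and the smaller powers of `C_m` vanish
      set b : Fin n := ⟨m - k, by omega⟩ with hb
      have hentry := congrFun (congrFun hc m) b
      rw [Matrix.sum_apply, Finset.sum_eq_single ⟨m, k⟩] at hentry
      · have h1 : cornerPow (n := n) ((m : ℕ) + 1) k C m b = 1 := by
          rw [cornerPow, cornerProj, Matrix.mul_diagonal,
            corner_companionMat_pow_apply hm k b (by simp only [hb]; omega)]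
          have h2 : (m : ℕ) - k + k = m := by omega
          have h3 : (m : ℕ) - k < m + 1 := by omega
          simp [hb, h2, h3]
        rw [Matrix.smul_apply, h1] at hentry
        simpa using hentry
      · rintro ⟨m', k'⟩ - hne
        have hk' : (k' : ℕ) ≤ m' := Nat.lt_succ_iff.1 k'.isLt
        have hm' := m'.isLt
        rw [Matrix.smul_apply]
        rcases lt_trichotomy (m' : ℕ) (m : ℕ) with hlt | heq | hgt
        · have h1 : cornerPow (n := n) ((m' : ℕ) + 1) k' C m b = 0 := by
            rw [← cornerProj_mul_cornerPow, cornerProj, Matrix.diagonal_mul, if_neg (by omega),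
              zero_mul]
          simp only [h1, smul_zero]
        · obtain rfl : m' = m := Fin.ext heq
          rcases lt_trichotomy (k' : ℕ) (k : ℕ) with hlt | heq | hgt
          · have h1 : cornerPow (n := n) ((m' : ℕ) + 1) k' C m' b = 0 := by
              rw [cornerPow, cornerProj, Matrix.mul_diagonal,
                corner_companionMat_pow_apply hm k' b (by simp only [hb]; omega),
                if_neg (by simp only [hb]; omega), zero_mul]
            simp only [h1, smul_zero]
          · exact absurd (by rw [Fin.ext heq]) hne
          · rw [ih ⟨m', k'⟩ (by simp only at hi ⊢; omega), zero_smul]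
        · rw [ih ⟨m', k'⟩ ?_, zero_smul]
          simp only at hi ⊢
          have h1 : ((m : ℕ) + 1) * (n + 1) ≤ m' * (n + 1) := Nat.mul_le_mul_right _ hgt
          have h5 : ((m : ℕ) + 1) * (n + 1) = m * (n + 1) + (n + 1) := by ring
          omega
      · simp
  exact fun i => key _ i le_rfl

theorem companionMat_mem_adjointOrbit {x : Mat n} (hx : IsRegularMat x) :
    companionMat n x.charpoly ∈ adjointOrbit x := by
  obtain ⟨v, hv⟩ := hx.exists_isCyclicVector
  have hu := isCyclicVector_iff_isUnit_krylov.1 hv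
  refine adjointOrbit_symm ⟨hu.unit, ?_⟩
  rw [Units.eq_mul_inv_iff_mul_eq]
  exact mul_krylov v x

theorem sregOrbit_nonempty_iff (x : Mat n) : (sregOrbit x).Nonempty ↔ IsRegularMat x := by
  constructor
  · rintro ⟨y, hy, hs⟩
    exact isRegularMat_of_mem_adjointOrbit hy hs.isRegularMat
  · intro hx
    exact ⟨_, companionMat_mem_adjointOrbit hx, isStronglyRegular_companionMat _⟩

end StronglyRegular

/-! ### Exponentials in a Banach algebra -/

section ExpUnit

variable {𝔸 : Type*} [NormedRing 𝔸] [NormedAlgebra ℂ 𝔸] [CompleteSpace 𝔸]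

-- `NormedSpace.exp` is defined for algebras over `ℚ`, whence the restriction of scalars.
theorem exp_mul_exp_of_commute {u v : 𝔸} (h : Commute u v) :
    NormedSpace.exp (u + v) = NormedSpace.exp u * NormedSpace.exp v :=
  let _ : NormedAlgebra ℚ 𝔸 := NormedAlgebra.restrictScalars ℚ ℂ 𝔸
  NormedSpace.exp_add_of_commute h

theorem exp_mul_exp_neg (u : 𝔸) : NormedSpace.exp u * NormedSpace.exp (-u) = 1 := by
  rw [← exp_mul_exp_of_commute (Commute.refl u).neg_right, add_neg_cancel, NormedSpace.exp_zero]

/-- The exponential of an element of a Banach algebra, as a unit. The unit comes with an explicit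
inverse, which makes conjugation by exponentials analytic without appeal to analyticity of
inversion. -/
noncomputable def expUnit (u : 𝔸) : 𝔸ˣ where
  val := NormedSpace.exp u
  inv := NormedSpace.exp (-u)
  val_inv := exp_mul_exp_neg u
  inv_val := by simpa using exp_mul_exp_neg (-u)

theorem expUnit_val (u : 𝔸) : (expUnit u : 𝔸) = NormedSpace.exp u := rfl

theorem expUnit_inv (u : 𝔸) : (((expUnit u)⁻¹ : 𝔸ˣ) : 𝔸) = NormedSpace.exp (-u) := rfl

theorem expUnit_zero : expUnit (0 : 𝔸) = 1 := Units.ext NormedSpace.exp_zero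

theorem expUnit_add_of_commute {u v : 𝔸} (h : Commute u v) :
    expUnit (u + v) = expUnit u * expUnit v :=
  Units.ext (exp_mul_exp_of_commute h)

theorem expUnit_conj (g : 𝔸ˣ) (u : 𝔸) :
    expUnit (g * u * ((g⁻¹ : 𝔸ˣ) : 𝔸)) = g * expUnit u * g⁻¹ :=
  let _ : NormedAlgebra ℚ 𝔸 := NormedAlgebra.restrictScalars ℚ ℂ 𝔸
  Units.ext (NormedSpace.exp_units_conj g u)

theorem Commute.expUnit_right {b u : 𝔸} (h : Commute b u) : Commute b (expUnit u : 𝔸) :=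
  let _ : NormedAlgebra ℚ 𝔸 := NormedAlgebra.restrictScalars ℚ ℂ 𝔸
  h.exp_right

theorem analyticAt_expUnit (u : 𝔸) : AnalyticAt ℂ (fun u : 𝔸 => (expUnit u : 𝔸)) u :=
  NormedSpace.exp_analytic (𝕂 := ℂ) u

theorem analyticAt_expUnit_inv (u : 𝔸) :
    AnalyticAt ℂ (fun u : 𝔸 => (((expUnit u)⁻¹ : 𝔸ˣ) : 𝔸)) u :=
  AnalyticAt.comp (g := NormedSpace.exp) (f := fun u : 𝔸 => -u)
    (NormedSpace.exp_analytic (𝕂 := ℂ) _) analyticAt_id.neg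

theorem hasDerivAt_expUnit (u : 𝔸) : HasDerivAt (fun t : ℂ => (expUnit (t • u) : 𝔸)) u 0 := by
  have h := hasDerivAt_exp_smul_const (𝕂 := ℂ) u (0 : ℂ)
  rw [zero_smul, NormedSpace.exp_zero, one_mul] at h
  exact h

theorem hasDerivAt_expUnit_inv (u : 𝔸) :
    HasDerivAt (fun t : ℂ => (((expUnit (t • u))⁻¹ : 𝔸ˣ) : 𝔸)) (-u) 0 := by
  have h := hasDerivAt_expUnit (-u)
  refine h.congr_of_eventuallyEq (Filter.Eventually.of_forall fun t => ?_)
  simp only [expUnit_inv, expUnit_val, smul_neg]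

/-- The trace property lets one differentiate a power as if the algebra were commutative. -/
theorem hasFDerivAt_tracial_pow {𝔸 : Type*} [NormedRing 𝔸] [NormedAlgebra ℂ 𝔸]
    (τ : 𝔸 →L[ℂ] ℂ) (hτ : ∀ a b, τ (a * b) = τ (b * a)) (a : 𝔸)
    (j : ℕ) :
    HasFDerivAt (fun x : 𝔸 => τ (x ^ (j + 1)))
      (((j : ℂ) + 1) • τ.comp (ContinuousLinearMap.mul ℂ 𝔸 (a ^ j))) a := by
  have h := τ.hasFDerivAt.comp a (hasFDerivAt_pow' (𝕜 := ℂ) (j + 1) (x := a))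
  refine h.congr_fderiv ?_
  ext v
  simp only [ContinuousLinearMap.comp_apply, sum_apply, map_sum]
  have : ∀ i ∈ Finset.range (j + 1),
      τ ((MulOpposite.op (a ^ i) • a ^ ((j + 1).pred - i) • ContinuousLinearMap.id ℂ 𝔸) v) =
        τ (a ^ j * v) := by
    intro i hi
    change τ (a ^ ((j + 1).pred - i) * v * a ^ i) = _
    rw [hτ, ← mul_assoc, ← pow_add]
    congr 3
    have := Finset.mem_range.1 hi
    simp only [Nat.pred_eq_sub_one, Nat.add_sub_cancel]
    omega
  refine (Finset.sum_congr rfl this).trans ?_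
  simp

end ExpUnit

/-! ### Corners of conjugates -/

section CornerConj

variable {n : ℕ}

theorem commute_units_inv {g : (Mat n)ˣ} {b : Mat n} (h : Commute b g) :
    Commute b ((g⁻¹ : (Mat n)ˣ) : Mat n) := h.units_inv_right

theorem corner_conj {m : ℕ} {g : (Mat n)ˣ} (h : Commute (cornerProj n m) (g : Mat n)) (y : Mat n) :
    corner m ((g : Mat n) * y * ((g⁻¹ : (Mat n)ˣ) : Mat n)) =
      (g : Mat n) * corner m y * ((g⁻¹ : (Mat n)ˣ) : Mat n) := by
  have h' := commute_units_inv h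
  rw [corner, corner]
  simp only [mul_assoc]
  rw [← h'.eq]
  simp only [← mul_assoc]
  rw [h.eq]

theorem cornerPow_conj {m : ℕ} {g : (Mat n)ˣ} (h : Commute (cornerProj n m) (g : Mat n))
    {y y' : Mat n}
    (hy : corner m y' = (g : Mat n) * corner m y * ((g⁻¹ : (Mat n)ˣ) : Mat n)) (j : ℕ) :
    cornerPow m j y' = (g : Mat n) * cornerPow m j y * ((g⁻¹ : (Mat n)ˣ) : Mat n) := by
  have h' := commute_units_inv h
  rw [cornerPow, cornerPow, hy, Units.conj_pow]
  simp only [mul_assoc]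
  rw [← h'.eq]

theorem corner_corner {m m' : ℕ} (h : m ≤ m') (y : Mat n) : corner m (corner m' y) = corner m y := by
  rw [corner, corner, corner, mul_assoc, mul_assoc, mul_assoc, cornerProj_mul_cornerProj, ← mul_assoc,
    ← mul_assoc, cornerProj_mul_cornerProj, min_eq_left h, min_eq_right h, mul_assoc]

theorem cutoff_corner {m : ℕ} (h : m ≤ n) (y : Mat n) : cutoff m h (corner m y) = cutoff m h y := by
  ext i j
  rw [cutoff, cutoff, corner, cornerProj, Matrix.submatrix_apply, Matrix.mul_diagonal,
    Matrix.diagonal_mul]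
  simp

/-- Conjugation by a matrix preserving the first `m` coordinates conjugates the corner `y_m`. -/
theorem charpoly_cutoff_conj {m : ℕ} (hm : m ≤ n) {g : (Mat n)ˣ}
    (h : Commute (cornerProj n m) (g : Mat n)) (y : Mat n) :
    (cutoff m hm ((g : Mat n) * y * ((g⁻¹ : (Mat n)ˣ) : Mat n))).charpoly =
      (cutoff m hm y).charpoly := by
  have hR : cornerRestr hm * cornerProj n m = cornerRestr hm := by
    rw [← transpose_mul_cornerRestr hm, ← Matrix.mul_assoc, cornerRestr_mul_transpose,
      Matrix.one_mul]
  have key : ∀ a b : Mat n, Commute (cornerProj n m) a →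
      cutoff m hm (a * b) = cutoff m hm a * cutoff m hm b := by
    intro a b hab
    have h1 : cornerRestr hm * a = cornerRestr hm * a * cornerProj n m := by
      conv_lhs => rw [← hR]
      rw [Matrix.mul_assoc, hab.eq, ← Matrix.mul_assoc]
    rw [cutoff_eq, cutoff_eq, cutoff_eq, ← Matrix.mul_assoc]
    conv_lhs => rw [h1, ← transpose_mul_cornerRestr hm]
    simp only [Matrix.mul_assoc]
  have key' : ∀ a b : Mat n, Commute (cornerProj n m) b →
      cutoff m hm (a * b) = cutoff m hm a * cutoff m hm b := by
    intro a b hab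
    have hcm : ∀ a : Mat n, cutoff m hm (a * cornerProj n m) = cutoff m hm a := by
      intro a
      ext i j
      rw [cutoff, cutoff, cornerProj, Matrix.submatrix_apply, Matrix.mul_diagonal]
      simp
    have h3 : cutoff m hm (a * b) = cutoff m hm (a * cornerProj n m * b) := by
      rw [mul_assoc, hab.eq, ← mul_assoc, hcm]
    rw [h3, cutoff_eq, cutoff_eq, cutoff_eq, ← transpose_mul_cornerRestr hm]
    simp only [Matrix.mul_assoc]
  have hone : cutoff m hm (1 : Mat n) = 1 := by
    rw [cutoff, Matrix.submatrix_one _ (Fin.castLE_injective hm)]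
  set P : (Mat m)ˣ :=
    { val := cutoff m hm g
      inv := cutoff m hm ((g⁻¹ : (Mat n)ˣ) : Mat n)
      val_inv := by rw [← key _ _ h, Units.mul_inv, hone]
      inv_val := by rw [← key' _ _ h, Units.inv_mul, hone] } with hP
  have h4 : cutoff m hm ((g : Mat n) * y * ((g⁻¹ : (Mat n)ˣ) : Mat n)) =
      (P : Mat m) * cutoff m hm y * ((P⁻¹ : (Mat m)ˣ) : Mat m) := by
    rw [key' _ _ (commute_units_inv h), key _ _ h]
    rfl
  rw [h4, Matrix.coe_units_inv]
  exact Matrix.charpoly_units_conj P _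

end CornerConj

/-! ### The Gelfand-Zeitlin action -/

section Action

variable {n : ℕ}

/-- Stated for the uniform structure of the norm, with respect to which instance search looks for
completeness here. -/
theorem completeSpace_mat (n : ℕ) : @CompleteSpace (Mat n) PseudoMetricSpace.toUniformSpace :=
  FiniteDimensional.complete ℂ (Mat n)

attribute [local instance] completeSpace_mat

/-- The gradient of `traceFun i` for the trace form, a power of the corner of size `i.1 + 1`. The
subtraction is not truncated, as `i.2 ≤ i.1`. -/
noncomputable def traceFunGrad (i : GZIndex n) (y : Mat n) : Mat n :=
  cornerPow (i.1 + 1) (i.1 - i.2) y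

/-- Hamiltonian vector fields are commutators with the gradient for the trace form. -/
theorem hamiltonianField_eq {f : Mat n → ℂ} {x G : Mat n}
    (h : ∀ v, fderiv ℂ f x v = (G * v).trace) : hamiltonianField f x = G * x - x * G := by
  have he : ∀ s t : Fin n, ∀ v : Mat n, fderiv ℂ (fun y : Mat n => y s t) x v = v s t := by
    intro s t v
    have := (LinearMap.toContinuousLinearMap (Matrix.entryLinearMap ℂ ℂ s t)).hasFDerivAt (x := x)
    have h2 : HasFDerivAt (fun y : Mat n => y s t)
      (LinearMap.toContinuousLinearMap (Matrix.entryLinearMap ℂ ℂ s t)) x := this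
    rw [h2.fderiv]
    rfl
  ext s t
  have h1 : hamiltonianField f x s t = ∑ i, ∑ j, ∑ s', ∑ t',
      fderiv ℂ f x (Matrix.single i j 1) *
        fderiv ℂ (fun y : Mat n => y s t) x (Matrix.single s' t' 1) *
      ((if j = s' then x i t' else 0) - (if i = t' then x s' j else 0)) := rfl
  have h2 : ∀ i j s' t', fderiv ℂ f x (Matrix.single i j 1) *
      fderiv ℂ (fun y : Mat n => y s t) x (Matrix.single s' t' 1) *
      ((if j = s' then x i t' else 0) - (if i = t' then x s' j else 0)) =
      if t' = t then (if s' = s then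
        G j i * ((if j = s then x i t else 0) - (if i = t then x s j else 0)) else 0) else 0 := by
    intro i j s' t'
    rw [h, he, Matrix.trace_mul_single, Matrix.single_apply]
    by_cases hs : s' = s
    · by_cases ht : t' = t
      · simp [hs, ht]
      · simp [hs, ht]
    · simp [hs]
  rw [h1]
  simp_rw [h2]
  simp only [Finset.sum_ite_eq', Finset.mem_univ, if_true, mul_sub, Finset.sum_sub_distrib,
    mul_ite, mul_zero]
  rw [Matrix.sub_apply, Matrix.mul_apply, Matrix.mul_apply]
  congr 1
  rw [Finset.sum_comm]
  refine Finset.sum_congr rfl fun i _ => ?_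
  simp [mul_comm]

theorem fderiv_traceFun (i : GZIndex n) (y v : Mat n) :
    fderiv ℂ (traceFun i) y v = (traceFunGrad i y * v).trace := by
  have hm : (i.1 : ℕ) + 1 ≤ n := by have := i.1.isLt; omega
  set L : Mat n →L[ℂ] Mat (i.1 + 1) := LinearMap.toContinuousLinearMap
      { toFun := fun x => cutoff (i.1 + 1) hm x
        map_add' := fun _ _ => rfl
        map_smul' := fun _ _ => rfl } with hL
  have hLa : ∀ x, L x = cutoff (i.1 + 1) hm x := fun x => rfl
  set τ : Mat (i.1 + 1) →L[ℂ] ℂ :=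
    LinearMap.toContinuousLinearMap (Matrix.traceLinearMap (Fin (i.1 + 1)) ℂ ℂ) with hτ
  have hτa : ∀ x, τ x = x.trace := fun x => rfl
  set j : ℕ := i.1 - i.2 with hj
  have hj1 : (i.1 : ℕ) + 1 - i.2 = j + 1 := by have : (i.2 : ℕ) < i.1 + 1 := i.2.isLt; omega
  have h1 := hasFDerivAt_tracial_pow τ
    (fun a b => by rw [hτa, hτa, Matrix.trace_mul_comm]) (L y) j
  have h2 := (h1.comp y L.hasFDerivAt).const_mul (1 / (((j + 1 : ℕ)) : ℂ))
  have h3 := h2.congr_of_eventuallyEq (f₁ := traceFun i) (Filter.Eventually.of_forall fun x => by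
    change (1 / (((i.1 : ℕ) + 1 - i.2 : ℕ) : ℂ)) * (cutoff (i.1 + 1) hm x ^ _).trace = _
    rw [hj1]
    rfl)
  rw [h3.fderiv]
  have h4 : ((j + 1 : ℕ) : ℂ) ≠ 0 := Nat.cast_ne_zero.2 (Nat.succ_ne_zero j)
  have h5 : (cutoff (i.1 + 1) hm y ^ j * cutoff (i.1 + 1) hm v).trace =
      (traceFunGrad i y * v).trace := by
    rw [trace_mul_cutoff, ← cornerPow_eq_padCorner]
    rfl
  rw [← h5]
  change 1 / ((j + 1 : ℕ) : ℂ) * (((j : ℂ) + 1) * (cutoff (i.1 + 1) hm y ^ j *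
    cutoff (i.1 + 1) hm v).trace) = _
  push_cast at h4 ⊢
  field_simp

theorem hamiltonianField_traceFun (i : GZIndex n) (y : Mat n) :
    hamiltonianField (traceFun i) y = traceFunGrad i y * y - y * traceFunGrad i y :=
  hamiltonianField_eq (fderiv_traceFun i y)

/-- The infinitesimal generator contributed by the corner of size `m + 1`. -/
noncomputable def gzGen (m : ℕ) (a : GZIndex n → ℂ) (y : Mat n) : Mat n :=
  if h : m < n - 1 then ∑ k : Fin (m + 1), a ⟨⟨m, h⟩, k⟩ • cornerPow (m + 1) (m - k) y else 0

/-- The product over `k < m` of the exponentials of the generators `gzGen k`. -/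
noncomputable def gzConj (a : GZIndex n → ℂ) (y : Mat n) : ℕ → (Mat n)ˣ
  | 0 => 1
  | m + 1 => gzConj a y m * expUnit (gzGen m a y)

/-- The Gelfand-Zeitlin action in closed form. The flow of the corner functions of size `m` is
conjugation by the exponential of a polynomial in the conserved corner `y_m`. -/
noncomputable def gzAction (a : GZIndex n → ℂ) (y : Mat n) : Mat n :=
  (gzConj a y (n - 1) : Mat n) * y * (((gzConj a y (n - 1))⁻¹ : (Mat n)ˣ) : Mat n)

theorem gzGen_add (m : ℕ) (a b : GZIndex n → ℂ) (y : Mat n) :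
    gzGen m (a + b) y = gzGen m a y + gzGen m b y := by
  unfold gzGen
  split_ifs with h
  · simp [add_smul, Finset.sum_add_distrib]
  · simp

theorem gzGen_smul (m : ℕ) (t : ℂ) (a : GZIndex n → ℂ) (y : Mat n) :
    gzGen m (t • a) y = t • gzGen m a y := by
  unfold gzGen
  split_ifs with h
  · simp [mul_smul, Finset.smul_sum]
  · simp

theorem commute_gzGen {m : ℕ} {b y : Mat n} (h : ∀ j, Commute b (cornerPow (m + 1) j y))
    (a : GZIndex n → ℂ) : Commute b (gzGen m a y) := by
  unfold gzGen
  split_ifs with h'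
  · exact Commute.sum_right _ _ _ fun k _ => (h _).smul_right _
  · exact Commute.zero_right _

theorem commute_cornerProj_cornerPow {m m' : ℕ} (h : m' ≤ m) (j : ℕ) (y : Mat n) :
    Commute (cornerProj n m) (cornerPow m' j y) := by
  have h1 : cornerProj n m * cornerPow m' j y = cornerPow m' j y := by
    rw [← cornerProj_mul_cornerPow, ← mul_assoc, cornerProj_mul_cornerProj, min_eq_right h]
  have h2 : cornerPow m' j y * cornerProj n m = cornerPow m' j y := by
    rw [← cornerPow_mul_cornerProj, mul_assoc, cornerProj_mul_cornerProj, min_eq_left h]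
  rw [commute_iff_eq, h1, h2]

theorem commute_corner_cornerPow (m j : ℕ) (y : Mat n) :
    Commute (corner m y) (cornerPow m j y) :=
  ((Commute.refl _).pow_right j).mul_right (commute_cornerProj_corner m y).symm

theorem commute_cornerPow_cornerPow (m j j' : ℕ) (y : Mat n) :
    Commute (cornerPow m j y) (cornerPow m j' y) :=
  Commute.mul_left ((commute_corner_cornerPow m j' y).pow_left j)
    (commute_cornerProj_cornerPow le_rfl j' y)

theorem commute_gzGen_gzGen (m : ℕ) (a b : GZIndex n → ℂ) (y : Mat n) :
    Commute (gzGen m a y) (gzGen m b y) :=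
  commute_gzGen (fun j => (commute_gzGen (fun j' => commute_cornerPow_cornerPow _ j j' y) a).symm) b

theorem commute_cornerProj_gzConj {m m' : ℕ} (h : m ≤ m') (a : GZIndex n → ℂ) (y : Mat n) :
    Commute (cornerProj n m') (gzConj a y m : Mat n) := by
  induction m with
  | zero => exact Commute.one_right _
  | succ m ih =>
    rw [gzConj, Units.val_mul]
    exact (ih (by omega)).mul_right
      (commute_gzGen (fun j => commute_cornerProj_cornerPow h j y) a).expUnit_right

/-- The corner of size `m + 1` is only moved by the first `m` factors. -/
theorem corner_gzConj (a : GZIndex n → ℂ) (y : Mat n) (m r : ℕ) :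
    corner (m + 1) ((gzConj a y (m + r) : Mat n) * y *
        (((gzConj a y (m + r))⁻¹ : (Mat n)ˣ) : Mat n)) =
      (gzConj a y m : Mat n) * corner (m + 1) y * (((gzConj a y m)⁻¹ : (Mat n)ˣ) : Mat n) := by
  induction r with
  | zero => exact corner_conj (commute_cornerProj_gzConj (Nat.le_succ m) a y) y
  | succ r ih =>
    set H := gzConj a y (m + r) with hH
    set E := expUnit (gzGen (m + r) a y) with hE
    have hHc : Commute (cornerProj n (m + r + 1)) (H : Mat n) :=
      commute_cornerProj_gzConj (Nat.le_succ _) a y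
    have hEc : Commute (cornerProj n (m + r + 1)) (E : Mat n) :=
      (commute_gzGen (fun j => commute_cornerProj_cornerPow le_rfl j y) a).expUnit_right
    have hEy : Commute (corner (m + r + 1) y) (E : Mat n) :=
      (commute_gzGen (fun j => commute_corner_cornerPow _ j y) a).expUnit_right
    have h1 : gzConj a y (m + (r + 1)) = H * E := rfl
    have h2 : corner (m + r + 1) ((E : Mat n) * y * ((E⁻¹ : (Mat n)ˣ) : Mat n)) =
        corner (m + r + 1) y := by
      rw [corner_conj hEc, ← hEy.eq, mul_assoc, Units.mul_inv, mul_one]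
    have h3 : ((H * E : (Mat n)ˣ) : Mat n) * y * (((H * E)⁻¹ : (Mat n)ˣ) : Mat n) =
        (H : Mat n) * ((E : Mat n) * y * ((E⁻¹ : (Mat n)ˣ) : Mat n)) *
          ((H⁻¹ : (Mat n)ˣ) : Mat n) := by
      rw [mul_inv_rev, Units.val_mul, Units.val_mul]
      simp only [mul_assoc]
    rw [h1, h3, ← corner_corner (show m + 1 ≤ m + r + 1 by omega), corner_conj hHc, h2,
      ← corner_conj hHc, corner_corner (by omega), ih]

theorem corner_gzAction {m : ℕ} (hm : m ≤ n - 1) (a : GZIndex n → ℂ) (y : Mat n) :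
    corner (m + 1) (gzAction a y) =
      (gzConj a y m : Mat n) * corner (m + 1) y * (((gzConj a y m)⁻¹ : (Mat n)ˣ) : Mat n) := by
  have := corner_gzConj a y m (n - 1 - m)
  rwa [Nat.add_sub_cancel' hm] at this

theorem charCoeff_gzAction (i : (m : Fin n) × Fin (m + 1)) (a : GZIndex n → ℂ) (y : Mat n) :
    charCoeff i (gzAction a y) = charCoeff i y := by
  have hm : (i.1 : ℕ) ≤ n - 1 := by have := i.1.isLt; omega
  have hc := commute_cornerProj_gzConj (Nat.le_succ (i.1 : ℕ)) a y
  have h1 : (cutoff (i.1 + 1) i.1.isLt (gzAction a y)).charpoly =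
      (cutoff (i.1 + 1) i.1.isLt y).charpoly := by
    rw [← cutoff_corner, corner_gzAction hm, charpoly_cutoff_conj _ hc, cutoff_corner]
  rw [charCoeff, charCoeff, h1]

/-- The action conjugates the corners, hence the generators, by the factors of the smaller corners. -/
theorem gzGen_gzAction {m : ℕ} (a b : GZIndex n → ℂ) (y : Mat n) :
    gzGen m a (gzAction b y) = if m < n - 1 then
      (gzConj b y m : Mat n) * gzGen m a y * (((gzConj b y m)⁻¹ : (Mat n)ˣ) : Mat n) else 0 := by
  unfold gzGen
  split_ifs with h
  · rw [Finset.mul_sum, Finset.sum_mul]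
    refine Finset.sum_congr rfl fun k _ => ?_
    rw [cornerPow_conj (commute_cornerProj_gzConj (Nat.le_succ m) b y) (corner_gzAction h.le b y),
      mul_smul_comm, smul_mul_assoc]
  · rfl

/-- The cocycle identity behind the group law. The new factor `exp (gzGen m a (gzAction b y))` is the
conjugate of `exp (gzGen m a y)` by `gzConj b y m`, and so can be moved past the latter. -/
theorem gzConj_gzAction_mul (a b : GZIndex n → ℂ) (y : Mat n) {m : ℕ} (hm : m ≤ n - 1) :
    gzConj a (gzAction b y) m * gzConj b y m = gzConj (a + b) y m := by
  induction m with
  | zero => simp [gzConj]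
  | succ m ih =>
    rw [gzConj, gzConj, gzConj, ← ih (by omega), gzGen_gzAction, if_pos (by omega), expUnit_conj,
      gzGen_add, expUnit_add_of_commute (commute_gzGen_gzGen m a b y)]
    group

theorem gzAction_add (a b : GZIndex n → ℂ) (y : Mat n) :
    gzAction (a + b) y = gzAction a (gzAction b y) := by
  have h1 : gzAction (a + b) y = (gzConj (a + b) y (n - 1) : Mat n) * y *
    (((gzConj (a + b) y (n - 1))⁻¹ : (Mat n)ˣ) : Mat n) := rfl
  have h2 : gzAction a (gzAction b y) = (gzConj a (gzAction b y) (n - 1) : Mat n) * gzAction b y *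
    (((gzConj a (gzAction b y) (n - 1))⁻¹ : (Mat n)ˣ) : Mat n) := rfl
  rw [h1, h2, ← gzConj_gzAction_mul a b y le_rfl]
  generalize gzConj a (gzAction b y) (n - 1) = g
  rw [gzAction, mul_inv_rev, Units.val_mul, Units.val_mul]
  simp only [mul_assoc]

theorem gzConj_zero (y : Mat n) (m : ℕ) : gzConj 0 y m = 1 := by
  induction m with
  | zero => rfl
  | succ m ih =>
    have : gzGen m (0 : GZIndex n → ℂ) y = 0 := by
      have := gzGen_smul m 0 (0 : GZIndex n → ℂ) y
      rwa [zero_smul, zero_smul] at this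
    rw [gzConj, ih, this, expUnit_zero, one_mul]

theorem gzAction_zero (y : Mat n) : gzAction 0 y = y := by
  rw [gzAction, gzConj_zero]; simp

theorem gzAction_mem_adjointOrbit (a : GZIndex n → ℂ) (y : Mat n) :
    gzAction a y ∈ adjointOrbit y := ⟨gzConj a y (n - 1), rfl⟩

theorem analyticAt_cornerPow (m j : ℕ) (y : Mat n) : AnalyticAt ℂ (cornerPow m j) y := by
  have h1 : AnalyticAt ℂ (fun y : Mat n => corner m y) y :=
    (analyticAt_const.fun_mul analyticAt_id).fun_mul analyticAt_const
  exact (h1.fun_pow j).fun_mul analyticAt_const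

theorem analyticAt_gzGen (m : ℕ) (p : (GZIndex n → ℂ) × Mat n) :
    AnalyticAt ℂ (fun p : (GZIndex n → ℂ) × Mat n => gzGen m p.1 p.2) p := by
  unfold gzGen
  split_ifs with h
  · refine Finset.analyticAt_fun_sum _ fun k _ => ?_
    have h1 : AnalyticAt ℂ (fun p : (GZIndex n → ℂ) × Mat n => p.1 ⟨⟨m, h⟩, k⟩) p :=
      ((ContinuousLinearMap.proj (R := ℂ) (φ := fun _ : GZIndex n => ℂ) ⟨⟨m, h⟩, k⟩).comp
        (ContinuousLinearMap.fst ℂ (GZIndex n → ℂ) (Mat n))).analyticAt p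
    have h2 : AnalyticAt ℂ (fun p : (GZIndex n → ℂ) × Mat n => cornerPow (m + 1) (m - k) p.2) p :=
      AnalyticAt.comp (g := cornerPow (m + 1) (m - k))
        (f := fun p : (GZIndex n → ℂ) × Mat n => p.2) (analyticAt_cornerPow _ _ _) analyticAt_snd
    exact h1.fun_smul h2
  · exact analyticAt_const

theorem analyticAt_gzConj (m : ℕ) (p : (GZIndex n → ℂ) × Mat n) :
    AnalyticAt ℂ (fun p : (GZIndex n → ℂ) × Mat n => (gzConj p.1 p.2 m : Mat n)) p ∧
    AnalyticAt ℂ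
      (fun p : (GZIndex n → ℂ) × Mat n => (((gzConj p.1 p.2 m)⁻¹ : (Mat n)ˣ) : Mat n)) p := by
  induction m with
  | zero => simp only [gzConj]; exact ⟨analyticAt_const, analyticAt_const⟩
  | succ m ih =>
    simp only [gzConj, mul_inv_rev, Units.val_mul]
    have h1 := analyticAt_gzGen m p
    exact ⟨ih.1.fun_mul (AnalyticAt.comp (g := fun u : Mat n => (expUnit u : Mat n))
        (analyticAt_expUnit _) h1),
      (AnalyticAt.comp (g := fun u : Mat n => (((expUnit u)⁻¹ : (Mat n)ˣ) : Mat n))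
        (analyticAt_expUnit_inv _) h1).fun_mul ih.2⟩

theorem hasDerivAt_gzConj (a : GZIndex n → ℂ) (y : Mat n) (m : ℕ) :
    HasDerivAt (fun t : ℂ => (gzConj (t • a) y m : Mat n)) (∑ k ∈ Finset.range m, gzGen k a y) 0 ∧
    HasDerivAt (fun t : ℂ => (((gzConj (t • a) y m)⁻¹ : (Mat n)ˣ) : Mat n))
      (-∑ k ∈ Finset.range m, gzGen k a y) 0 := by
  induction m with
  | zero =>
    simp only [gzConj, Finset.range_zero, Finset.sum_empty, neg_zero]
    exact ⟨hasDerivAt_const _ _, hasDerivAt_const _ _⟩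
  | succ m ih =>
    simp only [gzConj, mul_inv_rev, Units.val_mul, gzGen_smul]
    constructor
    · have := ih.1.fun_mul (hasDerivAt_expUnit (gzGen m a y))
      refine this.congr_deriv ?_
      simp [gzConj_zero, expUnit_zero, Finset.sum_range_succ]
    · have := (hasDerivAt_expUnit_inv (gzGen m a y)).fun_mul ih.2
      refine this.congr_deriv ?_
      simp [gzConj_zero, expUnit_zero, Finset.sum_range_succ]

theorem sum_gzGen (a : GZIndex n → ℂ) (y : Mat n) :
    ∑ k ∈ Finset.range (n - 1), gzGen k a y = ∑ i, a i • traceFunGrad i y := by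
  rw [Finset.sum_range, ← Finset.univ_sigma_univ, Finset.sum_sigma]
  refine Finset.sum_congr rfl fun m _ => ?_
  rw [gzGen, dif_pos m.isLt]
  rfl

theorem sum_hamiltonianField (a : GZIndex n → ℂ) (y : Mat n) :
    ∑ i, a i • hamiltonianField (traceFun i) y =
      (∑ i, a i • traceFunGrad i y) * y - y * ∑ i, a i • traceFunGrad i y := by
  simp_rw [hamiltonianField_traceFun, smul_sub, Finset.sum_sub_distrib, Finset.sum_mul,
    Finset.mul_sum, smul_mul_assoc, mul_smul_comm]

theorem isGZAction_gzAction (n : ℕ) : IsGZAction n (gzAction (n := n)) where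
  zero := gzAction_zero
  add := gzAction_add
  holomorphic := fun p _ => by
    have h := analyticAt_gzConj (n - 1) p
    exact (h.1.fun_mul analyticAt_snd).fun_mul h.2
  generator := fun a y => by
    have h := hasDerivAt_gzConj a y (n - 1)
    have h1 := (h.1.mul_const y).fun_mul h.2
    have h2 : HasDerivAt (fun t : ℂ => gzAction (t • a) y)
        (∑ i, a i • hamiltonianField (traceFun i) y) 0 := by
      refine h1.congr_deriv ?_
      rw [sum_hamiltonianField, ← sum_gzGen]
      simp [gzConj_zero, sub_eq_add_neg]
    exact h2

/-- The conditions on the Gelfand-Zeitlin action determine it: `t ↦ τ (-t a) (σ (t a) y)` has zero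
derivative. -/
theorem IsGZAction.unique {σ τ : (GZIndex n → ℂ) → Mat n → Mat n} (hσ : IsGZAction n σ)
    (hτ : IsGZAction n τ) : σ = τ := by
  have hτan : ∀ p, AnalyticAt ℂ (fun p : (GZIndex n → ℂ) × Mat n => τ p.1 p.2) p :=
    fun p => hτ.holomorphic p trivial
  funext a y
  set X : Mat n → Mat n := fun z => ∑ i, a i • hamiltonianField (traceFun i) z with hX
  have hinner : ∀ z, HasDerivAt (fun s : ℂ => τ (s • -a) (σ (s • a) z)) (0 : Mat n) 0 := by
    intro z
    have hΘ : AnalyticAt ℂ (fun q : ℂ × Mat n => τ (q.1 • -a) q.2) (0, z) :=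
      AnalyticAt.comp (g := fun p : (GZIndex n → ℂ) × Mat n => τ p.1 p.2)
        (f := fun q : ℂ × Mat n => (q.1 • -a, q.2)) (hτan _)
        ((analyticAt_fst.smul analyticAt_const).prod analyticAt_snd)
    set T' := fderiv ℂ (fun q : ℂ × Mat n => τ (q.1 • -a) q.2) (0, z)
    have hT : HasFDerivAt (fun q : ℂ × Mat n => τ (q.1 • -a) q.2) T' (0, z) :=
      hΘ.differentiableAt.hasFDerivAt
    have h1 : T' (1, 0) = -X z := by
      have hd : HasDerivAt (fun s : ℂ => (s, z)) ((1 : ℂ), (0 : Mat n)) 0 :=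
        (hasDerivAt_id _).prodMk (hasDerivAt_const _ _)
      have h2 : HasDerivAt (fun s : ℂ => τ (s • -a) z)
          (∑ i, (-a) i • hamiltonianField (traceFun i) z) 0 := hτ.generator (-a) z
      have h3 := (hT.comp_hasDerivAt (0 : ℂ) (f := fun s : ℂ => (s, z)) hd).unique h2
      rw [h3, hX]
      simp
    have h2 : T' (0, X z) = X z := by
      have hd : HasFDerivAt (fun w : Mat n => ((0 : ℂ), w)) (ContinuousLinearMap.inr ℂ ℂ (Mat n)) z :=
        hasFDerivAt_prodMk_right _ _
      have h3 := HasFDerivAt.comp z (f := fun w : Mat n => ((0 : ℂ), w)) hT hd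
      have h4 : HasFDerivAt (fun w : Mat n => τ ((0 : ℂ) • -a) w)
          (ContinuousLinearMap.id ℂ (Mat n)) z := by
        simp only [zero_smul, hτ.zero]
        exact hasFDerivAt_id z
      have h5 := h3.unique h4
      exact congrArg (fun L : Mat n →L[ℂ] Mat n => L (X z)) h5
    have hd : HasDerivAt (fun s : ℂ => (s, σ (s • a) z)) ((1 : ℂ), X z) 0 := by
      have h3 : HasDerivAt (fun s : ℂ => σ (s • a) z) (X z) 0 := hσ.generator a z
      exact (hasDerivAt_id _).prodMk h3
    have hT0 : HasFDerivAt (fun q : ℂ × Mat n => τ (q.1 • -a) q.2) T'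
        ((fun s : ℂ => (s, σ (s • a) z)) 0) := by
      simpa only [zero_smul, hσ.zero] using hT
    have h6 := hT0.comp_hasDerivAt (0 : ℂ) (f := fun s : ℂ => (s, σ (s • a) z)) hd
    refine h6.congr_deriv ?_
    have : ((1 : ℂ), X z) = (1, 0) + (0, X z) := by simp
    rw [this, map_add, h1, h2, neg_add_cancel]
  have hF : ∀ t : ℂ, HasDerivAt (fun t : ℂ => τ (t • -a) (σ (t • a) y)) (0 : Mat n) t := by
    intro t
    have ho : HasFDerivAt (fun w : Mat n => τ (t • -a) w)
        (fderiv ℂ (fun w : Mat n => τ (t • -a) w) (τ ((0 : ℂ) • -a) (σ ((0 : ℂ) • a) (σ (t • a) y))))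
        (τ ((0 : ℂ) • -a) (σ ((0 : ℂ) • a) (σ (t • a) y))) := by
      refine DifferentiableAt.hasFDerivAt (AnalyticAt.differentiableAt ?_)
      exact AnalyticAt.comp (g := fun p : (GZIndex n → ℂ) × Mat n => τ p.1 p.2)
        (f := fun w : Mat n => (t • -a, w)) (hτan _) (analyticAt_const.prod analyticAt_id)
    have h1 := ho.comp_hasDerivAt (0 : ℂ) (hinner (σ (t • a) y))
    rw [map_zero] at h1
    have h2 : HasDerivAt (fun s : ℂ => s - t) 1 t := (hasDerivAt_id t).sub_const t
    have h1' : HasDerivAt ((fun w : Mat n => τ (t • -a) w) ∘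
        fun s : ℂ => τ (s • -a) (σ (s • a) (σ (t • a) y))) (0 : Mat n) ((fun s : ℂ => s - t) t) := by
      simpa using h1
    have h3 := HasDerivAt.scomp t (h := fun s : ℂ => s - t) h1' h2
    rw [smul_zero] at h3
    refine h3.congr_of_eventuallyEq (Filter.Eventually.of_forall fun s => ?_)
    simp only [Function.comp_apply]
    rw [← hτ.add, ← hσ.add, ← add_smul, ← add_smul]
    congr 2 <;> ring_nf
  have hconst : τ ((1 : ℂ) • -a) (σ ((1 : ℂ) • a) y) = τ ((0 : ℂ) • -a) (σ ((0 : ℂ) • a) y) :=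
    is_const_of_deriv_eq_zero (𝕜 := ℂ) (fun t => (hF t).differentiableAt)
      (fun t => (hF t).deriv) 1 0
  rw [one_smul, one_smul, zero_smul, zero_smul, hτ.zero, hσ.zero] at hconst
  have := congrArg (τ a) hconst
  rwa [← hτ.add, add_neg_cancel, hτ.zero] at this

end Action

/-! ### Adjoint orbits of regular matrices -/

section Orbit

variable {n : ℕ}

/-- A derivative at `0` known to exist is determined by the derivatives along lines. -/
theorem hasFDerivAt_zero_of_forall_hasDerivAt_smul {P E : Type*} [NormedAddCommGroup P]
    [NormedSpace ℂ P] [NormedAddCommGroup E] [NormedSpace ℂ E] {F : P → E} {D : P →L[ℂ] E}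
    (hF : DifferentiableAt ℂ F 0)
    (h : ∀ a, HasDerivAt (fun t : ℂ => F (t • a)) (D a) 0) : HasFDerivAt F D 0 := by
  refine hF.hasFDerivAt.congr_fderiv ?_
  ext a
  have h1 : HasDerivAt (fun t : ℂ => t • a) a 0 := by
    simpa using (hasDerivAt_id (0 : ℂ)).smul_const a
  have h2 : HasFDerivAt F (fderiv ℂ F 0) ((0 : ℂ) • a) := by simpa using hF.hasFDerivAt
  exact (h2.comp_hasDerivAt 0 h1).unique (h a)

/-- The map `a ↦ [a, y]`. -/
noncomputable def adMap (y : Mat n) : Mat n →ₗ[ℂ] Mat n :=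
  LinearMap.mulRight ℂ y - LinearMap.mulLeft ℂ y

theorem adMap_apply (y a : Mat n) : adMap y a = a * y - y * a := rfl

theorem ker_adMap (y : Mat n) :
    LinearMap.ker (adMap y) = Subalgebra.toSubmodule (Subalgebra.centralizer ℂ {y}) := by
  ext a
  rw [LinearMap.mem_ker, adMap_apply, mem_centralizer_singleton, sub_eq_zero]
  rfl

/-- The trace form pairs `[a, y]` with the centralizer of `y` to zero. -/
theorem trace_mul_adMap (y a b : Mat n) :
    (b * adMap y a).trace = ((y * b - b * y) * a).trace := by
  rw [adMap_apply, mul_sub, sub_mul, Matrix.trace_sub, Matrix.trace_sub, ← mul_assoc,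
    Matrix.trace_mul_comm (b * a) y, mul_assoc, mul_assoc]

theorem commute_of_forall_trace_mul_adMap {y b : Mat n}
    (h : ∀ a, (b * adMap y a).trace = 0) : Commute b y := by
  have : y * b - b * y = 0 := by
    refine traceDual_injective ?_
    ext a
    rw [traceDual_apply, map_zero, ← trace_mul_adMap]
    exact h a
  exact (sub_eq_zero.1 this).symm

/-- The coefficients of the characteristic polynomial, the invariants of the adjoint orbits. -/
noncomputable def charpolyCoeffs (p : Mat n) : Fin n → ℂ := fun k => p.charpoly.coeff k

theorem analyticAt_charpolyCoeffs (p : Mat n) : AnalyticAt ℂ charpolyCoeffs p :=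
  AnalyticAt.pi fun k => analyticAt_charpoly_coeff k p

theorem fderiv_charpolyCoeffs_apply (y v : Mat n) (k : Fin n) :
    fderiv ℂ charpolyCoeffs y v k = fderiv ℂ (fun p : Mat n => p.charpoly.coeff k) y v := by
  have h : HasFDerivAt charpolyCoeffs (ContinuousLinearMap.pi fun k : Fin n =>
      fderiv ℂ (fun p : Mat n => p.charpoly.coeff k) y) y :=
    hasFDerivAt_pi.2 fun k => (analyticAt_charpoly_coeff k y).differentiableAt.hasFDerivAt
  rw [h.fderiv]
  rfl

/-- At a regular matrix, the directions in which the characteristic polynomial is stationary are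
tangent to the orbit. -/
theorem IsRegularMat.mem_range_adMap {y v : Mat n} (hy : IsRegularMat y)
    (hv : fderiv ℂ charpolyCoeffs y v = 0) : v ∈ LinearMap.range (adMap y) := by
  refine mem_of_forall_trace_eq_zero fun b hb => ?_
  have hc : Commute b y := commute_of_forall_trace_mul_adMap fun a => hb _ ⟨a, rfl⟩
  have h1 : ∀ k : Fin n, (adjCoeff y (k + 1) * v).trace = 0 := by
    intro k
    have h2 := congrFun hv k
    rw [fderiv_charpolyCoeffs_apply, fderiv_charpoly_coeff y v k.isLt] at h2
    simpa using h2
  have h3 := (forall_trace_eq_zero_iff_of_span_eq (span_adjCoeff y) v).1 h1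
  have hle : Submodule.span ℂ (Set.range fun j : Fin n => y ^ (j : ℕ)) ≤
      LinearMap.ker ((Matrix.traceLinearMap (Fin n) ℂ ℂ) ∘ₗ LinearMap.mulRight ℂ v) := by
    rw [Submodule.span_le]
    rintro _ ⟨j, rfl⟩
    exact h3 j
  exact hle (hy.mem_span_pow hc)

theorem charpolyCoeffs_eq_of_mem_adjointOrbit {x y : Mat n} (h : y ∈ adjointOrbit x) :
    charpolyCoeffs y = charpolyCoeffs x := by
  funext k
  rw [charpolyCoeffs, charpolyCoeffs, charpoly_eq_of_mem_adjointOrbit h]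

theorem IsRegularMat.of_mem_adjointOrbit {x y : Mat n} (hx : IsRegularMat x)
    (h : y ∈ adjointOrbit x) : IsRegularMat y :=
  isRegularMat_of_mem_adjointOrbit (adjointOrbit_symm h) hx

theorem analyticAt_expConj (q : Mat n × Mat n) :
    AnalyticAt ℂ (fun q : Mat n × Mat n => (expUnit q.1 : Mat n) * q.2 *
      (((expUnit q.1)⁻¹ : (Mat n)ˣ) : Mat n)) q :=
  ((AnalyticAt.comp (g := fun u : Mat n => (expUnit u : Mat n)) (f := fun q : Mat n × Mat n => q.1)
    (analyticAt_expUnit _) analyticAt_fst).fun_mul analyticAt_snd).fun_mul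
    (AnalyticAt.comp (g := fun u : Mat n => (((expUnit u)⁻¹ : (Mat n)ˣ) : Mat n))
      (f := fun q : Mat n × Mat n => q.1) (analyticAt_expUnit_inv _) analyticAt_fst)

theorem hasFDerivAt_expConj (y : Mat n) :
    HasFDerivAt (fun a : Mat n => (expUnit a : Mat n) * y *
      (((expUnit a)⁻¹ : (Mat n)ˣ) : Mat n)) (LinearMap.toContinuousLinearMap (adMap y)) 0 := by
  refine hasFDerivAt_zero_of_forall_hasDerivAt_smul (AnalyticAt.differentiableAt ?_) fun a => ?_
  · exact AnalyticAt.comp (f := fun a : Mat n => (a, y)) (analyticAt_expConj (0, y))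
      (analyticAt_id.prod analyticAt_const)
  · have h := ((hasDerivAt_expUnit a).mul_const y).fun_mul (hasDerivAt_expUnit_inv a)
    refine h.congr_deriv ?_
    simp [expUnit_zero, adMap_apply, sub_eq_add_neg]

theorem expConj_mem_adjointOrbit {x y : Mat n} (hy : y ∈ adjointOrbit x) (a : Mat n) :
    (expUnit a : Mat n) * y * (((expUnit a)⁻¹ : (Mat n)ˣ) : Mat n) ∈ adjointOrbit x :=
  adjointOrbit_trans hy ⟨expUnit a, rfl⟩

theorem charpolyCoeffs_expConj (y a : Mat n) :
    charpolyCoeffs ((expUnit a : Mat n) * y * (((expUnit a)⁻¹ : (Mat n)ˣ) : Mat n)) =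
      charpolyCoeffs y :=
  charpolyCoeffs_eq_of_mem_adjointOrbit (expConj_mem_adjointOrbit (self_mem_adjointOrbit y) a)

theorem sq_eq_two_mul_dd_add (n : ℕ) : n * n = 2 * dd (n - 1) + n := by
  rcases n with _ | n
  · rfl
  · have : 2 ∣ n * (n + 1) := (Nat.even_mul_succ_self n).two_dvd
    simp only [dd, Nat.add_sub_cancel]
    rw [Nat.mul_div_cancel' this]
    ring

theorem IsRegularMat.finrank_ker_adMap {y : Mat n} (hy : IsRegularMat y) :
    Module.finrank ℂ (LinearMap.ker (adMap y)) = n := by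
  rw [ker_adMap]
  exact hy

/-- The chart at `z` comes from conjugation by `exp a`, with `a` in a complement of the
centralizer of `z`. -/
theorem IsRegularMat.isComplexSubmanifold_adjointOrbit {x : Mat n} (hx : IsRegularMat x) :
    IsComplexSubmanifold (adjointOrbit x) (2 * dd (n - 1)) := by
  choose P hP using fun z : Mat n => Submodule.exists_isCompl (LinearMap.ker (adMap z))
  have hcomp : ∀ z, LinearMap.range ((LinearMap.toContinuousLinearMap (adMap z)).comp
      (P z).subtypeL).toLinearMap = LinearMap.range (adMap z) := by
    intro z
    refine le_antisymm ?_ ?_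
    · rintro _ ⟨a, rfl⟩
      exact ⟨a, rfl⟩
    · rintro _ ⟨a, rfl⟩
      have ha : a ∈ LinearMap.ker (adMap z) ⊔ P z := by rw [(hP z).sup_eq_top]; trivial
      obtain ⟨b, hb, c, hc, rfl⟩ := Submodule.mem_sup.1 ha
      refine ⟨⟨c, hc⟩, ?_⟩
      rw [map_add, LinearMap.mem_ker.1 hb, zero_add]
      rfl
  refine isComplexSubmanifold_of_slice (P := fun z => P z) (G := fun _ => Fin n → ℂ)
    (T := fun z a p => (expUnit (a : Mat n) : Mat n) * p *
      (((expUnit (a : Mat n))⁻¹ : (Mat n)ˣ) : Mat n))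
    (D := fun z => (LinearMap.toContinuousLinearMap (adMap z)).comp (P z).subtypeL)
    (f := fun _ => charpolyCoeffs) ?_ ?_ ?_ ?_ ?_ ?_ ?_ ?_ ?_ ?_
  · intro z q _
    exact AnalyticAt.comp (f := fun q : P z × Mat n => ((q.1 : Mat n), q.2))
      (analyticAt_expConj (q.1, q.2))
      ((((P z).subtypeL.comp (ContinuousLinearMap.fst ℂ (P z) (Mat n))).analyticAt q).prod
        analyticAt_snd)
  · intro z p
    simp [expUnit_zero]
  · intro z
    exact HasFDerivAt.comp (0 : P z) (f := fun a : P z => (a : Mat n)) (hasFDerivAt_expConj z)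
      (P z).subtypeL.hasFDerivAt
  · intro z _
    refine (injective_iff_map_eq_zero _).2 fun a ha => ?_
    have h1 : (a : Mat n) ∈ LinearMap.ker (adMap z) := ha
    have h2 := (hP z).disjoint.le_bot ⟨h1, a.2⟩
    exact Subtype.ext ((Submodule.mem_bot ℂ).1 h2)
  · intro z
    exact analyticAt_charpolyCoeffs z
  · intro z a p
    exact charpolyCoeffs_expConj p a
  · intro z hz v hv
    rw [hcomp]
    exact (hx.of_mem_adjointOrbit hz).mem_range_adMap hv
  · intro z hz
    have h1 := Submodule.finrank_add_eq_of_isCompl (hP z)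
    rw [(hx.of_mem_adjointOrbit hz).finrank_ker_adMap, Module.finrank_matrix, Fintype.card_fin,
      Module.finrank_self, mul_one, sq_eq_two_mul_dd_add] at h1
    omega
  · intro z hz a
    exact expConj_mem_adjointOrbit hz a
  · intro z hz p hp
    exact charpolyCoeffs_eq_of_mem_adjointOrbit (adjointOrbit_trans (adjointOrbit_symm hz) hp)

/-- The tangent vectors to the orbit at `y` are the `[a, y]`. -/
theorem IsRegularMat.tangentVectors_adjointOrbit {x y : Mat n} (hx : IsRegularMat x)
    (hy : y ∈ adjointOrbit x) :
    tangentVectors (adjointOrbit x) y = (LinearMap.range (adMap y) : Set (Mat n)) := by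
  refine tangentVectors_eq_range (P := Mat n) (T := fun a => (expUnit a : Mat n) * y *
    (((expUnit a)⁻¹ : (Mat n)ˣ) : Mat n)) (D := LinearMap.toContinuousLinearMap (adMap y))
    (f := charpolyCoeffs) ?_ ?_ (hasFDerivAt_expConj y)
    (analyticAt_charpolyCoeffs y).differentiableAt ?_ ?_ ?_
  · intro a _
    exact AnalyticAt.comp (f := fun a : Mat n => (a, y)) (analyticAt_expConj (a, y))
      (analyticAt_id.prod analyticAt_const)
  · simp [expUnit_zero]
  · intro v hv
    exact (hx.of_mem_adjointOrbit hy).mem_range_adMap hv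
  · exact expConj_mem_adjointOrbit hy
  · intro p hp
    exact charpolyCoeffs_eq_of_mem_adjointOrbit (adjointOrbit_trans (adjointOrbit_symm hy) hp)

/-! ### The strongly regular part is open and dense -/

theorem isOpen_isStronglyRegular : IsOpen {y : Mat n | IsStronglyRegular y} := by
  have hc : Continuous fun (y : Mat n) (i : (m : Fin n) × Fin (m + 1)) =>
      cornerPow (n := n) (i.1 + 1) i.2 y :=
    continuous_pi fun i => continuous_iff_continuousAt.2 fun y =>
      (analyticAt_cornerPow _ _ y).continuousAt
  have ho := (isOpen_setOfPred_linearIndependent (𝕜 := ℂ) (E := Mat n)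
    (ι := (m : Fin n) × Fin (m + 1))).preimage hc
  have he : {y : Mat n | IsStronglyRegular y} = (fun (y : Mat n)
      (i : (m : Fin n) × Fin (m + 1)) => cornerPow (n := n) (i.1 + 1) i.2 y) ⁻¹'
      {f | LinearIndependent ℂ f} := by
    ext y
    exact isStronglyRegular_iff
  rw [he]
  exact ho

theorem sregOrbit_eq_inter (x : Mat n) :
    sregOrbit x = adjointOrbit x ∩ {y | IsStronglyRegular y} := rfl

theorem AnalyticAt.matrix_det {E : Type*} [NormedAddCommGroup E] [NormedSpace ℂ E] {ι : Type*}
    [Fintype ι] [DecidableEq ι] {M : E → Matrix ι ι ℂ} {z : E}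
    (h : ∀ i j, AnalyticAt ℂ (fun t => M t i j) z) : AnalyticAt ℂ (fun t => (M t).det) z := by
  simp_rw [Matrix.det_apply']
  exact Finset.analyticAt_fun_sum _ fun σ _ => analyticAt_const.fun_mul
    (Finset.analyticAt_fun_prod _ fun i _ => h _ _)

theorem analyticAt_of_entries {E : Type*} [NormedAddCommGroup E] [NormedSpace ℂ E]
    {M : E → Mat n} {z : E}
    (h : ∀ i j, AnalyticAt ℂ (fun t => M t i j) z) : AnalyticAt ℂ M z := by
  have : M = fun t => ∑ i, ∑ j, M t i j • Matrix.single i j (1 : ℂ) := by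
    funext t
    conv_lhs => rw [Matrix.matrix_eq_sum_single (M t)]
    simp
  rw [this]
  exact Finset.analyticAt_fun_sum _ fun i _ => Finset.analyticAt_fun_sum _ fun j _ =>
    (h i j).fun_smul analyticAt_const

theorem AnalyticAt.matrix_adjugate {E : Type*} [NormedAddCommGroup E] [NormedSpace ℂ E]
    {M : E → Mat n} {z : E} (h : AnalyticAt ℂ M z) : AnalyticAt ℂ (fun t => (M t).adjugate) z := by
  have h' : ∀ i j, AnalyticAt ℂ (fun t => M t i j) z := fun i j =>
    AnalyticAt.comp (g := fun x : Mat n => x i j) (analyticAt_entry i j _) h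
  refine analyticAt_of_entries fun i j => ?_
  simp_rw [Matrix.adjugate_apply]
  refine AnalyticAt.matrix_det fun k l => ?_
  simp_rw [Matrix.updateRow_apply]
  split_ifs with hk
  · exact analyticAt_const
  · exact h' k l

theorem corner_smul (m : ℕ) (c : ℂ) (y : Mat n) : corner m (c • y) = c • corner m y := by
  simp [corner]

theorem cornerPow_smul (m j : ℕ) (c : ℂ) (y : Mat n) :
    cornerPow m j (c • y) = c ^ j • cornerPow m j y := by
  rw [cornerPow, cornerPow, corner_smul, smul_pow, smul_mul_assoc]

theorem isStronglyRegular_of_smul {c : ℂ} (hc : c ≠ 0) {y : Mat n}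
    (h : IsStronglyRegular (c • y)) : IsStronglyRegular y := by
  rw [isStronglyRegular_iff] at h ⊢
  simp_rw [cornerPow_smul] at h
  rw [Fintype.linearIndependent_iff] at h ⊢
  intro a ha i
  have := h (fun i => a i * (c ^ (i.2 : ℕ))⁻¹) (by
    rw [← ha]
    refine Finset.sum_congr rfl fun i _ => ?_
    rw [smul_smul, inv_mul_cancel_right₀ (pow_ne_zero _ hc)]) i
  simpa [hc] using this

/-- If `y₀` is strongly regular, then a nonzero minor `D` certifying this is a polynomial function.
Along the pencil `p t = 1 + t (g - 1)` the function `D (p t * y₀ * adj (p t))` is entire and nonzero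
at `t = 0`, hence not identically zero near `t = 1`, where `p t * y₀ * adj (p t)` is a multiple of a
conjugate of `y₀` near `g y₀ g⁻¹`. -/
theorem adjointOrbit_subset_closure_sregOrbit {x : Mat n} (hx : IsRegularMat x) :
    adjointOrbit x ⊆ closure (sregOrbit x) := by
  intro z hz
  obtain ⟨y₀, hy₀, hs₀⟩ := (sregOrbit_nonempty_iff x).2 hx
  obtain ⟨g, hg⟩ := adjointOrbit_trans (adjointOrbit_symm hy₀) hz
  set B : Mat n → ((m : Fin n) × Fin (m + 1)) → Mat n :=
    fun y i => cornerPow (n := n) (i.1 + 1) i.2 y with hB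
  have hsB : ∀ y, IsStronglyRegular y ↔ LinearIndependent ℂ (B y) := fun y => isStronglyRegular_iff
  have hli := (hsB y₀).1 hs₀
  obtain ⟨Λ, hΛ⟩ := (Fintype.linearCombination ℂ (B y₀)).exists_leftInverse_of_injective
    (LinearMap.ker_eq_bot.2 hli.fintypeLinearCombination_injective)
  set M : Mat n → Matrix ((m : Fin n) × Fin (m + 1)) ((m : Fin n) × Fin (m + 1)) ℂ :=
    fun y => Matrix.of fun i j => Λ (B y j) i with hM
  have hM0 : (M y₀).det = 1 := by
    have : M y₀ = 1 := by
      ext i j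
      have h1 := LinearMap.congr_fun hΛ (Pi.single j 1)
      rw [LinearMap.comp_apply, Fintype.linearCombination_apply_single, one_smul] at h1
      change Λ (B y₀ j) i = _
      rw [h1, LinearMap.id_apply, Matrix.one_apply, Pi.single_apply]
    rw [this, Matrix.det_one]
  have hMs : ∀ y, (M y).det ≠ 0 → IsStronglyRegular y := by
    intro y hy
    rw [hsB]
    have h1 : LinearIndependent ℂ (M y).col :=
      Matrix.linearIndependent_cols_iff_isUnit.2 ((Matrix.isUnit_iff_isUnit_det _).2 hy.isUnit)
    have h2 : (M y).col = Λ ∘ B y := by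
      funext j
      rfl
    rw [h2] at h1
    exact h1.of_comp Λ
  set p : ℂ → Mat n := fun t => 1 + t • ((g : Mat n) - 1) with hp
  have hpan : ∀ t, AnalyticAt ℂ p t := fun t =>
    analyticAt_const.fun_add (analyticAt_id.fun_smul analyticAt_const)
  set N : ℂ → Mat n := fun t => p t * y₀ * (p t).adjugate with hN
  have hNan : ∀ t, AnalyticAt ℂ N t := fun t =>
    ((hpan t).fun_mul analyticAt_const).fun_mul (hpan t).matrix_adjugate
  have hMan : ∀ y, AnalyticAt ℂ (fun y => (M y).det) y := by
    intro y
    refine AnalyticAt.matrix_det fun i j => ?_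
    exact AnalyticAt.comp (g := fun b : Mat n => Λ b i) (f := fun y => B y j)
      (((ContinuousLinearMap.proj (R := ℂ) (φ := fun _ => ℂ) i).comp
        (LinearMap.toContinuousLinearMap Λ)).analyticAt _) (analyticAt_cornerPow _ _ y)
  have hDan : AnalyticOnNhd ℂ (fun t => (M (N t)).det) Set.univ := fun t _ =>
    AnalyticAt.comp (g := fun y => (M y).det) (hMan _) (hNan t)
  have hp1 : p 1 = g := by simp [hp]
  have hp0 : p 0 = 1 := by simp [hp]
  have hN0 : N 0 = y₀ := by simp [hN, hp0]
  have hdet : AnalyticAt ℂ (fun t => (p t).det) 1 :=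
    AnalyticAt.matrix_det fun i j =>
      AnalyticAt.comp (g := fun x : Mat n => x i j) (analyticAt_entry i j _) (hpan 1)
  have hg0 : (p 1).det ≠ 0 := by
    rw [hp1]
    exact ((Matrix.isUnit_iff_isUnit_det _).1 g.isUnit).ne_zero
  set ψ : ℂ → Mat n := fun t => ((p t).det)⁻¹ • N t with hψ
  have hψc : ContinuousAt ψ 1 := (hdet.continuousAt.inv₀ hg0).smul (hNan 1).continuousAt
  have hψo : ∀ t, (p t).det ≠ 0 → ψ t ∈ adjointOrbit y₀ := by
    intro t ht
    have hu : IsUnit (p t) := (Matrix.isUnit_iff_isUnit_det _).2 ht.isUnit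
    refine ⟨hu.unit, ?_⟩
    rw [Matrix.coe_units_inv, IsUnit.unit_spec, Matrix.inv_def, Ring.inverse_eq_inv',
      mul_smul_comm]
  have hψ1 : ψ 1 = z := by
    rw [hg, hψ, hN]
    simp only
    rw [Matrix.coe_units_inv, Matrix.inv_def, Ring.inverse_eq_inv', mul_smul_comm, hp1]
  have hNψ : ∀ t, (p t).det ≠ 0 → N t = (p t).det • ψ t := fun t ht => by
    rw [hψ]
    simp only
    rw [smul_smul, mul_inv_cancel₀ ht, one_smul]
  by_contra hzc
  have hopen : IsOpen (closure (sregOrbit x))ᶜ := isClosed_closure.isOpen_compl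
  have hev : ∀ᶠ t in 𝓝 (1 : ℂ), ψ t ∈ (closure (sregOrbit x))ᶜ :=
    hψc.eventually_mem (by rw [hψ1]; exact hopen.mem_nhds hzc)
  have hev2 : ∀ᶠ t in 𝓝 (1 : ℂ), (p t).det ≠ 0 := hdet.continuousAt.eventually_ne hg0
  have hzero : (fun t => (M (N t)).det) =ᶠ[𝓝 1] 0 := by
    filter_upwards [hev, hev2] with t ht ht2
    by_contra h0
    have h1 := hMs _ h0
    rw [hNψ t ht2] at h1
    exact ht (subset_closure ⟨adjointOrbit_trans hy₀ (hψo t ht2), isStronglyRegular_of_smul ht2 h1⟩)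
  have := hDan.eqOn_zero_of_preconnected_of_eventuallyEq_zero isPreconnected_univ trivial hzero
    (Set.mem_univ 0)
  simp only [hN0, hM0, Pi.zero_apply] at this
  exact one_ne_zero this

end Orbit

/-! ### Alternating forms -/

section Forms

variable {E V : Type*} [NormedAddCommGroup E] [NormedSpace ℂ E] [NormedAddCommGroup V]
  [NormedSpace ℂ V]

/-- On a finite-dimensional space, a family of alternating forms is analytic as soon as all its
evaluations are. -/
theorem analyticAt_of_forall_apply [FiniteDimensional ℂ V] {k : ℕ} {f : E → V [⋀^Fin k]→L[ℂ] ℂ}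
    {z : E} (h : ∀ v, AnalyticAt ℂ (fun x => f x v) z) : AnalyticAt ℂ f z := by
  set b := Module.finBasis ℂ V
  set ev : (V [⋀^Fin k]→L[ℂ] ℂ) →ₗ[ℂ] ((Fin k → Fin (Module.finrank ℂ V)) → ℂ) :=
    { toFun := fun g σ => g fun i => b (σ i)
      map_add' := fun _ _ => rfl
      map_smul' := fun _ _ => rfl } with hev
  have hinj : Function.Injective ev := by
    intro g g' hg
    refine ContinuousAlternatingMap.toAlternatingMap_injective
      (Module.Basis.ext_alternating b fun σ _ => congrFun hg σ)
  obtain ⟨Λ, hΛ⟩ := ev.exists_leftInverse_of_injective (LinearMap.ker_eq_bot.2 hinj)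
  have h1 : f = fun x => LinearMap.toContinuousLinearMap Λ (ev (f x)) := by
    funext x
    exact (LinearMap.congr_fun hΛ (f x)).symm
  rw [h1]
  exact ((LinearMap.toContinuousLinearMap Λ).analyticAt _).comp
    (AnalyticAt.pi fun σ => h fun i => b (σ i))

theorem fderiv_mem_tangentVectors {S : Set E} {U : Set V} {φ : V → E} (hU : IsOpen U)
    (hφ : AnalyticOnNhd ℂ φ U) (hS : Set.MapsTo φ U S) {u : V} (hu : u ∈ U) (s : V) :
    fderiv ℂ φ u s ∈ tangentVectors S (φ u) := by
  refine ⟨fun t : ℂ => φ (u + t • s), ?_, by simp, ?_, ?_⟩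
  · have h8 : AnalyticAt ℂ φ (u + (0 : ℂ) • s) := by simpa using hφ u hu
    exact AnalyticAt.comp (g := φ) (f := fun t : ℂ => u + t • s) h8
      (analyticAt_const.add (analyticAt_id.smul analyticAt_const))
  · have hcont : ContinuousAt (fun t : ℂ => u + t • s) 0 := by fun_prop
    filter_upwards [hcont.eventually_mem (s := U) (by simpa using hU.mem_nhds hu)] with t ht
    exact hS ht
  · have h9 : HasDerivAt (fun t : ℂ => u + t • s) s 0 := by
      simpa using ((hasDerivAt_id (0 : ℂ)).smul_const s).const_add u
    have ha' : HasFDerivAt φ (fderiv ℂ φ u) (u + (0 : ℂ) • s) := by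
      simpa using (hφ u hu).differentiableAt.hasFDerivAt
    exact (ha'.comp_hasDerivAt 0 h9).deriv

theorem IsHolomorphicSymplectic.inter_isOpen {S U : Set E} {d : ℕ} {ω : E → E [⋀^Fin 2]→L[ℂ] ℂ}
    (h : IsHolomorphicSymplectic S d ω) (hU : IsOpen U) :
    IsHolomorphicSymplectic (S ∩ U) d ω where
  holomorphic := fun W φ hW hφ hS => h.holomorphic W φ hW hφ fun _ hu => (hS hu).1
  closed := fun W φ hW hφ hS => h.closed W φ hW hφ fun _ hu => (hS hu).1
  nondegenerate := fun y hy => by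
    rw [tangentVectors_inter_isOpen hU hy.2]
    exact h.nondegenerate y hy.1

end Forms

/-! ### The Kirillov-Kostant-Souriau form -/

section OrbitForm

variable {n : ℕ}

theorem trace_mul_commutator_eq (y a b : Mat n) :
    (y * (a * b - b * a)).trace = (a * adMap y b).trace := by
  rw [adMap_apply, mul_sub, mul_sub, Matrix.trace_sub, Matrix.trace_sub,
    ← mul_assoc a b y, Matrix.trace_mul_comm (a * b) y, ← mul_assoc y b a,
    Matrix.trace_mul_comm (y * b) a]

theorem trace_mul_commutator_eq_neg (y a b : Mat n) :
    (y * (a * b - b * a)).trace = -(adMap y a * b).trace := by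
  have h : y * (a * b - b * a) = -(y * (b * a - a * b)) := by rw [← mul_neg, neg_sub]
  rw [h, Matrix.trace_neg, trace_mul_commutator_eq, Matrix.trace_mul_comm]

theorem exists_section_adMap (y : Mat n) :
    ∃ s : Mat n →ₗ[ℂ] Mat n, ∀ a, adMap y (s (adMap y a)) = adMap y a := by
  obtain ⟨s₀, hs₀⟩ := (adMap y).rangeRestrict.exists_rightInverse_of_surjective
    (LinearMap.range_rangeRestrict _)
  obtain ⟨s, hs⟩ := s₀.exists_extend
  refine ⟨s, fun a => ?_⟩
  have h1 : s (adMap y a) = s₀ ⟨adMap y a, a, rfl⟩ :=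
    LinearMap.congr_fun hs ⟨adMap y a, a, rfl⟩
  rw [h1]
  exact congrArg Subtype.val (LinearMap.congr_fun hs₀ ⟨adMap y a, a, rfl⟩)

/-- A choice of a linear map inverting `a ↦ [a, y]` on its range. -/
noncomputable def adSection (y : Mat n) : Mat n →ₗ[ℂ] Mat n := (exists_section_adMap y).choose

theorem adMap_adSection (y a : Mat n) : adMap y (adSection y (adMap y a)) = adMap y a :=
  (exists_section_adMap y).choose_spec a

/-- The alternating form `(u, v) ↦ tr (y [s u, s v])`, where `s` inverts `a ↦ [a, y]` on its
range; off the range of `a ↦ [a, y]` its values are irrelevant. -/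
noncomputable def orbitForm (y : Mat n) : Mat n [⋀^Fin 2]→L[ℂ] ℂ where
  toFun v := (y * (adSection y (v 0) * adSection y (v 1) -
    adSection y (v 1) * adSection y (v 0))).trace
  map_update_add' := by
    intro _ v i a b
    fin_cases i <;>
    · simp only [Fin.zero_eta, Fin.mk_one, Function.update_self, ne_eq, one_ne_zero, zero_ne_one,
        not_false_eq_true, Function.update_of_ne, map_add, ← Matrix.trace_add]
      congr 1
      noncomm_ring
  map_update_smul' := by
    intro _ v i c a
    fin_cases i <;>
      simp [Function.update_self, Function.update_of_ne, mul_sub]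
  map_eq_zero_of_eq' := by
    intro v i j hij hne
    have h : v 0 = v 1 := by
      fin_cases i <;> fin_cases j <;> first | exact absurd rfl hne | exact hij | exact hij.symm
    simp [h]
  cont := by
    have hs : Continuous (adSection y) := (adSection y).continuous_of_finiteDimensional
    have h0 : Continuous fun v : Fin 2 → Mat n => adSection y (v 0) := hs.comp (continuous_apply 0)
    have h1 : Continuous fun v : Fin 2 → Mat n => adSection y (v 1) := hs.comp (continuous_apply 1)
    have ht : Continuous fun a : Mat n => a.trace :=
      (Matrix.traceLinearMap (Fin n) ℂ ℂ).continuous_of_finiteDimensional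
    exact ht.comp (continuous_const.mul ((h0.mul h1).sub (h1.mul h0)))

theorem orbitForm_adMap (y a b : Mat n) :
    orbitForm y ![adMap y a, adMap y b] = (y * (a * b - b * a)).trace := by
  have h : orbitForm y ![adMap y a, adMap y b] =
    (y * (adSection y (adMap y a) * adSection y (adMap y b) -
      adSection y (adMap y b) * adSection y (adMap y a))).trace := rfl
  rw [h, trace_mul_commutator_eq, adMap_adSection, ← trace_mul_commutator_eq,
    trace_mul_commutator_eq_neg, adMap_adSection, ← trace_mul_commutator_eq_neg]

theorem isOrbitForm_orbitForm (O : Set (Mat n)) : IsOrbitForm O orbitForm :=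
  fun y _ a b => orbitForm_adMap y a b

theorem analyticAt_krylov (v : Fin n → ℂ) (y : Mat n) : AnalyticAt ℂ (krylov v) y := by
  refine analyticAt_of_entries fun i j => ?_
  have h := (LinearMap.toContinuousLinearMap
    (LinearMap.proj i ∘ₗ (Matrix.mulVecBilin ℂ ℂ).flip v : Mat n →ₗ[ℂ] ℂ)).analyticAt (y ^ (j : ℕ))
  exact AnalyticAt.comp (f := fun y : Mat n => y ^ (j : ℕ)) h (analyticAt_id.pow _)

/-- The primitive of the orbit form: with `h y` the Krylov matrix of `y`, so that `y = h C h⁻¹`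
with `C` constant on the orbit, it is `- tr (C h⁻¹ dh)`. -/
noncomputable def krylovForm (C : Mat n) (v : Fin n → ℂ) (y : Mat n) : Mat n [⋀^Fin 1]→L[ℂ] ℂ :=
  ContinuousAlternatingMap.ofSubsingleton ℂ (Mat n) ℂ (0 : Fin 1)
    (-(traceDual n (C * Ring.inverse (krylov v y))).comp (fderiv ℂ (krylov v) y))

theorem analyticAt_inverse_krylov {v : Fin n → ℂ} {y : Mat n} (h : IsUnit (krylov v y)) :
    AnalyticAt ℂ (fun y => Ring.inverse (krylov v y)) y := by
  obtain ⟨g, hg⟩ := h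
  have h1 : AnalyticAt ℂ Ring.inverse (krylov v y) := by rw [← hg]; exact analyticAt_inverse g
  exact AnalyticAt.comp (g := Ring.inverse) h1 (analyticAt_krylov v y)

theorem analyticAt_trace {E : Type*} [NormedAddCommGroup E] [NormedSpace ℂ E] {f : E → Mat n}
    {z : E} (h : AnalyticAt ℂ f z) : AnalyticAt ℂ (fun t => (f t).trace) z :=
  AnalyticAt.comp (g := fun a : Mat n => a.trace)
    ((LinearMap.toContinuousLinearMap (Matrix.traceLinearMap (Fin n) ℂ ℂ)).analyticAt _) h

theorem AnalyticAt.fderiv_apply_const {E F : Type*} [NormedAddCommGroup E] [NormedSpace ℂ E]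
    [NormedAddCommGroup F] [NormedSpace ℂ F] [CompleteSpace F] {f : E → F} {z : E}
    (h : AnalyticAt ℂ f z) (w : E) : AnalyticAt ℂ (fun t => fderiv ℂ f t w) z :=
  ((ContinuousLinearMap.apply ℂ F w).analyticAt _).comp h.fderiv

theorem analyticAt_krylovForm (C : Mat n) {v : Fin n → ℂ} {y : Mat n} (h : IsUnit (krylov v y)) :
    AnalyticAt ℂ (krylovForm C v) y := by
  refine analyticAt_of_forall_apply fun w => ?_
  exact (analyticAt_trace ((analyticAt_const.fun_mul (analyticAt_inverse_krylov h)).fun_mul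
    ((analyticAt_krylov v y).fderiv_apply_const (w 0)))).neg

/-- The exterior derivative of `- tr (C h⁻¹ dh)`; the second derivatives of `h` cancel. -/
theorem extDeriv_krylovForm (C : Mat n) {v : Fin n → ℂ} {y : Mat n} (h : IsUnit (krylov v y))
    (u w : Mat n) :
    extDeriv (krylovForm C v) y ![u, w] =
      (C * Ring.inverse (krylov v y) * fderiv ℂ (krylov v) y u * Ring.inverse (krylov v y) *
        fderiv ℂ (krylov v) y w).trace -
      (C * Ring.inverse (krylov v y) * fderiv ℂ (krylov v) y w * Ring.inverse (krylov v y) *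
        fderiv ℂ (krylov v) y u).trace := by
  have hk := analyticAt_krylov v y
  have hsymm : IsSymmSndFDerivAt ℂ (krylov v) y :=
    (hk.contDiffAt (n := ⊤)).isSymmSndFDerivAt_of_omega
  have hinv : HasFDerivAt (fun q => Ring.inverse (krylov v q))
      ((-ContinuousLinearMap.mulLeftRight ℂ (Mat n) (Ring.inverse (krylov v y))
        (Ring.inverse (krylov v y))).comp (fderiv ℂ (krylov v) y)) y := by
    obtain ⟨g, hg⟩ := h
    have h1 : HasFDerivAt Ring.inverse (-ContinuousLinearMap.mulLeftRight ℂ (Mat n)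
        (Ring.inverse (krylov v y)) (Ring.inverse (krylov v y))) (krylov v y) := by
      rw [← hg, Ring.inverse_unit]
      exact hasFDerivAt_ringInverse g
    exact h1.comp y hk.differentiableAt.hasFDerivAt
  have key : ∀ u w : Mat n, fderiv ℂ
      (fun q => -(C * Ring.inverse (krylov v q) * fderiv ℂ (krylov v) q w).trace) y u =
      (C * Ring.inverse (krylov v y) * fderiv ℂ (krylov v) y u * Ring.inverse (krylov v y) *
        fderiv ℂ (krylov v) y w).trace -
      (C * Ring.inverse (krylov v y) * fderiv ℂ (fderiv ℂ (krylov v)) y u w).trace := by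
    intro u w
    have h2 : HasFDerivAt (fun q => fderiv ℂ (krylov v) q w)
        ((ContinuousLinearMap.apply ℂ (Mat n) w).comp (fderiv ℂ (fderiv ℂ (krylov v)) y)) y :=
      (ContinuousLinearMap.apply ℂ (Mat n) w).hasFDerivAt.comp y
        hk.fderiv.differentiableAt.hasFDerivAt
    have h3 := ((HasFDerivAt.mul' ((ContinuousLinearMap.mul ℂ (Mat n) C).hasFDerivAt.comp y hinv) h2))
    have h4 := ((LinearMap.toContinuousLinearMap
      (Matrix.traceLinearMap (Fin n) ℂ ℂ)).hasFDerivAt.comp y h3).neg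
    have h5 : HasFDerivAt
      (fun q => -(C * Ring.inverse (krylov v q) * fderiv ℂ (krylov v) q w).trace) _ y := h4
    rw [h5.fderiv]
    change -(C * Ring.inverse (krylov v y) * fderiv ℂ (fderiv ℂ (krylov v)) y u w +
      C * (-(Ring.inverse (krylov v y) * fderiv ℂ (krylov v) y u * Ring.inverse (krylov v y))) *
        fderiv ℂ (krylov v) y w).trace = _
    rw [Matrix.trace_add, mul_neg, neg_mul, Matrix.trace_neg]
    simp only [mul_assoc]
    ring
  rw [extDeriv_apply (analyticAt_krylovForm C h).differentiableAt, Fin.sum_univ_two]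
  have e0 : (fun q => krylovForm C v q ((0 : Fin 2).removeNth ![u, w])) =
    fun q => -(C * Ring.inverse (krylov v q) * fderiv ℂ (krylov v) q w).trace := rfl
  have e1 : (fun q => krylovForm C v q ((1 : Fin 2).removeNth ![u, w])) =
    fun q => -(C * Ring.inverse (krylov v q) * fderiv ℂ (krylov v) q u).trace := rfl
  rw [e0, e1]
  change ((-1 : ℤ)) ^ 0 • fderiv ℂ _ y u + (-1 : ℤ) ^ 1 • fderiv ℂ _ y w = _
  rw [key, key, hsymm u w]
  simp

/-- Differentiating `y h = h C` along the orbit shows that a tangent vector `u` is `[α, y]` with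
`α = dh(u) h⁻¹`. This turns the exterior derivative of the primitive into the orbit form, and also
gives a formula for the orbit form which is manifestly holomorphic. -/
theorem orbitForm_eq_extDeriv {x y u w : Mat n} {v : Fin n → ℂ}
    (hy : y ∈ adjointOrbit x) (hv : IsUnit (krylov v y)) (hu : u ∈ tangentVectors (adjointOrbit x) y)
    (hw : w ∈ tangentVectors (adjointOrbit x) y) :
    orbitForm y ![u, w] = extDeriv (krylovForm (companionMat n x.charpoly) v) y ![u, w] ∧
    orbitForm y ![u, w] = (y *
      (fderiv ℂ (krylov v) y u * Ring.inverse (krylov v y) *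
        (fderiv ℂ (krylov v) y w * Ring.inverse (krylov v y)) -
      fderiv ℂ (krylov v) y w * Ring.inverse (krylov v y) *
        (fderiv ℂ (krylov v) y u * Ring.inverse (krylov v y)))).trace := by
  set C := companionMat n x.charpoly with hC
  set h := krylov v with hh
  set J := Ring.inverse (h y) with hJ
  have hJ1 : h y * J = 1 := Ring.mul_inverse_cancel _ hv
  have hrel : ∀ p ∈ adjointOrbit x, p * h p - h p * C = 0 := by
    intro p hp
    rw [hC, ← charpoly_eq_of_mem_adjointOrbit hp, hh, mul_krylov, sub_self]
  have hyC : y * h y = h y * C := sub_eq_zero.1 (hrel y hy)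
  have hyJ : h y * C * J = y := by rw [← hyC, mul_assoc, hJ1, mul_one]
  have had : ∀ u ∈ tangentVectors (adjointOrbit x) y, u = adMap y (fderiv ℂ h y u * J) := by
    intro u hu
    have hd := (analyticAt_krylov v y).differentiableAt.hasFDerivAt
    have h1 := ((hasFDerivAt_id (𝕜 := ℂ) y).mul' hd).sub
      (((ContinuousLinearMap.mul ℂ (Mat n)).flip C).hasFDerivAt.comp y hd)
    have h2 : HasFDerivAt (fun p => p * h p - h p * C) _ y := h1
    have h3 := fderiv_eq_zero_of_mem_tangentVectors h2.differentiableAt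
      (fun p hp => (hrel p hp).trans (hrel y hy).symm) hu
    rw [h2.fderiv] at h3
    change (y * fderiv ℂ h y u + u * h y) - fderiv ℂ h y u * C = 0 at h3
    have h4 : u * h y = fderiv ℂ h y u * C - y * fderiv ℂ h y u := by
      rw [eq_sub_iff_add_eq, add_comm]
      exact sub_eq_zero.1 h3
    have h5 : C * J = J * y := by
      have : J * (h y * C * J) = C * J := by
        rw [← mul_assoc, ← mul_assoc, Ring.inverse_mul_cancel _ hv, one_mul]
      rw [← this, hyJ]
    calc u = u * h y * J := by rw [mul_assoc, hJ1, mul_one]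
      _ = _ := by rw [h4, adMap_apply, sub_mul, mul_assoc, h5]; simp only [mul_assoc]
  have key : orbitForm y ![u, w] = (y *
      (fderiv ℂ h y u * J * (fderiv ℂ h y w * J) -
        fderiv ℂ h y w * J * (fderiv ℂ h y u * J))).trace := by
    conv_lhs => rw [had u hu, had w hw]
    rw [orbitForm_adMap]
  refine ⟨?_, key⟩
  have hcyc : ∀ a b : Mat n, (y * (a * J * (b * J))).trace = (C * J * a * J * b).trace := by
    intro a b
    have h1 : y * (a * J * (b * J)) = h y * (C * J * a * J * b * J) := by
      conv_lhs => rw [← hyJ]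
      simp only [mul_assoc]
    rw [h1, Matrix.trace_mul_comm, mul_assoc, Ring.inverse_mul_cancel _ hv, mul_one]
  rw [key, extDeriv_krylovForm C hv, mul_sub, Matrix.trace_sub, hcyc, hcyc]

theorem isHolomorphicSymplectic_adjointOrbit {x : Mat n} (hx : IsRegularMat x) :
    IsHolomorphicSymplectic (adjointOrbit x) (2 * dd (n - 1)) orbitForm := by
  have hexists : ∀ y ∈ adjointOrbit x, ∃ v, IsUnit (krylov v y) := fun y hy =>
    let ⟨v, hv⟩ := (hx.of_mem_adjointOrbit hy).exists_isCyclicVector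
    ⟨v, isCyclicVector_iff_isUnit_krylov.1 hv⟩
  have hnear : ∀ (U : Set (Fin (2 * dd (n - 1)) → ℂ)) (φ : (Fin (2 * dd (n - 1)) → ℂ) → Mat n),
      IsOpen U → AnalyticOnNhd ℂ φ U → ∀ u ∈ U, ∀ v, IsUnit (krylov v (φ u)) →
      ∀ᶠ q in 𝓝 u, q ∈ U ∧ IsUnit (krylov v (φ q)) := by
    intro U φ hU hφ u hu v hv
    have h1 : ContinuousAt (fun q => krylov v (φ q)) u :=
      ContinuousAt.comp (g := krylov v) (analyticAt_krylov v _).continuousAt (hφ u hu).continuousAt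
    filter_upwards [hU.mem_nhds hu, h1.eventually_mem (Units.isOpen.mem_nhds hv)] with q hq hq2
      using ⟨hq, hq2⟩
  have htan : ∀ y ∈ adjointOrbit x, ∀ v, v ∈ tangentVectors (adjointOrbit x) y ↔
      v ∈ LinearMap.range (adMap y) := by
    intro y hy v
    rw [hx.tangentVectors_adjointOrbit hy]
    rfl
  refine ⟨?_, ?_, ?_⟩
  · intro U φ hU hφ hS u hu
    obtain ⟨v, hv⟩ := hexists _ (hS hu)
    refine analyticAt_of_forall_apply fun s => ?_
    have hk : AnalyticAt ℂ (fun q => Ring.inverse (krylov v (φ q))) u :=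
      AnalyticAt.comp (g := fun p => Ring.inverse (krylov v p)) (analyticAt_inverse_krylov hv)
        (hφ u hu)
    have hd : ∀ i, AnalyticAt ℂ (fun q => fderiv ℂ (fun q => krylov v (φ q)) q (s i)) u := fun i =>
      (AnalyticAt.comp (g := krylov v) (analyticAt_krylov v _) (hφ u hu)).fderiv_apply_const (s i)
    have hα := fun i => (hd i).fun_mul hk
    refine AnalyticAt.congr (analyticAt_trace ((hφ u hu).fun_mul
      (((hα 0).fun_mul (hα 1)).fun_sub ((hα 1).fun_mul (hα 0))))) ?_
    filter_upwards [hnear U φ hU hφ u hu v hv] with q hq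
    have hchain : ∀ i, fderiv ℂ (fun q => krylov v (φ q)) q (s i) =
        fderiv ℂ (krylov v) (φ q) (fderiv ℂ φ q (s i)) := by
      intro i
      have := (analyticAt_krylov v (φ q)).differentiableAt.hasFDerivAt.comp q
        (hφ q hq.1).differentiableAt.hasFDerivAt
      have h2 : HasFDerivAt (fun q => krylov v (φ q)) _ q := this
      rw [h2.fderiv]
      rfl
    have ht := fun i => fderiv_mem_tangentVectors hU hφ hS hq.1 (s i)
    have h3 : pullbackForm orbitForm φ q s =
        orbitForm (φ q) ![fderiv ℂ φ q (s 0), fderiv ℂ φ q (s 1)] := by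
      change orbitForm (φ q) (fderiv ℂ φ q ∘ s) = _
      congr 1
      ext i : 1
      fin_cases i <;> rfl
    rw [h3, (orbitForm_eq_extDeriv (hS hq.1) hq.2 (ht 0) (ht 1)).2, hchain, hchain]
  · intro U φ hU hφ hS u hu
    obtain ⟨v, hv⟩ := hexists _ (hS hu)
    set η := krylovForm (companionMat n x.charpoly) v with hη
    have heq : pullbackForm orbitForm φ =ᶠ[𝓝 u]
        fun q => (extDeriv η (φ q)).compContinuousLinearMap (fderiv ℂ φ q) := by
      filter_upwards [hnear U φ hU hφ u hu v hv] with q hq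
      ext s
      have ht := fun i => fderiv_mem_tangentVectors hU hφ hS hq.1 (s i)
      have h3 : fderiv ℂ φ q ∘ s = ![fderiv ℂ φ q (s 0), fderiv ℂ φ q (s 1)] := by
        ext i : 1
        fin_cases i <;> rfl
      change orbitForm (φ q) (fderiv ℂ φ q ∘ s) = extDeriv η (φ q) (fderiv ℂ φ q ∘ s)
      rw [h3, (orbitForm_eq_extDeriv (hS hq.1) hq.2 (ht 0) (ht 1)).1]
    have hηan : AnalyticAt ℂ η (φ u) := analyticAt_krylovForm _ hv
    have hext : DifferentiableAt ℂ (extDeriv η) (φ u) :=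
      (ContinuousAlternatingMap.alternatizeUncurryFinCLM ℂ (Mat n) ℂ).differentiableAt.comp (φ u)
        hηan.fderiv.differentiableAt
    rw [heq.extDeriv_eq, extDeriv_pullback hext ((hφ u hu).contDiffAt (n := ⊤)) (by simp),
      extDeriv_extDeriv_apply (hηan.contDiffAt (n := ⊤)) (by simp)]
    rfl
  · intro y hy u hu h
    obtain ⟨a, rfl⟩ := (htan y hy u).1 hu
    refine traceDual_injective ?_
    ext b
    have h1 := h (adMap y b) ((htan y hy _).2 ⟨b, rfl⟩)
    rw [orbitForm_adMap, trace_mul_commutator_eq_neg, neg_eq_zero] at h1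
    rw [traceDual_apply, map_zero]
    exact h1

end OrbitForm

/-! ### The Gelfand-Zeitlin distribution -/

section Distribution

variable {n : ℕ}

/-- The distribution spanned by the vector fields generating the Gelfand-Zeitlin action. -/
noncomputable def gzDistribution (y : Mat n) : Submodule ℂ (Mat n) :=
  Submodule.span ℂ (Set.range fun i : GZIndex n => hamiltonianField (traceFun i) y)

theorem hamiltonianField_traceFun_eq_adMap (i : GZIndex n) (y : Mat n) :
    hamiltonianField (traceFun i) y = adMap y (traceFunGrad i y) :=
  hamiltonianField_traceFun i y

theorem gzDistribution_eq_map (y : Mat n) :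
    gzDistribution y =
      (Submodule.span ℂ (Set.range fun i : GZIndex n => traceFunGrad i y)).map (adMap y) := by
  rw [Submodule.map_span, ← Set.range_comp, gzDistribution]
  congr 2
  funext i
  exact hamiltonianField_traceFun_eq_adMap i y

/-- The functions `f_{k,m}`, which are constant on the orbits of the action. -/
noncomputable def charCoeffs (y : Mat n) : ((m : Fin n) × Fin (m + 1)) → ℂ :=
  fun i => charCoeff i y

theorem analyticAt_charCoeffs (y : Mat n) : AnalyticAt ℂ charCoeffs y :=
  AnalyticAt.pi fun i => analyticAt_charCoeff i y

theorem fderiv_charCoeffs_apply (y v : Mat n) (i : (m : Fin n) × Fin (m + 1)) :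
    fderiv ℂ charCoeffs y v i = fderiv ℂ (charCoeff i) y v := by
  have h : HasFDerivAt charCoeffs (ContinuousLinearMap.pi fun i : (m : Fin n) × Fin (m + 1) =>
      fderiv ℂ (charCoeff i) y) y :=
    hasFDerivAt_pi.2 fun i => (analyticAt_charCoeff i y).differentiableAt.hasFDerivAt
  rw [h.fderiv]
  rfl

theorem fderiv_charCoeffs_eq_zero_iff (y v : Mat n) :
    fderiv ℂ charCoeffs y v = 0 ↔
      ∀ (m : Fin n) (j : Fin (m + 1)), (cornerPow (n := n) (m + 1) j y * v).trace = 0 := by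
  rw [funext_iff]
  simp only [fderiv_charCoeffs_apply, Pi.zero_apply, Sigma.forall]
  exact forall_congr' fun m => forall_fderiv_charCoeff_eq_zero_iff m y v

theorem charCoeffs_gzAction (a : GZIndex n → ℂ) (y : Mat n) :
    charCoeffs (gzAction a y) = charCoeffs y :=
  funext fun i => charCoeff_gzAction i a y

theorem analyticAt_gzAction (p : (GZIndex n → ℂ) × Mat n) :
    AnalyticAt ℂ (fun p : (GZIndex n → ℂ) × Mat n => gzAction p.1 p.2) p :=
  (isGZAction_gzAction n).holomorphic p trivial

theorem analyticAt_gzAction_left (y : Mat n) (a : GZIndex n → ℂ) :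
    AnalyticAt ℂ (fun a => gzAction a y) a :=
  AnalyticAt.comp (f := fun a : GZIndex n → ℂ => (a, y)) (analyticAt_gzAction (a, y))
    (analyticAt_id.prod analyticAt_const)

theorem analyticAt_gzAction_right (a : GZIndex n → ℂ) (y : Mat n) :
    AnalyticAt ℂ (gzAction a) y :=
  AnalyticAt.comp (f := fun y : Mat n => (a, y)) (analyticAt_gzAction (a, y))
    (analyticAt_const.prod analyticAt_id)

/-- The infinitesimal action at `y`, with the distribution as its range. -/
noncomputable def gzInfinitesimal (y : Mat n) : (GZIndex n → ℂ) →L[ℂ] Mat n :=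
  LinearMap.toContinuousLinearMap
    (Fintype.linearCombination ℂ fun i : GZIndex n => hamiltonianField (traceFun i) y)

theorem range_gzInfinitesimal (y : Mat n) :
    LinearMap.range (gzInfinitesimal y).toLinearMap = gzDistribution y :=
  Fintype.range_linearCombination ℂ _

theorem hasFDerivAt_gzAction (y : Mat n) :
    HasFDerivAt (fun a => gzAction a y) (gzInfinitesimal y) 0 :=
  hasFDerivAt_zero_of_forall_hasDerivAt_smul (analyticAt_gzAction_left y 0).differentiableAt
    fun a => (isGZAction_gzAction n).generator a y

theorem fderiv_charCoeffs_gzInfinitesimal (y : Mat n) (a : GZIndex n → ℂ) :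
    fderiv ℂ charCoeffs y (gzInfinitesimal y a) = 0 := by
  have h1 : HasFDerivAt charCoeffs (fderiv ℂ charCoeffs y) (gzAction 0 y) := by
    rw [gzAction_zero]
    exact (analyticAt_charCoeffs y).differentiableAt.hasFDerivAt
  have h2 := h1.comp (0 : GZIndex n → ℂ) (hasFDerivAt_gzAction y)
  have h3 : HasFDerivAt (charCoeffs ∘ fun a => gzAction a y)
      (0 : (GZIndex n → ℂ) →L[ℂ] _) 0 :=
    (hasFDerivAt_const (charCoeffs y) (0 : GZIndex n → ℂ)).congr_of_eventuallyEq
      (Filter.Eventually.of_forall fun a => charCoeffs_gzAction a y)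
  exact congrArg (fun L : (GZIndex n → ℂ) →L[ℂ] _ => L a) (h2.unique h3)

theorem gzDistribution_le_ker (y : Mat n) :
    gzDistribution y ≤ LinearMap.ker (fderiv ℂ charCoeffs y).toLinearMap := by
  rw [← range_gzInfinitesimal]
  rintro _ ⟨a, rfl⟩
  exact fderiv_charCoeffs_gzInfinitesimal y a

theorem card_sigma_fin_succ (N : ℕ) : Fintype.card ((m : Fin N) × Fin (m + 1)) = dd N := by
  rw [Fintype.card_sigma]
  simp only [Fintype.card_fin]
  rw [Fin.sum_univ_eq_sum_range (fun m => m + 1), dd]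
  induction N with
  | zero => rfl
  | succ N ih =>
    obtain ⟨c, hc⟩ : 2 ∣ N * (N + 1) := (Nat.even_mul_succ_self N).two_dvd
    have h2 : (N + 1) * (N + 1 + 1) = N * (N + 1) + 2 * (N + 1) := by ring
    rw [Finset.sum_range_succ, ih, h2]
    omega

theorem card_gzIndex (n : ℕ) : Fintype.card (GZIndex n) = dd (n - 1) := card_sigma_fin_succ (n - 1)

/-- At a strongly regular matrix, the gradients of the functions of the proper corners are
independent of the centralizer, which is spanned by the gradients of those of the full matrix. -/
theorem IsStronglyRegular.linearIndependent_hamiltonianField {y : Mat n} (hy : IsStronglyRegular y) :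
    LinearIndependent ℂ fun i : GZIndex n => hamiltonianField (traceFun i) y := by
  set e : GZIndex n ⊕ Fin n → (m : Fin n) × Fin (m + 1) := Sum.elim
    (fun i => ⟨⟨i.1, by omega⟩, ⟨i.1 - i.2, by simp only; omega⟩⟩)
    (fun j => ⟨⟨n - 1, by have := j.isLt; omega⟩, ⟨j, by simp only; omega⟩⟩) with he
  have heinj : Function.Injective e := by
    have key : ∀ p q : (m : Fin n) × Fin (m + 1), p = q → (p.1 : ℕ) = q.1 ∧ (p.2 : ℕ) = q.2 := by
      rintro p _ rfl
      exact ⟨rfl, rfl⟩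
    rintro (i | i) (j | j) hij <;> obtain ⟨h1, h2⟩ := key _ _ hij
    · obtain ⟨⟨a, ha⟩, ⟨b, hb⟩⟩ := i
      obtain ⟨⟨a', ha'⟩, ⟨b', hb'⟩⟩ := j
      change a = a' at h1
      change a - b = a' - b' at h2
      simp only at hb hb'
      subst h1
      have : b = b' := by omega
      subst this
      rfl
    · have := i.1.isLt
      change (i.1 : ℕ) = n - 1 at h1
      omega
    · have := j.1.isLt
      change n - 1 = (j.1 : ℕ) at h1
      omega
    · rw [Fin.ext (show (i : ℕ) = j from h2)]
  have hli := (isStronglyRegular_iff.1 hy).comp e heinj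
  obtain ⟨h1, -, h3⟩ := linearIndependent_sum.1 hli
  have hG : (fun i : GZIndex n => traceFunGrad i y) =
      ((fun i : (m : Fin n) × Fin (m + 1) => cornerPow (n := n) (i.1 + 1) i.2 y) ∘ e) ∘ Sum.inl :=
    rfl
  have hP : (fun j : Fin n => y ^ (j : ℕ)) =
      ((fun i : (m : Fin n) × Fin (m + 1) => cornerPow (n := n) (i.1 + 1) i.2 y) ∘ e) ∘ Sum.inr := by
    funext j
    have hn : n - 1 + 1 = n := by have := j.isLt; omega
    change y ^ (j : ℕ) = cornerPow (n - 1 + 1) j y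
    rw [hn, cornerPow_top]
  rw [← hG] at h1 h3
  rw [← hP] at h3
  have h4 : (fun i : GZIndex n => hamiltonianField (traceFun i) y) =
      adMap y ∘ fun i => traceFunGrad i y :=
    funext fun i => hamiltonianField_traceFun_eq_adMap i y
  rw [h4]
  refine h1.map (h3.mono_right fun a ha => hy.isRegularMat.mem_span_pow ?_)
  rw [ker_adMap] at ha
  exact mem_centralizer_singleton.1 ha

theorem IsStronglyRegular.gzInfinitesimal_injective {y : Mat n} (hy : IsStronglyRegular y) :
    Function.Injective (gzInfinitesimal y) :=
  hy.linearIndependent_hamiltonianField.fintypeLinearCombination_injective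

/-- The common kernel of `d(n)` independent functionals has codimension `d(n)`. -/
theorem finrank_ker_fderiv_charCoeffs {y : Mat n} (hy : IsStronglyRegular y) :
    dd n + Module.finrank ℂ (LinearMap.ker (fderiv ℂ charCoeffs y).toLinearMap) = n * n := by
  have hy' : LinearIndependent ℂ fun i : (m : Fin n) × Fin (m + 1) => fderiv ℂ (charCoeff i) y := hy
  have hli : LinearIndependent ℂ fun i : (m : Fin n) × Fin (m + 1) =>
      ((fderiv ℂ (charCoeff i) y).toLinearMap : Module.Dual ℂ (Mat n)) :=
    hy'.map' (ContinuousLinearMap.coeLM ℂ)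
      (LinearMap.ker_eq_bot.2 ContinuousLinearMap.coe_injective)
  have h1 := Subspace.finrank_add_finrank_dualCoannihilator_eq
    (Submodule.span ℂ (Set.range fun i : (m : Fin n) × Fin (m + 1) =>
      ((fderiv ℂ (charCoeff i) y).toLinearMap : Module.Dual ℂ (Mat n))))
  have h2 : (Submodule.span ℂ (Set.range fun i : (m : Fin n) × Fin (m + 1) =>
      ((fderiv ℂ (charCoeff i) y).toLinearMap : Module.Dual ℂ (Mat n)))).dualCoannihilator =
      LinearMap.ker (fderiv ℂ charCoeffs y).toLinearMap := by
    ext v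
    rw [Submodule.mem_dualCoannihilator, LinearMap.mem_ker]
    constructor
    · intro h
      funext i
      exact (fderiv_charCoeffs_apply y v i).trans (h _ (Submodule.subset_span ⟨i, rfl⟩))
    · intro h φ hφ
      have hle : Submodule.span ℂ (Set.range fun i : (m : Fin n) × Fin (m + 1) =>
          ((fderiv ℂ (charCoeff i) y).toLinearMap : Module.Dual ℂ (Mat n))) ≤
          LinearMap.ker (Module.Dual.eval ℂ (Mat n) v) := by
        rw [Submodule.span_le]
        rintro _ ⟨i, rfl⟩
        exact (fderiv_charCoeffs_apply y v i).symm.trans (congrFun h i)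
      exact hle hφ
  rw [h2, finrank_span_eq_card hli, card_sigma_fin_succ, Module.finrank_matrix, Fintype.card_fin,
    Module.finrank_self, mul_one] at h1
  exact h1

/-- At a strongly regular matrix, the distribution is the common kernel of the differentials of the
`f_{k,m}`: it is contained in it, and has the same dimension. -/
theorem IsStronglyRegular.gzDistribution_eq_ker {y : Mat n} (hy : IsStronglyRegular y) :
    gzDistribution y = LinearMap.ker (fderiv ℂ charCoeffs y).toLinearMap := by
  refine Submodule.eq_of_le_of_finrank_eq (gzDistribution_le_ker y) ?_
  have h1 := finrank_ker_fderiv_charCoeffs hy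
  have h2 : Module.finrank ℂ (gzDistribution y) = dd (n - 1) := by
    rw [gzDistribution, finrank_span_eq_card hy.linearIndependent_hamiltonianField, card_gzIndex]
  have h3 : dd n = dd (n - 1) + n := by
    rw [← card_sigma_fin_succ, ← card_sigma_fin_succ, Fintype.card_sigma, Fintype.card_sigma]
    simp only [Fintype.card_fin]
    rw [Fin.sum_univ_eq_sum_range (fun m => m + 1), Fin.sum_univ_eq_sum_range (fun m => m + 1)]
    rcases n with _ | n
    · rfl
    · rw [Finset.sum_range_succ, Nat.add_sub_cancel]
  have h4 := sq_eq_two_mul_dd_add n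
  rw [h2]
  omega

theorem IsStronglyRegular.mem_gzDistribution_iff {y v : Mat n} (hy : IsStronglyRegular y) :
    v ∈ gzDistribution y ↔ fderiv ℂ charCoeffs y v = 0 := by
  rw [hy.gzDistribution_eq_ker]
  rfl

/-- The map `gzAction a` preserves each `f_{k,m}`, so the differentials at `y` are pullbacks of those
at `gzAction a y`. -/
theorem IsStronglyRegular.gzAction_apply {y : Mat n} (hy : IsStronglyRegular y) (a : GZIndex n → ℂ) :
    IsStronglyRegular (gzAction a y) := by
  have hy' : LinearIndependent ℂ fun i : (m : Fin n) × Fin (m + 1) => fderiv ℂ (charCoeff i) y := hy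
  set D := fderiv ℂ (gzAction a) y with hD
  have h1 : (fun i : (m : Fin n) × Fin (m + 1) => fderiv ℂ (charCoeff i) y) =
      (ContinuousLinearMap.compL ℂ (Mat n) (Mat n) ℂ).flip D ∘
        fun i => fderiv ℂ (charCoeff i) (gzAction a y) := by
    funext i
    have h2 : charCoeff i = charCoeff i ∘ gzAction a :=
      funext fun p => (charCoeff_gzAction i a p).symm
    conv_lhs => rw [h2]
    exact ((analyticAt_charCoeff i _).differentiableAt.hasFDerivAt.comp y
      (analyticAt_gzAction_right a y).differentiableAt.hasFDerivAt).fderiv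
  rw [h1] at hy'
  exact hy'.of_comp ((ContinuousLinearMap.compL ℂ (Mat n) (Mat n) ℂ).flip D).toLinearMap

theorem mapsTo_gzAction_sregOrbit (x : Mat n) (a : GZIndex n → ℂ) :
    Set.MapsTo (gzAction a) (sregOrbit x) (sregOrbit x) := fun y hy =>
  ⟨adjointOrbit_trans hy.1 (gzAction_mem_adjointOrbit a y), hy.2.gzAction_apply a⟩

/-! ### Orbits of the Gelfand-Zeitlin action -/

/-- The orbit of `y` under the Gelfand-Zeitlin action. -/
def gzOrbit (y : Mat n) : Set (Mat n) := Set.range fun a => gzAction a y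

theorem self_mem_gzOrbit (y : Mat n) : y ∈ gzOrbit y := ⟨0, gzAction_zero y⟩

theorem gzAction_mem_gzOrbit {y z : Mat n} (hz : z ∈ gzOrbit y) (a : GZIndex n → ℂ) :
    gzAction a z ∈ gzOrbit y := by
  obtain ⟨b, rfl⟩ := hz
  exact ⟨a + b, gzAction_add a b y⟩

theorem equivalence_mem_gzOrbit : Equivalence fun y z : Mat n => z ∈ gzOrbit y where
  refl := self_mem_gzOrbit
  symm := by
    rintro y _ ⟨a, rfl⟩
    refine ⟨-a, ?_⟩
    change gzAction (-a) (gzAction a y) = y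
    rw [← gzAction_add, neg_add_cancel, gzAction_zero]
  trans := by
    rintro y z _ hz ⟨a, rfl⟩
    exact gzAction_mem_gzOrbit hz a

theorem charCoeffs_eq_of_mem_gzOrbit {y z : Mat n} (hz : z ∈ gzOrbit y) :
    charCoeffs z = charCoeffs y := by
  obtain ⟨a, rfl⟩ := hz
  exact charCoeffs_gzAction a y

theorem IsStronglyRegular.of_mem_gzOrbit {y z : Mat n} (hy : IsStronglyRegular y)
    (hz : z ∈ gzOrbit y) : IsStronglyRegular z := by
  obtain ⟨a, rfl⟩ := hz
  exact hy.gzAction_apply a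

theorem IsStronglyRegular.isComplexSubmanifold_gzOrbit {y : Mat n} (hy : IsStronglyRegular y) :
    IsComplexSubmanifold (gzOrbit y) (dd (n - 1)) := by
  refine isComplexSubmanifold_of_slice (P := fun _ => GZIndex n → ℂ)
    (G := fun _ => ((m : Fin n) × Fin (m + 1)) → ℂ) (T := fun _ => gzAction)
    (D := gzInfinitesimal) (f := fun _ => charCoeffs) (fun _ p _ => analyticAt_gzAction p)
    (fun _ => gzAction_zero) hasFDerivAt_gzAction
    (fun z hz => (hy.of_mem_gzOrbit hz).gzInfinitesimal_injective) analyticAt_charCoeffs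
    (fun _ => charCoeffs_gzAction) ?_ ?_ (fun z hz => gzAction_mem_gzOrbit hz) ?_
  · intro z hz v hv
    rw [range_gzInfinitesimal]
    exact (hy.of_mem_gzOrbit hz).mem_gzDistribution_iff.2 hv
  · intro z _
    rw [Module.finrank_fintype_fun_eq_card, card_gzIndex]
  · intro z hz p hp
    rw [charCoeffs_eq_of_mem_gzOrbit hz, charCoeffs_eq_of_mem_gzOrbit hp]

theorem IsStronglyRegular.tangentVectors_gzOrbit {y z : Mat n} (hy : IsStronglyRegular y)
    (hz : z ∈ gzOrbit y) : tangentVectors (gzOrbit y) z = (gzDistribution z : Set (Mat n)) := by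
  rw [← range_gzInfinitesimal]
  refine tangentVectors_eq_range (T := fun a => gzAction a z) (f := charCoeffs)
    (fun a _ => analyticAt_gzAction_left z a) (gzAction_zero z) (hasFDerivAt_gzAction z)
    (analyticAt_charCoeffs z).differentiableAt ?_ (gzAction_mem_gzOrbit hz) ?_
  · intro v hv
    rw [range_gzInfinitesimal]
    exact (hy.of_mem_gzOrbit hz).mem_gzDistribution_iff.2 hv
  · intro p hp
    rw [charCoeffs_eq_of_mem_gzOrbit hz, charCoeffs_eq_of_mem_gzOrbit hp]

theorem gzOrbit_subset_sregOrbit {x y : Mat n} (hy : y ∈ sregOrbit x) :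
    gzOrbit y ⊆ sregOrbit x := by
  rintro _ ⟨a, rfl⟩
  exact mapsTo_gzAction_sregOrbit x a hy

theorem isConnected_gzOrbit (y : Mat n) : IsConnected (gzOrbit y) :=
  isConnected_range (continuous_iff_continuousAt.2 fun a =>
    (analyticAt_gzAction_left y a).continuousAt)

theorem isIntegralManifold_gzOrbit {x y : Mat n} (hy : y ∈ sregOrbit x) :
    IsIntegralManifold (sregOrbit x) (dd (n - 1)) gzDistribution (gzOrbit y) where
  subset := gzOrbit_subset_sregOrbit hy
  connected := isConnected_gzOrbit y
  submanifold := hy.2.isComplexSubmanifold_gzOrbit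
  tangent := fun _ hz => hy.2.tangentVectors_gzOrbit hz

/-- The `f_{k,m}` are locally constant on an integral manifold, whose points near `z` are
therefore in the orbit of `z`. -/
theorem isLeaf_gzOrbit {x y : Mat n} (hy : y ∈ sregOrbit x) :
    IsLeaf (sregOrbit x) (dd (n - 1)) gzDistribution (gzOrbit y) where
  integral := isIntegralManifold_gzOrbit hy
  maximal := by
    rintro L hL ⟨q, hq, hqL⟩ p hp
    refine equivalence_mem_gzOrbit.trans hq
      (IsPreconnected.subset_of_eventually hL.connected.isPreconnected equivalence_mem_gzOrbit
        (fun z hz => ?_) hqL hp)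
    have hzs : IsStronglyRegular z := (hL.subset hz).2
    have hloc := hL.submanifold.eventually_eq (f := charCoeffs)
      (fun p => (analyticAt_charCoeffs p).differentiableAt) (fun y hy v hv => by
        rw [hL.tangent y hy] at hv
        exact (hL.subset hy).2.mem_gzDistribution_iff.1 hv) hz
    obtain ⟨Φ, hzΦ, -, -, hΦ⟩ := exists_slice_chart (T := gzAction) (f := charCoeffs)
      (fun p _ => analyticAt_gzAction p) gzAction_zero (hasFDerivAt_gzAction z)
      hzs.gzInfinitesimal_injective (analyticAt_charCoeffs z) charCoeffs_gzAction (fun v hv => by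
        rw [range_gzInfinitesimal]
        exact hzs.mem_gzDistribution_iff.2 hv)
    filter_upwards [hloc, nhdsWithin_le_nhds (Φ.open_source.mem_nhds hzΦ)] with p h1 h2
    obtain ⟨a, ha⟩ := (hΦ p h2).2 h1
    exact ⟨a, ha.symm⟩

/-- Conversely, a leaf meets the orbit of each of its points, and two leaves that meet are equal. -/
theorem isLeaf_iff {x : Mat n} (L : Set (Mat n)) :
    IsLeaf (sregOrbit x) (dd (n - 1)) gzDistribution L ↔ ∃ y ∈ sregOrbit x, L = gzOrbit y := by
  constructor
  · intro hL
    obtain ⟨y, hy⟩ := hL.integral.connected.nonempty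
    have hys := hL.integral.subset hy
    exact ⟨y, hys, Set.Subset.antisymm
      ((isLeaf_gzOrbit hys).maximal L hL.integral ⟨y, self_mem_gzOrbit y, hy⟩)
      (hL.maximal _ (isIntegralManifold_gzOrbit hys) ⟨y, hy, self_mem_gzOrbit y⟩)⟩
  · rintro ⟨y, hy, rfl⟩
    exact isLeaf_gzOrbit hy

/-! ### The polarization -/

theorem tangentVectors_sregOrbit {x y : Mat n} (hx : IsRegularMat x) (hy : y ∈ sregOrbit x) :
    tangentVectors (sregOrbit x) y = (LinearMap.range (adMap y) : Set (Mat n)) := by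
  rw [sregOrbit_eq_inter, tangentVectors_inter_isOpen isOpen_isStronglyRegular hy.2,
    hx.tangentVectors_adjointOrbit hy.1]

/-- For a vector `[a, y]` tangent to the orbit, the differentials of the invariants of the full
matrix vanish automatically, so that only the proper corners matter. -/
theorem IsStronglyRegular.adMap_mem_gzDistribution_iff {y : Mat n} (hy : IsStronglyRegular y)
    (a : Mat n) :
    adMap y a ∈ gzDistribution y ↔ ∀ i : GZIndex n, (traceFunGrad i y * adMap y a).trace = 0 := by
  rw [hy.mem_gzDistribution_iff, fderiv_charCoeffs_eq_zero_iff]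
  constructor
  · intro h i
    exact h ⟨i.1, by omega⟩ ⟨i.1 - i.2, by simp only; omega⟩
  · intro h m j
    by_cases hm : (m : ℕ) < n - 1
    · have h1 := h ⟨⟨m, hm⟩, ⟨m - j, by simp only; omega⟩⟩
      have h2 : (m : ℕ) - (m - j) = j := by omega
      change (cornerPow (m + 1) (m - (m - j)) y * adMap y a).trace = 0 at h1
      rwa [h2] at h1
    · have hm' : (m : ℕ) + 1 = n := by omega
      have h1 : cornerPow (n := n) (m + 1) j y = y ^ (j : ℕ) := by
        rw [cornerPow, corner, cornerProj_eq_one hm'.ge, one_mul, mul_one, mul_one]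
      rw [h1, trace_mul_adMap, (Commute.self_pow y j).eq, sub_self, zero_mul,
        Matrix.trace_zero]

/-- For `u = [a, y]` the pairing with the generator of gradient `G` is `ω (u, [G, y]) = - tr (G u)`, so
the orthogonal complement of the distribution is the common kernel of the `d f_{k,m}`. Involutivity
follows from the symmetry of the second derivatives of the `f_{k,m}`. -/
theorem isPolarization_gzDistribution {x : Mat n} (hx : IsRegularMat x) :
    IsPolarization (sregOrbit x) orbitForm (dd (n - 1)) gzDistribution where
  lagrangian := by
    intro y hy u
    have hmem : u ∈ tangentVectors (sregOrbit x) y ↔ u ∈ LinearMap.range (adMap y) := by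
      rw [tangentVectors_sregOrbit hx hy]
      rfl
    have hval : ∀ a b, orbitForm y ![adMap y a, adMap y b] = -(b * adMap y a).trace := fun a b => by
      rw [orbitForm_adMap, trace_mul_commutator_eq_neg, Matrix.trace_mul_comm]
    rw [hmem]
    constructor
    · intro hu
      have hu' := hu
      rw [gzDistribution_eq_map] at hu'
      obtain ⟨a, -, rfl⟩ := hu'
      refine ⟨⟨a, rfl⟩, fun v hv => ?_⟩
      rw [gzDistribution_eq_map] at hv
      obtain ⟨b, hb, rfl⟩ := hv
      have hle : Submodule.span ℂ (Set.range fun i : GZIndex n => traceFunGrad i y) ≤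
          LinearMap.ker ((Matrix.traceLinearMap (Fin n) ℂ ℂ) ∘ₗ
            LinearMap.mulRight ℂ (adMap y a)) := by
        rw [Submodule.span_le]
        rintro _ ⟨i, rfl⟩
        exact (hy.2.adMap_mem_gzDistribution_iff a).1 hu i
      have h1 : (b * adMap y a).trace = 0 := hle hb
      rw [hval, h1, neg_zero]
    · rintro ⟨⟨a, rfl⟩, h⟩
      refine (hy.2.adMap_mem_gzDistribution_iff a).2 fun i => ?_
      have h1 := h (adMap y (traceFunGrad i y))
        (hamiltonianField_traceFun_eq_adMap i y ▸ Submodule.subset_span ⟨i, rfl⟩)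
      rwa [hval, neg_eq_zero] at h1
  holomorphic := by
    intro y _
    set e := (Fintype.equivFinOfCardEq (card_gzIndex n)).symm with he
    refine ⟨Set.univ, fun i => hamiltonianField (traceFun (e i)), isOpen_univ, trivial, ?_, ?_⟩
    · intro i p _
      have h1 := analyticAt_cornerPow (n := n) ((e i).1 + 1) ((e i).1 - (e i).2) p
      have h2 : AnalyticAt ℂ (fun p => traceFunGrad (e i) p * p - p * traceFunGrad (e i) p) p :=
        (h1.fun_mul analyticAt_id).fun_sub (analyticAt_id.fun_mul h1)
      exact h2.congr (Filter.Eventually.of_forall fun q => (hamiltonianField_traceFun _ q).symm)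
    · intro z hz
      refine ⟨hz.1.2.linearIndependent_hamiltonianField.comp e e.injective, ?_⟩
      rw [gzDistribution]
      congr 1
      exact (e.surjective.range_comp fun i => hamiltonianField (traceFun i) z).symm
  involutive := by
    intro U X Y hU hX hY hXY z hz
    -- differentiate `df (Y) = 0` along `X` and `df (X) = 0` along `Y`
    have key : ∀ X Y : Mat n → Mat n, AnalyticOnNhd ℂ Y U →
        (∀ z ∈ sregOrbit x ∩ U, X z ∈ gzDistribution z ∧ Y z ∈ gzDistribution z) →
        fderiv ℂ charCoeffs z (fderiv ℂ Y z (X z)) =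
          -fderiv ℂ (fderiv ℂ charCoeffs) z (X z) (Y z) := by
      intro X Y hY hXY
      have h1 : HasFDerivAt (fun q => fderiv ℂ charCoeffs q (Y q)) _ z :=
        (analyticAt_charCoeffs z).fderiv.differentiableAt.hasFDerivAt.clm_apply
          (hY z hz.2).differentiableAt.hasFDerivAt
      have h0 : ∀ q ∈ sregOrbit x ∩ U, fderiv ℂ charCoeffs q (Y q) = 0 := fun q hq =>
        hq.1.2.mem_gzDistribution_iff.1 (hXY q hq).2
      have hXt : X z ∈ tangentVectors (sregOrbit x ∩ U) z := by
        rw [tangentVectors_inter_isOpen hU hz.2]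
        refine tangentVectors_mono (gzOrbit_subset_sregOrbit hz.1) z ?_
        rw [hz.1.2.tangentVectors_gzOrbit (self_mem_gzOrbit z)]
        exact (hXY z hz).1
      have h2 := fderiv_eq_zero_of_mem_tangentVectors h1.differentiableAt
        (fun q hq => (h0 q hq).trans (h0 z hz).symm) hXt
      rw [h1.fderiv] at h2
      exact eq_neg_of_add_eq_zero_left h2
    have hsymm : IsSymmSndFDerivAt ℂ (charCoeffs (n := n)) z :=
      ((analyticAt_charCoeffs z).contDiffAt (n := ⊤)).isSymmSndFDerivAt_of_omega
    refine hz.1.2.mem_gzDistribution_iff.2 ?_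
    rw [VectorField.lieBracket, map_sub, key X Y hY hXY,
      key Y X hX fun q hq => ⟨(hXY q hq).2, (hXY q hq).1⟩, hsymm (X z) (Y z), sub_self]

end Distribution

end MatrixTopology

theorem theorem3p36 (n : ℕ) (hn : 0 < n) (x : Mat n) :
    ((sregOrbit x).Nonempty ↔ IsRegularMat x) ∧
    (∃ σ, IsGZAction n σ) ∧
    (IsRegularMat x →
      -- an open dense complex submanifold of the orbit
      IsComplexSubmanifold (adjointOrbit x) (2 * dd (n - 1)) ∧
      IsComplexSubmanifold (sregOrbit x) (2 * dd (n - 1)) ∧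
      (∃ U : Set (Mat n), IsOpen U ∧ sregOrbit x = adjointOrbit x ∩ U) ∧
      adjointOrbit x ⊆ closure (sregOrbit x) ∧
      -- the symplectic structure of the orbit
      ∃ ω : Mat n → Mat n [⋀^Fin 2]→L[ℂ] ℂ,
        IsOrbitForm (adjointOrbit x) ω ∧
        IsHolomorphicSymplectic (adjointOrbit x) (2 * dd (n - 1)) ω ∧
        IsHolomorphicSymplectic (sregOrbit x) (2 * dd (n - 1)) ω ∧
        -- the orbits of the group action
        ∀ σ, IsGZAction n σ →
          (∀ a, Set.MapsTo (σ a) (sregOrbit x) (sregOrbit x)) ∧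
          (∀ y ∈ sregOrbit x,
            IsComplexSubmanifold (Set.range fun a => σ a y) (dd (n - 1))) ∧
          ∃ F : Mat n → Submodule ℂ (Mat n),
            IsPolarization (sregOrbit x) ω (dd (n - 1)) F ∧
            ∀ L : Set (Mat n), IsLeaf (sregOrbit x) (dd (n - 1)) F L ↔
              ∃ y ∈ sregOrbit x, L = Set.range fun a => σ a y) := by
  refine ⟨sregOrbit_nonempty_iff x, ⟨gzAction, isGZAction_gzAction n⟩, fun hx => ?_⟩
  have hS := isHolomorphicSymplectic_adjointOrbit hx
  refine ⟨hx.isComplexSubmanifold_adjointOrbit,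
    hx.isComplexSubmanifold_adjointOrbit.inter_isOpen isOpen_isStronglyRegular,
    ⟨_, isOpen_isStronglyRegular, sregOrbit_eq_inter x⟩,
    adjointOrbit_subset_closure_sregOrbit hx, orbitForm, isOrbitForm_orbitForm _, hS,
    hS.inter_isOpen isOpen_isStronglyRegular, fun σ hσ => ?_⟩
  obtain rfl : σ = gzAction := hσ.unique (isGZAction_gzAction n)
  exact ⟨mapsTo_gzAction_sregOrbit x, fun y hy => hy.2.isComplexSubmanifold_gzOrbit,
    gzDistribution, isPolarization_gzDistribution hx, isLeaf_iff⟩
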